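/- **Setting.** Let $w_0:[0,\infty)\to[0,\infty)$ be decreasing, right-continuous and integrable with $\int_0^\infty w_0(x)\,dx=1$. Put $a_0=\sup\{x\ge 0: w_0(x)>0\}\in(0,\infty]$ and $h_0(x)=\int_x^\infty w_0(x')\,dx'$. Assume that $h_0$ is $C^2$ on $[0,a_0)$ (with one-sided derivatives at $0$), and let $$\beta_0(x)=\frac{h_0''(x)\,h_0(x)}{h_0'(x)^2},\qquad 0\le x<a_0 .$$ The LSW system for $w(x,t)$ is $$\frac{\partial w}{\partial t}(x,t)=\Big[1-\Big(\frac{x}{L(t)}\Big)^{1/3}\Big]\frac{\partial w}{\partial x}(x,t),\quad x>0,\ t>0,\qquad \int_0^\infty w(x,t)\,dx=1,$$ where $L(t)>0$ is given by $L(t)^{1/3}=\frac13\int_0^\infty x^{-2/3}w(x,t)\,dx\,\big/\,w(0,t)$. A global solution with initial data $w_0$ is a function $w(x,t)$, $x\ge0$, $t\ge0$, with $w(\cdot,0)=w_0$ such that, for every $t\ge 0$, $w(\cdot,t)$ is nonnegative, decreasing, right-continuous and integrable with $\int_0^\infty w(x,t)\,dx=1$; the function $L$ is continuous on $[0,\infty)$;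 the differential equation holds pointwise at all $x>0$, $t>0$ with $x\ne\sup\{y\ge 0:w(y,t)>0\}$; and $w$ is constant along characteristics, that is, for all $x\ge0$, $t\ge0$ there is a nonnegative solution $x(\cdot)$ of $\frac{dx}{ds}=-\big[1-(x/L(s))^{1/3}\big]$ on $[0,t]$ with $x(t)=x$, and $w(x,t)=w_0(x(0))$. **Proposition.** For every real $\beta_\infty$ there is a constant $C(\beta_\infty)>0$, depending only on $\beta_\infty$, such that for every $w_0$ as above with $\sup\beta_0\le\beta_\infty$ there is a global solution $w$ of the LSW system with initial data $w_0$ which satisfies $$L(t)\le 2L(0)+C(\beta_\infty)\,t\qquad\text{for all } t\ge 0 .$$ -/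

import Mathlib

open Set MeasureTheory

noncomputable section

namespace LSW

/-- The space `E` of integrable nonnegative decreasing functions on `[0,∞)`.  A member is, up to
the factor `w 0`, the function `x ↦ P(X > x)` of a random variable, so it is right continuous.
Only the values on `[0,∞)` matter. -/
structure MemE (w : ℝ → ℝ) : Prop where
  nonneg : ∀ x, 0 ≤ x → 0 ≤ w x
  antitone : AntitoneOn w (Ici 0)
  integrable : IntegrableOn w (Ioi 0)
  rightCont : ∀ x, 0 ≤ x → ContinuousWithinAt w (Ici x) x

/-- `‖X‖_∞` for the random variable `X` associated with `w`: the right end, possibly `∞`, of the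
interval on which `w` is positive. -/
def supportEnd (w : ℝ → ℝ) : EReal :=
  sSup {e : EReal | ∃ x : ℝ, 0 ≤ x ∧ 0 < w x ∧ e = (x : EReal)}

/-- The domain `[0, ‖X‖_∞)` of the beta function. -/
def betaDomain (w : ℝ → ℝ) : Set ℝ :=
  {x : ℝ | 0 ≤ x ∧ (x : EReal) < supportEnd w}

/-- `h(x) = ∫_x^∞ w(x') dx'`. -/
def tail (w : ℝ → ℝ) (x : ℝ) : ℝ := ∫ y in Ioi x, w y

/-- The beta function `h''(x) h(x) / h'(x)^2`; derivatives at `x = 0` are one-sided. -/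
def beta (w : ℝ → ℝ) (x : ℝ) : ℝ :=
  iteratedDerivWithin 2 (tail w) (Ici 0) x * tail w x / (derivWithin (tail w) (Ici 0) x) ^ 2

/-- The parameter `L` with `L^{1/3} = (1/3) ∫_0^∞ x^{-2/3} w(x) dx / w(0)`. -/
def volumeL (w : ℝ → ℝ) : ℝ :=
  ((1 / 3) * (∫ x in Ioi (0 : ℝ), x ^ (-(2 / 3) : ℝ) * w x) / w 0) ^ 3

/-- `X` is a nonnegative solution on `[0,t]` of the characteristic equation
`dX/ds = -[1 - (X / L(s))^{1/3}]`. -/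
def IsCharacteristic (L : ℝ → ℝ) (t : ℝ) (X : ℝ → ℝ) : Prop :=
  ∀ s ∈ Icc 0 t, 0 ≤ X s ∧
    HasDerivWithinAt X (-(1 - (X s / L s) ^ (1 / 3 : ℝ))) (Icc 0 t) s

/-- `w x t` (`x ≥ 0`, `t ≥ 0`) is a global solution of the LSW system with initial data `w₀`,
where `L(t)` is the parameter of `w(·,t)`.

The initial data need not be continuous, let alone differentiable, at the end of its support, so
the transport equation is imposed pointwise at all `x > 0`, `t > 0` off the moving end of the
support, and everywhere in the integrated form that `w` is constant along characteristics. -/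
structure IsGlobalSolution (w₀ : ℝ → ℝ) (w : ℝ → ℝ → ℝ) : Prop where
  initial : ∀ x : ℝ, 0 ≤ x → w x 0 = w₀ x
  memE : ∀ t : ℝ, 0 ≤ t → MemE (fun x => w x t)
  mass : ∀ t : ℝ, 0 ≤ t → ∫ x in Ioi (0 : ℝ), w x t = 1
  L_cont : ContinuousOn (fun t => volumeL (fun x => w x t)) (Ici 0)
  pde : ∀ x t : ℝ, 0 < x → 0 < t → (x : EReal) ≠ supportEnd (fun y => w y t) →
    ∃ wx : ℝ, HasDerivAt (fun y => w y t) wx x ∧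
      HasDerivAt (fun s => w x s)
        ((1 - (x / volumeL (fun y => w y t)) ^ (1 / 3 : ℝ)) * wx) t
  characteristics : ∀ x t : ℝ, 0 ≤ x → 0 ≤ t →
    ∃ X : ℝ → ℝ, IsCharacteristic (fun s => volumeL (fun y => w y s)) t X ∧
      X t = x ∧ w x t = w₀ (X 0)

end LSW

end

noncomputable section

namespace LSW

open Filter Topology

/-! ### Existence for the scalar equation behind the characteristics. -/

section

/-! ### The cube root of the positive part -/

/-! Put `μ = L^{-1/3}` and extend `w₀` by the constant `w₀ 0` to a profile `g` on the line. For a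
given rate `μ` the transported profile is `w(x,t) = g (F_t x)`, where `F_t x = flow μ t x 0` is the
starting point of the characteristic that reaches `x` at time `t`. The cube root is increasing, so
characteristics contract backward in time. This gives uniqueness and stability of `F_t` although the
velocity is not Lipschitz at `0`.

The cube root is also concave, which makes `F_t` convex: its difference quotients are `flowSlope`,
monotone in both end points (`flowSlope_mono`). Convexity propagates the bound on the beta function.
As `(1/w)' = β/h`, the bound `β ≤ B` integrates to `1/w(y) - 1/w(x) ≤ B (y - x) / h(y)`. Composition
with `F_t` multiplies `y - x` by a chord slope `p`, while `p · h(y,t) ≤ h₀(F_t y)`, so the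
inequality holds at time `t` with the same `B` (`inv_profileAt_sub_le`).

While mass is conserved, three facts follow for the mean size `Λ(t) = 1/w(0,t)`. It satisfies `Λ(t)
≤ Λ(0) + B t` (`inv_profileAt_zero_le`). The integral `V = 1/3 ∫ x^{-2/3} w dx` has a positive lower
bound in terms of `Λ` (`cbrt_mul_le_radiusSum`), which bounds `μ = w(0,t)/V` above. Finally
`V/w(0,t) ≤ 3/2 Λ^{1/3}`, hence `L ≤ 27/8 Λ`.

For existence, the relation `μ = w(0,t)/V` is regularised by cutoffs and solved by time delay and
compactness (`exists_selfconsistent_rate`). Mass is conserved as long as the relation holds without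
cutoffs (`mass_balance`), and conserved mass keeps the cutoffs strictly inactive, so a continuity
argument removes them for all time (`exists_isSelfConsistent`).

For the bound on `L`, a time of at least a small multiple of `Λ(0)` allows `Λ(0)` to be absorbed
into `C t`. On shorter times `V` and `Λ` change by so little that `L` cannot double (`volumeL_le`).
-/

/-- The cube root of the positive part. -/
def cbrt (x : ℝ) : ℝ := (max x 0) ^ (1 / 3 : ℝ)

lemma cbrt_nonneg (x : ℝ) : 0 ≤ cbrt x := Real.rpow_nonneg (le_max_right _ _) _

lemma cbrt_mono : Monotone cbrt := fun _ _ h =>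
  Real.rpow_le_rpow (le_max_right _ _) (max_le_max_right 0 h) (by norm_num)

lemma continuous_cbrt : Continuous cbrt :=
  (continuous_id.max continuous_const).rpow_const fun _ => Or.inr (by norm_num)

lemma cbrt_pow_three {x : ℝ} (hx : 0 ≤ x) : cbrt x ^ 3 = x := by
  rw [cbrt, max_eq_left hx, ← Real.rpow_natCast, ← Real.rpow_mul hx]
  norm_num

lemma cbrt_of_nonpos {x : ℝ} (hx : x ≤ 0) : cbrt x = 0 := by
  rw [cbrt, max_eq_right hx, Real.zero_rpow (by norm_num)]

lemma cbrt_eq_rpow {x : ℝ} (hx : 0 ≤ x) : cbrt x = x ^ (1 / 3 : ℝ) := by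
  rw [cbrt, max_eq_left hx]

lemma cbrt_pos {x : ℝ} (hx : 0 < x) : 0 < cbrt x := by
  rw [cbrt_eq_rpow hx.le]; exact Real.rpow_pos_of_pos hx _

lemma cbrt_cube {x : ℝ} (hx : 0 ≤ x) : cbrt (x ^ 3) = x := by
  have h := cbrt_pow_three (pow_nonneg hx 3)
  exact (pow_left_inj₀ (cbrt_nonneg _) hx (by norm_num)).1 h

lemma lt_cbrt_iff {x y : ℝ} (hy : 0 ≤ y) : y < cbrt x ↔ y ^ 3 < x := by
  rcases le_or_gt x 0 with hx | hx
  · rw [cbrt_of_nonpos hx]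
    exact ⟨fun h => absurd h hy.not_gt, fun h => absurd h (hx.trans (pow_nonneg hy 3)).not_gt⟩
  · rw [← pow_lt_pow_iff_left₀ hy (cbrt_nonneg x) (n := 3) (by norm_num), cbrt_pow_three hx.le]

lemma cbrt_add_le {x y : ℝ} (hx : 0 ≤ x) (hy : 0 ≤ y) : cbrt (x + y) ≤ cbrt x + cbrt y := by
  rw [cbrt_eq_rpow hx, cbrt_eq_rpow hy, cbrt_eq_rpow (add_nonneg hx hy)]
  exact Real.rpow_add_le_add_rpow hx hy (by norm_num) (by norm_num)

/-- The derivative of the cube root is written in terms of the cube root itself. -/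
lemma hasDerivAt_cbrt {x : ℝ} (hx : 0 < x) : HasDerivAt cbrt (1 / (3 * cbrt x ^ 2)) x := by
  have h := Real.hasDerivAt_rpow_const (x := x) (p := 1 / 3) (Or.inl hx.ne')
  have h2 : (1 / 3 : ℝ) * x ^ (1 / 3 - 1 : ℝ) = 1 / (3 * cbrt x ^ 2) := by
    rw [cbrt_eq_rpow hx.le, ← Real.rpow_natCast, ← Real.rpow_mul hx.le,
      show (1 / 3 - 1 : ℝ) = -(1 / 3 * (2 : ℕ)) by norm_num, Real.rpow_neg hx.le]
    field_simp
  rw [h2] at h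
  refine h.congr_of_eventuallyEq ?_
  filter_upwards [lt_mem_nhds hx] with y hy
  exact cbrt_eq_rpow hy.le

lemma cbrt_sub_eq {x y : ℝ} (hx : 0 ≤ x) (hy : 0 ≤ y) (h : 0 < x ∨ 0 < y) :
    cbrt x - cbrt y = (x - y) / (cbrt x ^ 2 + cbrt x * cbrt y + cbrt y ^ 2) := by
  have h1 := cbrt_nonneg x
  have h2 := cbrt_nonneg y
  have h0 : 0 < cbrt x ^ 2 + cbrt x * cbrt y + cbrt y ^ 2 := by
    rcases h with h | h <;> have := cbrt_pos h <;> positivity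
  rw [eq_div_iff h0.ne']
  linear_combination cbrt_pow_three hx - cbrt_pow_three hy

/-! ### A comparison principle -/

/-- The right side plus `η (1 + (s - a))` is a positive barrier growing strictly faster than `g`. At
a contact point `D` is therefore positive, which is why the derivative bound is needed only there.
-/
lemma le_add_integral_of_deriv_le_of_pos {D D' g : ℝ → ℝ} {a b : ℝ}
    (hD : ContinuousOn D (Icc a b))
    (hD' : ∀ s ∈ Ico a b, HasDerivWithinAt D (D' s) (Ici s) s)
    (hg : Continuous g) (hg0 : ∀ s, 0 ≤ g s)
    (h : ∀ s ∈ Ico a b, 0 < D s → D' s ≤ g s) {s : ℝ} (hs : s ∈ Icc a b) :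
    D s ≤ max (D a) 0 + ∫ u in a..s, g u := by
  have key : ∀ η > 0, D s ≤ max (D a) 0 + (∫ u in a..s, g u) + η * (1 + (s - a)) := by
    intro η hη
    have hB : ∀ x, HasDerivAt (fun x => max (D a) 0 + (∫ u in a..x, g u) + η * (1 + (x - a)))
        (g x + η) x := by
      intro x
      have h1 := (hg.integral_hasStrictDerivAt a x).hasDerivAt.const_add (max (D a) 0)
      have h2 := (((hasDerivAt_id x).sub_const a).const_add 1).const_mul η
      simpa [Pi.add_def] using h1.fun_add h2
    refine image_le_of_deriv_right_lt_deriv_boundary' hD hD' ?_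
      (fun x _ => (hB x).continuousAt.continuousWithinAt) (fun x _ => (hB x).hasDerivWithinAt) ?_ hs
    · simp only [intervalIntegral.integral_same, sub_self]
      linarith [le_max_left (D a) 0]
    · intro x hx hDx
      have : 0 < D x := by
        rw [hDx]
        have h1 : 0 ≤ ∫ u in a..x, g u := intervalIntegral.integral_nonneg hx.1 fun u _ => hg0 u
        have h2 : 0 < η * (1 + (x - a)) := by have := hx.1; apply mul_pos hη; linarith
        linarith [le_max_right (D a) 0]
      linarith [h x hx this]
  have hc : 0 ≤ s - a := sub_nonneg.2 hs.1
  refine le_of_forall_pos_le_add fun η hη => ?_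
  have := key (η / (1 + (s - a))) (by positivity)
  rwa [div_mul_cancel₀ _ (by positivity)] at this

/-! ### Solutions of `y' = 1 - ν y^{1/3}` -/

/-- The cube root cut off below `ε` and above `R`. -/
def clipCbrt (ε R y : ℝ) : ℝ := cbrt (min (max y ε) R)

lemma clipCbrt_nonneg (ε R y : ℝ) : 0 ≤ clipCbrt ε R y := cbrt_nonneg _

lemma clipCbrt_mono (ε R : ℝ) : Monotone (clipCbrt ε R) := fun _ _ h =>
  cbrt_mono (min_le_min_right _ (max_le_max_right _ h))

lemma continuous_clipCbrt (R : ℝ) : Continuous fun p : ℝ × ℝ => clipCbrt p.1 R p.2 :=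
  continuous_cbrt.comp ((continuous_snd.max continuous_fst).min continuous_const)

lemma clipCbrt_le (ε R y : ℝ) : clipCbrt ε R y ≤ cbrt R := cbrt_mono (min_le_right _ _)

/-- By subadditivity of the cube root, lowering the cutoff costs at most `cbrt ε`, uniformly in `y`.
-/
lemma clipCbrt_le_add {ε ε' R : ℝ} (hε : 0 ≤ ε) (hε' : 0 ≤ ε') (hR : 0 ≤ R) (y : ℝ) :
    clipCbrt ε R y ≤ clipCbrt ε' R y + cbrt ε := by
  refine le_trans (cbrt_mono ?_) (cbrt_add_le (le_min (le_max_of_le_right hε') hR) hε)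
  rcases le_total y ε with h | h
  · rw [max_eq_right h]
    have h1 : 0 ≤ min (max y ε') R := le_min (le_max_of_le_right hε') hR
    linarith [min_le_left ε R]
  · rw [max_eq_left h]
    have : min y R ≤ min (max y ε') R := min_le_min_right _ (le_max_left _ _)
    linarith

lemma clipCbrt_lipschitz {ε R : ℝ} (hε : 0 < ε) (hR : ε ≤ R) (x y : ℝ) :
    |clipCbrt ε R x - clipCbrt ε R y| ≤ (1 / cbrt ε ^ 2) * |x - y| := by
  have he := cbrt_pos hε
  have hx : ε ≤ min (max x ε) R := le_min (le_max_right _ _) hR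
  have hy : ε ≤ min (max y ε) R := le_min (le_max_right _ _) hR
  have h1 : |min (max x ε) R - min (max y ε) R| ≤ |x - y| :=
    (abs_min_sub_min_le_max _ _ _ _).trans (by
      simp only [sub_self, abs_zero]
      refine max_le ((abs_max_sub_max_le_max _ _ _ _).trans ?_) (abs_nonneg _)
      simp)
  rw [clipCbrt, clipCbrt, cbrt_sub_eq (hε.le.trans hx) (hε.le.trans hy)
    (Or.inl (hε.trans_le hx)), abs_div]
  have h2 : cbrt ε ^ 2 ≤ |cbrt (min (max x ε) R) ^ 2 +
      cbrt (min (max x ε) R) * cbrt (min (max y ε) R) + cbrt (min (max y ε) R) ^ 2| := by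
    refine le_trans ?_ (le_abs_self _)
    have := pow_le_pow_left₀ he.le (cbrt_mono hx) 2
    have := mul_nonneg (cbrt_nonneg (min (max x ε) R)) (cbrt_nonneg (min (max y ε) R))
    nlinarith [sq_nonneg (cbrt (min (max y ε) R))]
  calc _ ≤ |x - y| / cbrt ε ^ 2 := div_le_div₀ (abs_nonneg _) h1 (by positivity) h2
    _ = _ := by ring

/-- The cutoffs make the right side bounded and globally Lipschitz in `y`, so a Picard–Lindelöf ball
of radius speed times `T` covers all of `[0,T]`. -/
lemma exists_clipped_solution {ν : ℝ → ℝ} (hν : Continuous ν) (hν0 : ∀ s, 0 ≤ ν s) {T : ℝ}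
    (hT : 0 ≤ T) (x : ℝ) {ε R : ℝ} (hε : 0 < ε) (hR : ε ≤ R) :
    ∃ Y : ℝ → ℝ, Y 0 = x ∧
      ∀ s ∈ Icc 0 T, HasDerivWithinAt Y (1 - ν s * clipCbrt ε R (Y s)) (Icc 0 T) s := by
  obtain ⟨M, hM⟩ := (isCompact_Icc (a := (0 : ℝ)) (b := T)).bddAbove_image hν.continuousOn
  have hM' : ∀ s ∈ Icc 0 T, ν s ≤ M := fun s hs => hM ⟨s, hs, rfl⟩
  have hM0 : 0 ≤ M := (hν0 0).trans (hM' 0 ⟨le_rfl, hT⟩)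
  have hK : 0 ≤ 1 + M * cbrt R := by have := mul_nonneg hM0 (cbrt_nonneg R); linarith
  have hL : 0 ≤ M * (1 / cbrt ε ^ 2) := by positivity
  have hpl : IsPicardLindelof (fun s y => 1 - ν s * clipCbrt ε R y) (tmin := 0) (tmax := T)
      ⟨0, le_rfl, hT⟩ x ((1 + M * cbrt R) * T).toNNReal 0 (1 + M * cbrt R).toNNReal
      (M * (1 / cbrt ε ^ 2)).toNNReal := by
    refine ⟨fun s hs => ?_, fun y _ => ?_, fun s hs y _ => ?_, ?_⟩
    · refine LipschitzWith.lipschitzOnWith (LipschitzWith.of_dist_le_mul fun y z => ?_)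
      rw [Real.dist_eq, Real.dist_eq, Real.coe_toNNReal _ hL]
      rw [show (1 - ν s * clipCbrt ε R y) - (1 - ν s * clipCbrt ε R z) =
        -(ν s * (clipCbrt ε R y - clipCbrt ε R z)) by ring, abs_neg, abs_mul,
        abs_of_nonneg (hν0 s), mul_assoc]
      exact mul_le_mul (hM' s hs) (clipCbrt_lipschitz hε hR y z) (abs_nonneg _) hM0
    · fun_prop
    · rw [Real.norm_eq_abs, Real.coe_toNNReal _ hK]
      have h1 : ν s * clipCbrt ε R y ≤ M * cbrt R :=
        mul_le_mul (hM' s hs) (clipCbrt_le _ _ _) (clipCbrt_nonneg _ _ _) hM0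
      have h2 : 0 ≤ ν s * clipCbrt ε R y := mul_nonneg (hν0 s) (clipCbrt_nonneg _ _ _)
      rw [abs_le]; constructor <;> linarith
    · rw [Real.coe_toNNReal _ hK, Real.coe_toNNReal _ (mul_nonneg hK hT)]
      simp [hT]
  obtain ⟨α, h0, hα⟩ := hpl.exists_eq_forall_mem_Icc_hasDerivWithinAt
    (x := x) (Metric.mem_closedBall_self le_rfl)
  exact ⟨α, h0, hα⟩

lemma hasDerivWithinAt_Ici_of_Icc {f : ℝ → ℝ} {f' a b s : ℝ} (hs : s ∈ Ico a b)
    (h : HasDerivWithinAt f f' (Icc a b) s) : HasDerivWithinAt f f' (Ici s) s :=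
  h.mono_of_mem_nhdsWithin (mem_of_superset (Icc_mem_nhdsGE hs.2) (Icc_subset_Icc_left hs.1))

/-- The right side decreases in `y`, so where `Y > Z` only the change of cutoff can increase `Y -
Z`. The Lipschitz constant, which blows up as the cutoff tends to `0`, does not enter. -/
lemma clipped_solution_sub_le {ν : ℝ → ℝ} (hν0 : ∀ s, 0 ≤ ν s) {T M : ℝ}
    (hM : ∀ s ∈ Icc 0 T, ν s ≤ M) {ε ε' R : ℝ} (hε : 0 ≤ ε) (hε' : 0 ≤ ε') (hR : 0 ≤ R)
    {Y Z : ℝ → ℝ} (h0 : Y 0 = Z 0)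
    (hY : ∀ s ∈ Icc 0 T, HasDerivWithinAt Y (1 - ν s * clipCbrt ε R (Y s)) (Icc 0 T) s)
    (hZ : ∀ s ∈ Icc 0 T, HasDerivWithinAt Z (1 - ν s * clipCbrt ε' R (Z s)) (Icc 0 T) s)
    {s : ℝ} (hs : s ∈ Icc 0 T) : Y s - Z s ≤ T * (M * cbrt ε') := by
  have hM0 : 0 ≤ M := (hν0 s).trans (hM s hs)
  have hc : 0 ≤ M * cbrt ε' := mul_nonneg hM0 (cbrt_nonneg _)
  have hd := fun s hs => (hY s hs).sub (hZ s hs)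
  have := le_add_integral_of_deriv_le_of_pos (D := Y - Z)
    (g := fun _ => M * cbrt ε') (a := 0) (b := T) (fun s hs => (hd s hs).continuousWithinAt)
    (fun s hs => hasDerivWithinAt_Ici_of_Icc hs (hd s (Ico_subset_Icc_self hs))) continuous_const
    (fun _ => hc) ?_ hs
  · simp only [Pi.sub_apply, h0, sub_self, max_self, intervalIntegral.integral_const, sub_zero,
      smul_eq_mul, zero_add] at this
    exact this.trans (mul_le_mul_of_nonneg_right hs.2 hc)
  · intro u hu hpos
    have hlt : Z u ≤ Y u := (sub_pos.1 hpos).le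
    have h1 : clipCbrt ε' R (Z u) - clipCbrt ε R (Y u) ≤ cbrt ε' := by
      have := clipCbrt_le_add hε' hε hR (Z u)
      have := clipCbrt_mono ε R hlt
      linarith
    have h2 := mul_le_mul_of_nonneg_left h1 (hν0 u)
    have h3 := mul_le_mul_of_nonneg_right (hM u (Ico_subset_Icc_self hu)) (cbrt_nonneg ε')
    linarith

lemma exists_solution {ν : ℝ → ℝ} (hν : Continuous ν) (hν0 : ∀ s, 0 ≤ ν s) {T : ℝ}
    (hT : 0 ≤ T) (x : ℝ) :
    ∃ Y : ℝ → ℝ, Continuous Y ∧ Y 0 = x ∧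
      ∀ s ∈ Icc 0 T, HasDerivAt Y (1 - ν s * cbrt (Y s)) s := by
  obtain ⟨M, hM⟩ := (isCompact_Icc (a := (0 : ℝ)) (b := T)).bddAbove_image hν.continuousOn
  have hM' : ∀ s ∈ Icc 0 T, ν s ≤ M := fun s hs => hM ⟨s, hs, rfl⟩
  have hM0 : 0 ≤ M := (hν0 0).trans (hM' 0 ⟨le_rfl, hT⟩)
  -- Solutions have slope at most `1`, so they stay below `|x| + T` and the upper cutoff is never
  -- active in the limit. The extra `1` keeps every `e n` below `R`.
  set R : ℝ := |x| + T + 1 with hRdef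
  have hR1 : 1 ≤ R := by have := abs_nonneg x; linarith
  set e : ℕ → ℝ := fun n => (1 / ((n : ℝ) + 1)) ^ 3 with hedef
  have he0 : ∀ n, 0 < e n := fun n => by positivity
  have hcbe : ∀ n, cbrt (e n) = 1 / ((n : ℝ) + 1) := fun n => cbrt_cube (by positivity)
  have heR : ∀ n, e n ≤ R := fun n => by
    refine le_trans (pow_le_one₀ (by positivity) ?_) hR1
    rw [div_le_one (by positivity)]; have : (0 : ℝ) ≤ n := n.cast_nonneg
    linarith
  choose α hα0 hα using fun n => exists_clipped_solution hν hν0 hT x (he0 n) (heR n)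
  have hcmp : ∀ n m, n ≤ m → ∀ s ∈ Icc 0 T, |α n s - α m s| ≤ T * M * (1 / ((n : ℝ) + 1)) := by
    intro n m hnm s hs
    have h1 := clipped_solution_sub_le hν0 hM' (he0 n).le (he0 m).le (by linarith)
      ((hα0 n).trans (hα0 m).symm) (hα n) (hα m) hs
    have h2 := clipped_solution_sub_le hν0 hM' (he0 m).le (he0 n).le (by linarith)
      ((hα0 m).trans (hα0 n).symm) (hα m) (hα n) hs
    rw [hcbe] at h1 h2
    have h3 : 1 / ((m : ℝ) + 1) ≤ 1 / ((n : ℝ) + 1) :=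
      one_div_le_one_div_of_le (by positivity) (by gcongr)
    have h4 : T * (M * (1 / ((m : ℝ) + 1))) ≤ T * (M * (1 / ((n : ℝ) + 1))) := by gcongr
    rw [abs_le]; constructor <;> linarith
  have hlim0 : Tendsto (fun n : ℕ => T * M * (1 / ((n : ℝ) + 1))) atTop (𝓝 0) := by
    simpa using tendsto_one_div_add_atTop_nhds_zero_nat.const_mul (T * M)
  have hex : ∀ s ∈ Icc 0 T, ∃ l, Tendsto (fun n => α n s) atTop (𝓝 l) := fun s hs =>
    cauchySeq_tendsto_of_complete (cauchySeq_of_le_tendsto_0' _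
      (fun n m hnm => by rw [Real.dist_eq]; exact hcmp n m hnm s hs) hlim0)
  choose! A hA using hex
  have hAle : ∀ n, ∀ s ∈ Icc 0 T, |α n s - A s| ≤ T * M * (1 / ((n : ℝ) + 1)) := by
    intro n s hs
    refine le_of_tendsto ((tendsto_const_nhds.sub (hA s hs)).abs) ?_
    filter_upwards [eventually_ge_atTop n] with m hm using hcmp n m hm s hs
  have hAc : ContinuousOn A (Icc 0 T) := by
    have hu : TendstoUniformlyOn α A atTop (Icc 0 T) := by
      rw [Metric.tendstoUniformlyOn_iff]
      intro η hη
      filter_upwards [hlim0.eventually (gt_mem_nhds hη)] with n hn s hs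
      rw [dist_comm, Real.dist_eq]
      exact (hAle n s hs).trans_lt hn
    exact hu.continuousOn (Frequently.of_forall fun n s hs => (hα n s hs).continuousWithinAt)
  have hpr : ∀ s, max 0 (min s T) ∈ Icc 0 T := fun s =>
    ⟨le_max_left _ _, max_le hT (min_le_right _ _)⟩
  have hpr' : ∀ s ∈ Icc 0 T, max 0 (min s T) = s := fun s hs => by
    rw [min_eq_left hs.2, max_eq_right hs.1]
  have hprc : Continuous fun s : ℝ => max 0 (min s T) := by fun_prop
  set Z : ℝ → ℝ := fun s => A (max 0 (min s T)) with hZdef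
  have hZc : Continuous Z := hAc.comp_continuous hprc hpr
  -- `Z` extends the limit by constants outside `[0,T]`. The integral is then differentiable on the
  -- whole line, so the equation holds with two-sided derivatives also at `0` and `T`.
  set Y : ℝ → ℝ := fun s => x + ∫ u in (0 : ℝ)..s, (1 - ν u * clipCbrt 0 R (Z u)) with hYdef
  have hfc : Continuous fun u => 1 - ν u * clipCbrt 0 R (Z u) :=
    continuous_const.sub (hν.mul ((continuous_clipCbrt R).comp (continuous_const.prodMk hZc)))
  have hYd : ∀ s, HasDerivAt Y (1 - ν s * clipCbrt 0 R (Z s)) s := fun s =>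
    (hfc.integral_hasStrictDerivAt 0 s).hasDerivAt.const_add x
  have hYZ : ∀ s ∈ Icc 0 T, Y s = Z s := by
    intro s hs
    have h1 : ∀ n, α n s = x + ∫ u in (0 : ℝ)..s,
        (1 - ν u * clipCbrt (e n) R (α n (max 0 (min u T)))) := by
      intro n
      have hc : Continuous fun u => 1 - ν u * clipCbrt (e n) R (α n (max 0 (min u T))) := by
        have : Continuous fun u => α n (max 0 (min u T)) :=
          ContinuousOn.comp_continuous (fun s hs => (hα n s hs).continuousWithinAt) hprc hpr
        exact continuous_const.sub
          (hν.mul ((continuous_clipCbrt R).comp (continuous_const.prodMk this)))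
      rw [intervalIntegral.integral_eq_sub_of_hasDeriv_right_of_le (f := α n) hs.1
        (fun u hu => ((hα n u ⟨hu.1, hu.2.trans hs.2⟩).continuousWithinAt).mono
          (Icc_subset_Icc_right hs.2)) ?_ (hc.intervalIntegrable _ _), hα0]
      · ring
      · intro u hu
        have hu' : u ∈ Ico 0 T := ⟨hu.1.le, hu.2.trans_le hs.2⟩
        rw [hpr' u (Ico_subset_Icc_self hu')]
        exact (hasDerivWithinAt_Ici_of_Icc hu' (hα n u (Ico_subset_Icc_self hu'))).mono
          Ioi_subset_Ici_self
    have h2 : Tendsto (fun n => α n s) atTop (𝓝 (Y s)) := by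
      simp_rw [h1]
      refine tendsto_const_nhds.add ?_
      refine intervalIntegral.tendsto_integral_filter_of_dominated_convergence
        (fun _ => 1 + M * cbrt R) (Eventually.of_forall fun n => ?_) ?_
        intervalIntegrable_const ?_
      · have hc : Continuous fun u => 1 - ν u * clipCbrt (e n) R (α n (max 0 (min u T))) := by
          have : Continuous fun u => α n (max 0 (min u T)) :=
            ContinuousOn.comp_continuous (fun s hs => (hα n s hs).continuousWithinAt) hprc hpr
          exact continuous_const.sub
            (hν.mul ((continuous_clipCbrt R).comp (continuous_const.prodMk this)))
        exact hc.aestronglyMeasurable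
      · refine Eventually.of_forall fun n => Eventually.of_forall fun u hu => ?_
        rw [uIoc_of_le hs.1] at hu
        have h3 : ν u * clipCbrt (e n) R (α n (max 0 (min u T))) ≤ M * cbrt R :=
          mul_le_mul (hM' u ⟨hu.1.le, hu.2.trans hs.2⟩) (clipCbrt_le _ _ _)
            (clipCbrt_nonneg _ _ _) hM0
        have h4 : 0 ≤ ν u * clipCbrt (e n) R (α n (max 0 (min u T))) :=
          mul_nonneg (hν0 u) (clipCbrt_nonneg _ _ _)
        rw [Real.norm_eq_abs, abs_le]; constructor <;> linarith
      · refine Eventually.of_forall fun u _ => ?_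
        have he : Tendsto e atTop (𝓝 0) := by
          simpa [hedef] using (tendsto_one_div_add_atTop_nhds_zero_nat (𝕜 := ℝ)).pow 3
        exact tendsto_const_nhds.sub (((continuous_clipCbrt R).continuousAt.tendsto.comp
          (he.prodMk_nhds (hA _ (hpr u)))).const_mul _)
    have := tendsto_nhds_unique h2 (hA s hs)
    simpa [hZdef, hpr' s hs] using this
  refine ⟨Y, continuous_iff_continuousAt.2 fun s => (hYd s).continuousAt, by simp [hYdef], ?_⟩
  intro s hs
  have hYR : Y s ≤ R := by
    have h1 : ∫ u in (0 : ℝ)..s, (1 - ν u * clipCbrt 0 R (Z u)) ≤ ∫ u in (0 : ℝ)..s, (1 : ℝ) := by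
      refine intervalIntegral.integral_mono hs.1 (hfc.intervalIntegrable _ _)
        intervalIntegrable_const fun u => ?_
      have := mul_nonneg (hν0 u) (clipCbrt_nonneg 0 R (Z u))
      simpa using this
    rw [intervalIntegral.integral_const] at h1
    simp only [sub_zero, smul_eq_mul, mul_one] at h1
    have := le_abs_self x
    have := hs.2
    simp only [hYdef]
    linarith
  have h := hYd s
  rw [← hYZ s hs, clipCbrt, min_eq_left (max_le hYR (by linarith))] at h
  convert h using 3
  simp [cbrt]

end

/-! ### The flow of the characteristics, backward in time. -/

section

/-! ### Continuation inequalities -/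

lemma le_add_integral_of_neg_le_deriv_of_pos {D D' g : ℝ → ℝ} {a b : ℝ}
    (hD : ∀ s ∈ Icc a b, HasDerivAt D (D' s) s)
    (hg : Continuous g) (hg0 : ∀ s, 0 ≤ g s)
    (h : ∀ s ∈ Icc a b, 0 < D s → -g s ≤ D' s) {s : ℝ} (hs : s ∈ Icc a b) :
    D s ≤ max (D b) 0 + ∫ u in s..b, g u := by
  have hmem : ∀ u ∈ Icc a b, a + b - u ∈ Icc a b := fun u hu =>
    ⟨by linarith [hu.2], by linarith [hu.1]⟩
  have hd : ∀ u ∈ Icc a b, HasDerivAt (fun u => D (a + b - u)) (-D' (a + b - u)) u := fun u hu => by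
    simpa using (hD _ (hmem u hu)).comp_const_sub (a + b) u
  have := le_add_integral_of_deriv_le_of_pos (D := fun u => D (a + b - u))
    (g := fun u => g (a + b - u)) (fun u hu => (hd u hu).continuousAt.continuousWithinAt)
    (fun u hu => (hd u (Ico_subset_Icc_self hu)).hasDerivWithinAt)
    (hg.comp (by fun_prop)) (fun _ => hg0 _)
    (fun u hu hpos => by
      have := h _ (hmem u (Ico_subset_Icc_self hu)) hpos
      linarith) (hmem s hs)
  simpa [intervalIntegral.integral_comp_sub_left (fun u => g u) (a + b)] using this

/-! ### Characteristics -/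

/-- A nonnegative continuous rate; it plays the role of `L^{-1/3}`. -/
structure Rate where
  /-- The underlying function. -/
  toFun : ℝ → ℝ
  continuous_toFun : Continuous toFun
  nonneg_toFun : ∀ s, 0 ≤ toFun s

instance : CoeFun Rate fun _ => ℝ → ℝ := ⟨Rate.toFun⟩

lemma Rate.continuous (μ : Rate) : Continuous μ := μ.continuous_toFun

lemma Rate.nonneg (μ : Rate) (s : ℝ) : 0 ≤ μ s := μ.nonneg_toFun s

/-- `X` solves the characteristic equation, extended to negative values, on `[0,t]`. -/
def IsTrajectory (μ : Rate) (t : ℝ) (X : ℝ → ℝ) : Prop :=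
  ∀ s ∈ Icc 0 t, HasDerivAt X (-1 + μ s * cbrt (X s)) s

lemma IsTrajectory.mono {μ : Rate} {t t' : ℝ} {X : ℝ → ℝ} (h : IsTrajectory μ t X)
    (ht : t' ≤ t) : IsTrajectory μ t' X := fun s hs => h s ⟨hs.1, hs.2.trans ht⟩

/-- Time reversal turns the characteristic equation into `y' = 1 - ν y^{1/3}`, whose right side
decreases in `y`. -/
lemma exists_trajectory (μ : Rate) {t : ℝ} (ht : 0 ≤ t) (x : ℝ) :
    ∃ X : ℝ → ℝ, Continuous X ∧ X t = x ∧ IsTrajectory μ t X := by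
  obtain ⟨Y, hYc, hY0, hY⟩ := exists_solution (ν := fun s => μ (t - s))
    (μ.continuous.comp (by fun_prop)) (fun _ => μ.nonneg _) ht x
  refine ⟨fun s => Y (t - s), by fun_prop, by simpa using hY0, fun s hs => ?_⟩
  have := (hY (t - s) ⟨by linarith [hs.2], by linarith [hs.1]⟩).comp_const_sub t s
  refine this.congr_deriv ?_
  simp only [sub_sub_cancel]
  ring

/-- The characteristic through `x` at time `t`, as a function of time. -/
def flow (μ : Rate) (t x : ℝ) : ℝ → ℝ :=
  if h : 0 ≤ t then (exists_trajectory μ h x).choose else fun _ => x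

variable {μ : Rate} {t : ℝ}

lemma continuous_flow (ht : 0 ≤ t) (x : ℝ) : Continuous (flow μ t x) := by
  rw [flow, dif_pos ht]; exact (exists_trajectory μ ht x).choose_spec.1

lemma flow_self (ht : 0 ≤ t) (x : ℝ) : flow μ t x t = x := by
  rw [flow, dif_pos ht]; exact (exists_trajectory μ ht x).choose_spec.2.1

lemma isTrajectory_flow (ht : 0 ≤ t) (x : ℝ) : IsTrajectory μ t (flow μ t x) := by
  rw [flow, dif_pos ht]; exact (exists_trajectory μ ht x).choose_spec.2.2

/-- Where `X > Y`, monotonicity of the cube root gives `(X - Y)' ≥ (μ - μ') cbrt Y`. Going back in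
time, only the difference of the rates can push `X` above `Y`. -/
lemma IsTrajectory.sub_le {μ' : Rate} {X Y : ℝ → ℝ} (hX : IsTrajectory μ t X)
    (hY : IsTrajectory μ' t Y) (hYc : Continuous Y) {s : ℝ} (hs : s ∈ Icc 0 t) :
    X s - Y s ≤ max (X t - Y t) 0 + ∫ u in s..t, |μ u - μ' u| * cbrt (Y u) := by
  refine le_add_integral_of_neg_le_deriv_of_pos (D := fun s => X s - Y s)
    (fun s hs => (hX s hs).sub (hY s hs))
    (g := fun u => |μ u - μ' u| * cbrt (Y u))
    ((μ.continuous.sub μ'.continuous).abs.mul (continuous_cbrt.comp hYc))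
    (fun _ => mul_nonneg (abs_nonneg _) (cbrt_nonneg _)) (fun u _ hpos => ?_) hs
  have h1 := mul_le_mul_of_nonneg_left (cbrt_mono (sub_pos.1 hpos).le) (μ.nonneg u)
  have h2 := mul_le_mul_of_nonneg_right (neg_abs_le (μ u - μ' u)) (cbrt_nonneg (Y u))
  linarith

/-- For a common rate the gap between trajectories does not decrease in time. Backward uniqueness,
order and the Lipschitz constant `1` of the flow come from here. -/
lemma IsTrajectory.sub_le_max {X Y : ℝ → ℝ} (hX : IsTrajectory μ t X)
    (hY : IsTrajectory μ t Y) {s : ℝ} (hs : s ∈ Icc 0 t) :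
    X s - Y s ≤ max (X t - Y t) 0 := by
  have := le_add_integral_of_neg_le_deriv_of_pos (D := fun s => X s - Y s) (g := fun _ => 0)
    (fun s hs => (hX s hs).sub (hY s hs)) continuous_const (fun _ => le_rfl)
    (fun u _ hpos => ?_) hs
  · simpa using this
  have h1 := mul_le_mul_of_nonneg_left (cbrt_mono (sub_pos.1 hpos).le) (μ.nonneg u)
  linarith

lemma IsTrajectory.le_of_le {X Y : ℝ → ℝ} (hX : IsTrajectory μ t X)
    (hY : IsTrajectory μ t Y) (h : X t ≤ Y t) {s : ℝ} (hs : s ∈ Icc 0 t) : X s ≤ Y s := by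
  have := hX.sub_le_max hY hs
  rw [max_eq_right (sub_nonpos.2 h)] at this
  linarith

lemma IsTrajectory.eq_flow {X : ℝ → ℝ} (hX : IsTrajectory μ t X) {s : ℝ} (hs : s ∈ Icc 0 t) :
    X s = flow μ t (X t) s := by
  have ht := hs.1.trans hs.2
  refine le_antisymm (hX.le_of_le (isTrajectory_flow ht _) ?_ hs)
    ((isTrajectory_flow ht _).le_of_le hX ?_ hs) <;> rw [flow_self ht]

lemma flow_mono {s : ℝ} (hs : s ∈ Icc 0 t) : Monotone fun x => flow μ t x s := fun x y hxy =>
  (isTrajectory_flow (hs.1.trans hs.2) x).le_of_le (isTrajectory_flow (hs.1.trans hs.2) y)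
    (by rwa [flow_self (hs.1.trans hs.2), flow_self (hs.1.trans hs.2)]) hs

lemma abs_flow_sub_le {s : ℝ} (hs : s ∈ Icc 0 t) (x y : ℝ) :
    |flow μ t x s - flow μ t y s| ≤ |x - y| := by
  have ht := hs.1.trans hs.2
  have h1 := (isTrajectory_flow ht x).sub_le_max (isTrajectory_flow (μ := μ) ht y) hs
  have h2 := (isTrajectory_flow ht y).sub_le_max (isTrajectory_flow (μ := μ) ht x) hs
  rw [flow_self ht, flow_self ht] at h1 h2
  have h3 : max (x - y) 0 ≤ |x - y| := max_le (le_abs_self _) (abs_nonneg _)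
  have h4 : max (y - x) 0 ≤ |x - y| := max_le (by rw [abs_sub_comm]; exact le_abs_self _)
    (abs_nonneg _)
  rw [abs_le]; constructor <;> linarith

lemma continuous_flow_left {s : ℝ} (hs : s ∈ Icc 0 t) : Continuous fun x => flow μ t x s :=
  (LipschitzWith.of_dist_le_mul (K := 1) fun x y => by
    simpa [Real.dist_eq] using abs_flow_sub_le hs x y).continuous

lemma flow_flow {s r : ℝ} (hs : s ∈ Icc 0 r) (hr : r ≤ t) (x : ℝ) :
    flow μ r (flow μ t x r) s = flow μ t x s :=
  (((isTrajectory_flow ((hs.1.trans hs.2).trans hr) x).mono hr).eq_flow hs).symm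

lemma flow_le_add {s : ℝ} (hs : s ∈ Icc 0 t) (x : ℝ) : flow μ t x s ≤ x + (t - s) := by
  have ht := hs.1.trans hs.2
  have := le_add_integral_of_neg_le_deriv_of_pos
    (g := fun _ => 0) (D' := fun s => -1 + μ s * cbrt (flow μ t x s) + 1)
    (D := fun s => flow μ t x s + s - (x + t))
    (fun s hs => (((isTrajectory_flow ht x) s hs).add (hasDerivAt_id s)).sub_const _)
    continuous_const (fun _ => le_rfl)
    (fun u _ _ => by have := mul_nonneg (μ.nonneg u) (cbrt_nonneg (flow μ t x u)); linarith) hs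
  simp [flow_self ht] at this
  linarith

/-- Particles smaller than `c` do not grow, so backward in time a trajectory cannot sink below both
`c` and its end value. -/
lemma min_le_flow {s c : ℝ} (hs : s ∈ Icc 0 t) (hc : ∀ u ∈ Icc 0 t, μ u * cbrt c ≤ 1) (x : ℝ) :
    min x c ≤ flow μ t x s := by
  have ht := hs.1.trans hs.2
  have := le_add_integral_of_neg_le_deriv_of_pos (g := fun _ => 0)
    (D := fun s => min x c - flow μ t x s)
    (fun s hs => ((isTrajectory_flow ht x) s hs).const_sub _)
    continuous_const (fun _ => le_rfl)
    (fun u hu hpos => by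
      have h1 : flow μ t x u ≤ c := (sub_pos.1 hpos).le.trans (min_le_right _ _)
      have h2 := mul_le_mul_of_nonneg_left (cbrt_mono h1) (μ.nonneg u)
      linarith [hc u hu]) hs
  simpa [flow_self ht] using this

lemma flow_nonneg {s x : ℝ} (hs : s ∈ Icc 0 t) (hx : 0 ≤ x) : 0 ≤ flow μ t x s := by
  have := min_le_flow (μ := μ) hs (c := 0) (fun u _ => by simp [cbrt_of_nonpos le_rfl]) x
  rwa [min_eq_right hx] at this

lemma min_inv_cube_le_flow {s M : ℝ} (hs : s ∈ Icc 0 t) (hM : 0 < M)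
    (hμ : ∀ u ∈ Icc 0 t, μ u ≤ M) (x : ℝ) : min x ((1 / M) ^ 3) ≤ flow μ t x s := by
  refine min_le_flow hs (fun u hu => ?_) x
  rw [cbrt_cube (by positivity), mul_one_div, div_le_one hM]
  exact hμ u hu

lemma Rate.exists_bound (μ : Rate) (t : ℝ) : ∃ M, 0 < M ∧ ∀ u ∈ Icc 0 t, μ u ≤ M := by
  obtain ⟨M, hM⟩ := (isCompact_Icc (a := (0 : ℝ)) (b := t)).bddAbove_image μ.continuous.continuousOn
  exact ⟨max M 1, by positivity, fun u hu => (hM ⟨u, hu, rfl⟩).trans (le_max_left _ _)⟩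

lemma flow_pos {s x : ℝ} (hs : s ∈ Icc 0 t) (hx : 0 < x) : 0 < flow μ t x s := by
  obtain ⟨M, hM, hμ⟩ := μ.exists_bound t
  exact lt_of_lt_of_le (lt_min hx (by positivity)) (min_inv_cube_le_flow hs hM hμ x)

/-- Along a positive characteristic `(X^{2/3})' = 2/3 (μ - X^{-1/3}) ≤ 2/3 M`. In the radius
`X^{1/3}` this is growth by at most a square root of the elapsed time. -/
lemma cbrt_sq_le {s M : ℝ} (hs : s ∈ Icc 0 t) (hμ : ∀ u ∈ Icc s t, μ u ≤ M) (x : ℝ) :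
    cbrt x ^ 2 ≤ cbrt (flow μ t x s) ^ 2 + 2 / 3 * M * (t - s) := by
  have ht := hs.1.trans hs.2
  have hM : 0 ≤ M := (μ.nonneg s).trans (hμ s ⟨le_rfl, hs.2⟩)
  rcases le_or_gt x 0 with hx | hx
  · rw [cbrt_of_nonpos hx]
    have := sub_nonneg.2 hs.2
    have : 0 ≤ 2 / 3 * M * (t - s) := by positivity
    nlinarith [sq_nonneg (cbrt (flow μ t x s))]
  have := le_add_integral_of_neg_le_deriv_of_pos (g := fun _ => 2 / 3 * M) (a := s) (b := t)
    (D := fun s => cbrt x ^ 2 - cbrt (flow μ t x s) ^ 2)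
    (fun u hu => (((hasDerivAt_cbrt (flow_pos ⟨hs.1.trans hu.1, hu.2⟩ hx)).comp u
      ((isTrajectory_flow ht x) u ⟨hs.1.trans hu.1, hu.2⟩)).pow 2).const_sub _)
    continuous_const (fun _ => by positivity)
    (fun u hu _ => by
      have hp := cbrt_pos (flow_pos (μ := μ) ⟨hs.1.trans hu.1, hu.2⟩ hx)
      have h1 := hμ u hu
      simp only [Function.comp_apply, Nat.cast_ofNat, Nat.add_one_sub_one, pow_one]
      have h2 : 2 * cbrt (flow μ t x u) * (1 / (3 * cbrt (flow μ t x u) ^ 2) *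
          (-1 + μ u * cbrt (flow μ t x u))) =
          2 / 3 * μ u - 2 / 3 * (1 / cbrt (flow μ t x u)) := by field_simp; ring
      rw [h2]
      have h3 : 0 < 1 / cbrt (flow μ t x u) := by positivity
      linarith) ⟨le_rfl, hs.2⟩
  simp [flow_self ht] at this
  linarith

lemma cube_le_flow {s M : ℝ} (hs : s ∈ Icc 0 t) (hμ : ∀ u ∈ Icc s t, μ u ≤ M) {ρ : ℝ}
    (hρ : 0 ≤ ρ) : ρ ^ 3 ≤ flow μ t ((ρ + √(2 / 3 * M * (t - s))) ^ 3) s := by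
  have hM : 0 ≤ M := (μ.nonneg s).trans (hμ s ⟨le_rfl, hs.2⟩)
  have hs' := sub_nonneg.2 hs.2
  set a := √(2 / 3 * M * (t - s)) with ha
  have ha0 : 0 ≤ a := Real.sqrt_nonneg _
  have ha2 : a ^ 2 = 2 / 3 * M * (t - s) := Real.sq_sqrt (by positivity)
  have h := cbrt_sq_le hs hμ ((ρ + a) ^ 3)
  rw [cbrt_cube (by positivity), ← ha2] at h
  have h1 : ρ ≤ cbrt (flow μ t ((ρ + a) ^ 3) s) := by
    refine (pow_le_pow_iff_left₀ hρ (cbrt_nonneg _) two_ne_zero).1 ?_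
    nlinarith [mul_nonneg hρ ha0]
  calc ρ ^ 3 ≤ cbrt (flow μ t ((ρ + a) ^ 3) s) ^ 3 := pow_le_pow_left₀ hρ h1 3
    _ = _ := cbrt_pow_three (flow_nonneg hs (by positivity))

/-- Every value at time `s` can be continued forward to time `t`: particles that have vanished
continue at negative sizes, where `cbrt` is zero. -/
lemma exists_flow_eq {s : ℝ} (hs : s ∈ Icc 0 t) (y : ℝ) : ∃ x, flow μ t x s = y := by
  obtain ⟨M, hM, hμ⟩ := μ.exists_bound t
  refine (continuous_flow_left hs).surjective ?_ ?_ y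
  · refine tendsto_atTop.2 fun b => ?_
    filter_upwards [eventually_ge_atTop ((max b 1 + √(2 / 3 * M * (t - s))) ^ 3)] with x hx
    have h1 : 1 ≤ max b 1 := le_max_right _ _
    calc b ≤ max b 1 := le_max_left _ _
      _ ≤ max b 1 ^ 3 := le_self_pow₀ h1 (by norm_num)
      _ ≤ _ := cube_le_flow hs (fun u hu => hμ u ⟨hs.1.trans hu.1, hu.2⟩) (by linarith)
      _ ≤ _ := flow_mono hs hx
  · refine tendsto_atBot_mono (fun x => flow_le_add hs x) ?_
    exact tendsto_atBot_add_const_right _ _ tendsto_id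

/-! ### The difference quotient of the flow -/

/-- The denominator in the divided difference of the cube root. -/
def cbrtDen (x y : ℝ) : ℝ := cbrt x ^ 2 + cbrt x * cbrt y + cbrt y ^ 2

lemma cbrtDen_pos {x y : ℝ} (h : 0 < x ∨ 0 < y) : 0 < cbrtDen x y := by
  have h1 := cbrt_nonneg x
  have h2 := cbrt_nonneg y
  rcases h with h | h <;> have := cbrt_pos h <;> unfold cbrtDen <;> positivity

lemma cbrtDen_mono {x y x' y' : ℝ} (hx : x ≤ x') (hy : y ≤ y') : cbrtDen x y ≤ cbrtDen x' y' := by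
  have h1 := cbrt_nonneg x
  have h2 := cbrt_nonneg y
  have h3 := cbrt_mono hx
  have h4 := cbrt_mono hy
  have h5 := cbrt_nonneg x'
  unfold cbrtDen
  gcongr

lemma continuous_cbrtDen : Continuous fun p : ℝ × ℝ => cbrtDen p.1 p.2 := by
  have := continuous_cbrt
  unfold cbrtDen
  fun_prop

/-- The difference quotient of `x ↦ flow μ t x 0`. -/
def flowSlope (μ : Rate) (t x y : ℝ) : ℝ :=
  Real.exp (-∫ s in (0 : ℝ)..t, μ s / cbrtDen (flow μ t x s) (flow μ t y s))

lemma flowSlope_pos (μ : Rate) (t x y : ℝ) : 0 < flowSlope μ t x y := Real.exp_pos _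

lemma cbrtDen_flow_pos {x y s : ℝ} (h : 0 < x ∨ 0 < y) (hs : s ∈ Icc 0 t) :
    0 < cbrtDen (flow μ t x s) (flow μ t y s) :=
  cbrtDen_pos (h.imp (flow_pos hs) (flow_pos hs))

lemma continuousOn_slope_integrand (ht : 0 ≤ t) {x y : ℝ} (h : 0 < x ∨ 0 < y) :
    ContinuousOn (fun s => μ s / cbrtDen (flow μ t x s) (flow μ t y s)) (Icc 0 t) :=
  μ.continuous.continuousOn.div
    (continuous_cbrtDen.comp ((continuous_flow ht x).prodMk (continuous_flow ht y))).continuousOn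
    fun _ hs => (cbrtDen_flow_pos h hs).ne'

/-- The difference of two characteristics solves the linear equation `D' = (μ / cbrtDen) D`, which
an integrating factor solves exactly. -/
lemma flow_sub_flow (ht : 0 ≤ t) {x y : ℝ} (hx : 0 ≤ x) (hy : 0 ≤ y) (h : 0 < x ∨ 0 < y) :
    flow μ t x 0 - flow μ t y 0 = flowSlope μ t x y * (x - y) := by
  have hpr : ∀ s, max 0 (min s t) ∈ Icc 0 t := fun s =>
    ⟨le_max_left _ _, max_le ht (min_le_right _ _)⟩
  have hpr' : ∀ s ∈ Icc 0 t, max 0 (min s t) = s := fun s hs => by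
    rw [min_eq_left hs.2, max_eq_right hs.1]
  have hprc : Continuous fun s : ℝ => max 0 (min s t) := by fun_prop
  set f := fun s => μ s / cbrtDen (flow μ t x s) (flow μ t y s) with hf
  set k : ℝ → ℝ := fun s => f (max 0 (min s t)) with hk
  have hkc : Continuous k := (continuousOn_slope_integrand ht h).comp_continuous hprc hpr
  set I : ℝ → ℝ := fun s => ∫ u in (0 : ℝ)..s, k u with hI
  have hId : ∀ s, HasDerivAt I (k s) s := fun s => (hkc.integral_hasStrictDerivAt 0 s).hasDerivAt
  have hEd : ∀ s ∈ Icc 0 t, HasDerivAt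
      (fun s => (flow μ t x s - flow μ t y s) * Real.exp (-I s)) 0 s := by
    intro s hs
    have h1 := ((isTrajectory_flow (μ := μ) ht x) s hs).sub ((isTrajectory_flow (μ := μ) ht y) s hs)
    have h2 := h1.mul (hId s).neg.exp
    refine h2.congr_deriv ?_
    have h3 : μ s * cbrt (flow μ t x s) - μ s * cbrt (flow μ t y s) =
        k s * (flow μ t x s - flow μ t y s) := by
      rw [← mul_sub, cbrt_sub_eq (flow_nonneg hs hx) (flow_nonneg hs hy)
        (h.imp (flow_pos hs) (flow_pos hs))]
      simp only [hk, hf, hpr' s hs, cbrtDen]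
      ring
    simp only [Pi.sub_apply, Pi.neg_apply]
    linear_combination Real.exp (-I s) * h3
  have hconst := constant_of_has_deriv_right_zero
    (fun s hs => (hEd s hs).continuousAt.continuousWithinAt)
    (fun s hs => (hEd s (Ico_subset_Icc_self hs)).hasDerivWithinAt) t ⟨ht, le_rfl⟩
  have hIt : I t = ∫ s in (0 : ℝ)..t, f s := by
    refine intervalIntegral.integral_congr fun s hs => ?_
    rw [uIcc_of_le ht] at hs
    simp only [hk, hpr' s hs]
  simp only [flow_self ht, hIt] at hconst
  simp only [hI, intervalIntegral.integral_same, neg_zero, Real.exp_zero, mul_one] at hconst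
  rw [← hconst, flowSlope, mul_comm]

/-- Larger end points give larger trajectories, hence larger denominators and a smaller exponent.
This is where concavity of the cube root turns into convexity of the flow. -/
lemma flowSlope_mono (ht : 0 ≤ t) {x y x' y' : ℝ} (h : 0 < x ∨ 0 < y) (hx : x ≤ x')
    (hy : y ≤ y') : flowSlope μ t x y ≤ flowSlope μ t x' y' := by
  have h' : 0 < x' ∨ 0 < y' := h.imp hx.trans_lt' hy.trans_lt'
  refine Real.exp_le_exp.2 (neg_le_neg ?_)
  have hi : ∀ {x y : ℝ}, 0 < x ∨ 0 < y → IntervalIntegrable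
      (fun s => μ s / cbrtDen (flow μ t x s) (flow μ t y s)) volume 0 t := fun h =>
    ContinuousOn.intervalIntegrable_of_Icc ht (continuousOn_slope_integrand ht h)
  refine intervalIntegral.integral_mono_on ht (hi h') (hi h) fun s hs => ?_
  exact div_le_div_of_nonneg_left (μ.nonneg s) (cbrtDen_flow_pos h hs)
    (cbrtDen_mono (flow_mono hs hx) (flow_mono hs hy))

lemma flow_zero_lt {x y : ℝ} (ht : 0 ≤ t) (hx : 0 ≤ x) (hxy : x < y) :
    flow μ t x 0 < flow μ t y 0 := by
  have := flow_sub_flow (μ := μ) ht (hx.trans hxy.le) hx (Or.inl (hx.trans_lt hxy))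
  have := mul_pos (flowSlope_pos μ t y x) (sub_pos.2 hxy)
  linarith

/-- Convexity of `x ↦ flow μ t x 0`: to the right of `y` it lies above its chords. -/
lemma flow_ge_chord (ht : 0 ≤ t) {x y z : ℝ} (hx : 0 ≤ x) (hxy : x < y) (hyz : y ≤ z) :
    flow μ t y 0 + flowSlope μ t x y * (z - y) ≤ flow μ t z 0 := by
  have hy := hx.trans_lt hxy
  have h1 := flow_sub_flow (μ := μ) ht (hy.le.trans hyz) hy.le (Or.inr hy)
  have h2 : flowSlope μ t x y ≤ flowSlope μ t z y :=
    flowSlope_mono ht (Or.inr hy) (hxy.le.trans hyz) le_rfl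
  have := mul_le_mul_of_nonneg_right h2 (sub_nonneg.2 hyz)
  linarith

/-- A lower bound that depends on the rate only through `M`; it fixes the cutoff `K` in
`exists_isSelfConsistent` before the rate is known. -/
lemma exp_mul_le_flowSlope (ht : 0 ≤ t) {M x : ℝ} (hM : 0 < M) (hμ : ∀ u ∈ Icc 0 t, μ u ≤ M)
    (hx : 0 < x) :
    Real.exp (-(M / cbrt (min x ((1 / M) ^ 3)) ^ 2 * t)) ≤ flowSlope μ t x 0 := by
  refine Real.exp_le_exp.2 (neg_le_neg ?_)
  have hc : 0 < cbrt (min x ((1 / M) ^ 3)) := cbrt_pos (lt_min hx (by positivity))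
  calc _ ≤ ∫ s in (0 : ℝ)..t, M / cbrt (min x ((1 / M) ^ 3)) ^ 2 := by
        refine intervalIntegral.integral_mono_on ht (ContinuousOn.intervalIntegrable_of_Icc ht
          (continuousOn_slope_integrand ht (Or.inl hx))) intervalIntegrable_const fun s hs => ?_
        refine div_le_div₀ hM.le (hμ s hs) (by positivity) ?_
        have h1 := cbrt_mono (min_inv_cube_le_flow hs hM hμ x)
        have h2 := cbrt_nonneg (flow μ t x s)
        have h3 := cbrt_nonneg (flow μ t 0 s)
        have h4 := pow_le_pow_left₀ hc.le h1 2
        unfold cbrtDen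
        nlinarith [mul_nonneg h2 h3, sq_nonneg (cbrt (flow μ t 0 s))]
    _ = _ := by rw [intervalIntegral.integral_const, sub_zero, smul_eq_mul, mul_comm]

end

/-! ### Initial profiles and their transport by a given rate. -/

section

/-! ### Translations of the half line -/

lemma integrableOn_Ioi_comp_add_right_iff (f : ℝ → ℝ) (a b : ℝ) :
    IntegrableOn (fun x => f (x + b)) (Ioi a) ↔ IntegrableOn f (Ioi (a + b)) := by
  have h := (measurePreserving_add_right (volume : Measure ℝ) b).integrableOn_comp_preimage
    (measurableEmbedding_addRight b) (f := f) (s := Ioi (a + b))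
  rwa [preimage_add_const_Ioi, add_sub_cancel_right] at h

lemma setIntegral_Ioi_comp_add_right (f : ℝ → ℝ) (a b : ℝ) :
    ∫ x in Ioi a, f (x + b) = ∫ x in Ioi (a + b), f x := by
  have h := (measurePreserving_add_right (volume : Measure ℝ) b).setIntegral_preimage_emb
    (measurableEmbedding_addRight b) f (Ioi (a + b))
  rwa [preimage_add_const_Ioi, add_sub_cancel_right] at h

lemma Antitone.integrableOn_Ioc {f : ℝ → ℝ} (hf : Antitone f) (a b : ℝ) :
    IntegrableOn f (Ioc a b) :=
  ((hf.antitoneOn _).integrableOn_isCompact isCompact_Icc).mono_set Ioc_subset_Icc_self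

/-- Split the half line at `b`: the first piece is at most `b N`, the rest is a translate dominated
by `f`. Flow estimates enter the integrals as such shifts. -/
lemma integrableOn_and_integral_le_of_shift_le {f g : ℝ → ℝ} {b N : ℝ} (hb : 0 ≤ b)
    (hf : IntegrableOn f (Ioi 0)) (hg : Antitone g) (hg0 : ∀ x, 0 ≤ g x)
    (hN : ∀ x, 0 ≤ x → g x ≤ N) (h : ∀ x, 0 ≤ x → g (x + b) ≤ f x) :
    IntegrableOn g (Ioi 0) ∧ ∫ x in Ioi 0, g x ≤ (∫ x in Ioi 0, f x) + b * N := by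
  have h1 : IntegrableOn (fun x => g (x + b)) (Ioi 0) := by
    refine Integrable.mono' hf (hg.measurable.comp (measurable_id.add_const b)).aestronglyMeasurable
      (ae_restrict_of_forall_mem measurableSet_Ioi fun x hx => ?_)
    rw [Real.norm_of_nonneg (hg0 _)]
    exact h x (le_of_lt hx)
  have h2 : IntegrableOn g (Ioi b) := by
    have := (integrableOn_Ioi_comp_add_right_iff g 0 b).1 h1
    rwa [zero_add] at this
  have h3 := Antitone.integrableOn_Ioc hg 0 b
  have hu : Ioi (0 : ℝ) = Ioc 0 b ∪ Ioi b := (Ioc_union_Ioi_eq_Ioi hb).symm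
  refine ⟨hu ▸ h3.union h2, ?_⟩
  rw [hu, setIntegral_union (Ioc_disjoint_Ioi le_rfl) measurableSet_Ioi h3 h2, ← hu]
  have h4 : ∫ x in Ioi b, g x ≤ ∫ x in Ioi 0, f x := by
    have := setIntegral_Ioi_comp_add_right g 0 b
    rw [zero_add] at this
    rw [← this]
    exact setIntegral_mono_on h1 hf measurableSet_Ioi fun x hx => h x (le_of_lt hx)
  have h5 : ∫ x in Ioc 0 b, g x ≤ b * N := by
    calc _ ≤ ∫ x in Ioc 0 b, N := setIntegral_mono_on h3 (by simp) measurableSet_Ioc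
          fun x hx => hN x hx.1.le
      _ = _ := by simp [hb]
  linarith

/-! ### Initial profiles -/

/-- What is used of the initial data `g`, extended to negative arguments by `g 0`.  The last
condition is the integrated form of the bound `B` on the beta function. -/
structure Profile (B : ℝ) (g : ℝ → ℝ) : Prop where
  nonneg : ∀ x, 0 ≤ g x
  antitone : Antitone g
  eq_of_nonpos : ∀ x ≤ 0, g x = g 0
  integrable : IntegrableOn g (Ioi 0)
  integral_eq_one : ∫ x in Ioi 0, g x = 1
  rightCont : ∀ x, ContinuousWithinAt g (Ici x) x
  continuousAt : ∀ x, 0 < g x → ContinuousAt g x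
  differentiableAt : ∀ x, 0 < x → 0 < g x → DifferentiableAt ℝ g x
  inv_sub_inv_le : ∀ x y, 0 ≤ x → x ≤ y → 0 < g y → 1 / g y - 1 / g x ≤ B * (y - x) / tail g y

namespace Profile

variable {B : ℝ} {g : ℝ → ℝ}

lemma le_zero (hg : Profile B g) (x : ℝ) : g x ≤ g 0 := by
  rcases le_total x 0 with h | h
  · exact (hg.eq_of_nonpos x h).le
  · exact hg.antitone h

lemma zero_pos (hg : Profile B g) : 0 < g 0 := by
  refine (hg.nonneg 0).lt_of_ne fun h => ?_
  have h1 : ∀ x, g x = 0 := fun x => le_antisymm (h ▸ hg.le_zero x) (hg.nonneg x)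
  have := hg.integral_eq_one
  simp [h1] at this

lemma integrableOn_Ioi (hg : Profile B g) {y : ℝ} (hy : 0 ≤ y) : IntegrableOn g (Ioi y) :=
  hg.integrable.mono_set (Ioi_subset_Ioi hy)

lemma tail_nonneg (hg : Profile B g) (y : ℝ) : 0 ≤ tail g y :=
  setIntegral_nonneg measurableSet_Ioi fun x _ => hg.nonneg x

lemma tail_sub_tail (hg : Profile B g) {x y : ℝ} (hx : 0 ≤ x) (hxy : x ≤ y) :
    tail g x - tail g y = ∫ z in Ioc x y, g z := by
  rw [tail, tail, ← Ioc_union_Ioi_eq_Ioi hxy, setIntegral_union (Ioc_disjoint_Ioi le_rfl)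
    measurableSet_Ioi (Antitone.integrableOn_Ioc hg.antitone x y)
    (hg.integrableOn_Ioi (hx.trans hxy))]
  ring

lemma mul_le_tail_sub_tail (hg : Profile B g) {x y : ℝ} (hx : 0 ≤ x) (hxy : x ≤ y) :
    (y - x) * g y ≤ tail g x - tail g y := by
  rw [hg.tail_sub_tail hx hxy]
  calc (y - x) * g y = ∫ z in Ioc x y, g y := by simp [hxy]
    _ ≤ _ := setIntegral_mono_on (by simp) (Antitone.integrableOn_Ioc hg.antitone x y)
      measurableSet_Ioc fun z hz => hg.antitone hz.2

lemma tail_sub_tail_le_mul (hg : Profile B g) {x y : ℝ} (hx : 0 ≤ x) (hxy : x ≤ y) :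
    tail g x - tail g y ≤ (y - x) * g x := by
  rw [hg.tail_sub_tail hx hxy]
  calc _ ≤ ∫ z in Ioc x y, g x := setIntegral_mono_on
        (Antitone.integrableOn_Ioc hg.antitone x y) (by simp)
        measurableSet_Ioc fun z hz => hg.antitone hz.1.le
    _ = _ := by simp [hxy]

lemma tail_zero (hg : Profile B g) : tail g 0 = 1 := hg.integral_eq_one

lemma tail_eq_zero (hg : Profile B g) {y : ℝ} (h : g y = 0) : tail g y = 0 := by
  rw [tail]
  exact setIntegral_eq_zero_of_forall_eq_zero fun x hx =>
    le_antisymm (h ▸ hg.antitone (le_of_lt hx)) (hg.nonneg x)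

lemma abs_tail_sub_tail_le (hg : Profile B g) {x y : ℝ} (hx : 0 ≤ x) (hy : 0 ≤ y) :
    |tail g x - tail g y| ≤ g 0 * |x - y| := by
  wlog hxy : x ≤ y generalizing x y
  · rw [abs_sub_comm, abs_sub_comm x]; exact this hy hx (le_of_not_ge hxy)
  have h1 := hg.mul_le_tail_sub_tail hx hxy
  have h2 := hg.tail_sub_tail_le_mul hx hxy
  have h3 := mul_nonneg (sub_nonneg.2 hxy) (hg.nonneg y)
  have h4 := mul_le_mul_of_nonneg_left (hg.le_zero x) (sub_nonneg.2 hxy)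
  rw [abs_of_nonneg (h3.trans h1), abs_sub_comm, abs_of_nonneg (sub_nonneg.2 hxy)]
  linarith

lemma continuousOn_tail (hg : Profile B g) : ContinuousOn (tail g) (Ici 0) :=
  (LipschitzOnWith.of_dist_le_mul (K := (g 0).toNNReal) fun x hx y hy => by
    rw [Real.dist_eq, Real.dist_eq, Real.coe_toNNReal _ (hg.nonneg 0)]
    exact hg.abs_tail_sub_tail_le hx hy).continuousOn

/-- Only the end of the support can be a discontinuity, since beyond a point where `g` vanishes it
vanishes identically. -/
lemma subsingleton_not_continuousAt (hg : Profile B g) :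
    {x | ¬ ContinuousAt g x}.Subsingleton := by
  have h : ∀ x y, x < y → ¬ ContinuousAt g x → ContinuousAt g y := by
    intro x y hxy hx
    have h0 : g x = 0 := by
      by_contra h
      exact hx (hg.continuousAt x ((hg.nonneg x).lt_of_ne' h))
    have h1 : g =ᶠ[𝓝 y] fun _ => 0 := by
      filter_upwards [lt_mem_nhds hxy] with z hz
      exact le_antisymm (h0 ▸ hg.antitone hz.le) (hg.nonneg z)
    exact continuousAt_const.congr h1.symm
  intro x hx y hy
  rcases lt_trichotomy x y with hxy | hxy | hxy
  · exact absurd (h x y hxy hx) hy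
  · exact hxy
  · exact absurd (h y x hxy hy) hx

lemma integrable_cube (hg : Profile B g) : IntegrableOn (fun ρ => g (ρ ^ 3)) (Ioi 0) := by
  refine (integrableOn_and_integral_le_of_shift_le zero_le_one hg.integrable
    (hg.antitone.comp_monotone (Odd.strictMono_pow (by decide)).monotone)
    (fun _ => hg.nonneg _) (fun x _ => hg.le_zero _) fun x hx => hg.antitone ?_).1
  nlinarith [pow_nonneg hx 3, pow_nonneg hx 2]

end Profile

/-! ### The transported profile -/

/-- The profile at time `t`. -/
def profileAt (g : ℝ → ℝ) (μ : Rate) (t x : ℝ) : ℝ := g (flow μ t x 0)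

/-- The integral `1/3 ∫ x^{-2/3} w(x,t) dx`, written in the variable `x^{1/3}`. -/
def radiusSum (g : ℝ → ℝ) (μ : Rate) (t : ℝ) : ℝ := ∫ ρ in Ioi 0, profileAt g μ t (ρ ^ 3)

variable {B : ℝ} {g : ℝ → ℝ} {μ : Rate} {t : ℝ}

lemma zero_mem_Icc (ht : 0 ≤ t) : (0 : ℝ) ∈ Icc 0 t := ⟨le_rfl, ht⟩

lemma antitone_profileAt (hg : Profile B g) (ht : 0 ≤ t) : Antitone (profileAt g μ t) :=
  hg.antitone.comp_monotone (flow_mono (zero_mem_Icc ht))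

lemma antitone_profileAt_cube (hg : Profile B g) (ht : 0 ≤ t) :
    Antitone fun ρ => profileAt g μ t (ρ ^ 3) :=
  (antitone_profileAt hg ht).comp_monotone (Odd.strictMono_pow (by decide)).monotone

lemma profileAt_time_zero (x : ℝ) : profileAt g μ 0 x = g x := by
  rw [profileAt, flow_self le_rfl]

lemma profileAt_flow {s x : ℝ} (hs : s ∈ Icc 0 t) :
    profileAt g μ s (flow μ t x s) = profileAt g μ t x := by
  rw [profileAt, profileAt, flow_flow (zero_mem_Icc hs.1) hs.2]

lemma profileAt_add_sqrt_le (hg : Profile B g) {s M ρ : ℝ} (hs : s ∈ Icc 0 t)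
    (hμ : ∀ u ∈ Icc s t, μ u ≤ M) (hρ : 0 ≤ ρ) :
    profileAt g μ t ((ρ + √(2 / 3 * M * (t - s))) ^ 3) ≤ profileAt g μ s (ρ ^ 3) := by
  rw [← profileAt_flow hs]
  exact antitone_profileAt hg hs.1 (cube_le_flow hs hμ hρ)

lemma profileAt_add_cbrt_le (hg : Profile B g) {s ρ : ℝ} (hs : s ∈ Icc 0 t) (hρ : 0 ≤ ρ) :
    profileAt g μ s ((ρ + cbrt (t - s)) ^ 3) ≤ profileAt g μ t (ρ ^ 3) := by
  rw [← profileAt_flow hs]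
  refine antitone_profileAt hg hs.1 ((flow_le_add hs _).trans ?_)
  have h := cbrt_pow_three (sub_nonneg.2 hs.2)
  have h0 := cbrt_nonneg (t - s)
  have : 0 ≤ 3 * ρ * cbrt (t - s) * (ρ + cbrt (t - s)) := by positivity
  nlinarith

lemma integrableOn_profileAt_cube (hg : Profile B g) (ht : 0 ≤ t) :
    IntegrableOn (fun ρ => profileAt g μ t (ρ ^ 3)) (Ioi 0) := by
  obtain ⟨M, hM, hμ⟩ := μ.exists_bound t
  refine (integrableOn_and_integral_le_of_shift_le (Real.sqrt_nonneg (2 / 3 * M * (t - 0)))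
    hg.integrable_cube (antitone_profileAt_cube hg ht) (fun _ => hg.nonneg _)
    (fun x _ => hg.le_zero _) fun x hx => ?_).1
  have := profileAt_add_sqrt_le hg (zero_mem_Icc ht) hμ hx
  rwa [profileAt_time_zero] at this

lemma radiusSum_le (hg : Profile B g) {s M : ℝ} (hs : s ∈ Icc 0 t)
    (hμ : ∀ u ∈ Icc s t, μ u ≤ M) :
    radiusSum g μ t ≤ radiusSum g μ s + √(2 / 3 * M * (t - s)) * profileAt g μ s 0 := by
  refine (integrableOn_and_integral_le_of_shift_le (Real.sqrt_nonneg (2 / 3 * M * (t - s)))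
    (integrableOn_profileAt_cube hg hs.1) (antitone_profileAt_cube hg (hs.1.trans hs.2))
    (fun _ => hg.nonneg _) (fun x hx => ?_)
    fun x hx => profileAt_add_sqrt_le hg hs hμ hx).2
  rw [← profileAt_flow hs]
  exact antitone_profileAt hg hs.1 (flow_nonneg hs (pow_nonneg hx 3))

/-- Radii grow by at most a square root and shrink by at most a cube root of the elapsed time. The
modulus depends on the rate only through `M`, which gives equicontinuity for families of rates. -/
lemma abs_radiusSum_sub_le (hg : Profile B g) {s M : ℝ} (hs : s ∈ Icc 0 t)
    (hμ : ∀ u ∈ Icc 0 t, μ u ≤ M) :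
    |radiusSum g μ t - radiusSum g μ s| ≤ (√(2 / 3 * M * (t - s)) + cbrt (t - s)) * g 0 := by
  have h1 := (integrableOn_and_integral_le_of_shift_le (Real.sqrt_nonneg (2 / 3 * M * (t - s)))
    (integrableOn_profileAt_cube hg hs.1) (antitone_profileAt_cube hg (hs.1.trans hs.2))
    (fun _ => hg.nonneg _) (fun x _ => hg.le_zero _)
    fun x hx => profileAt_add_sqrt_le hg hs (fun u hu => hμ u ⟨hs.1.trans hu.1, hu.2⟩) hx).2
  have h2 := (integrableOn_and_integral_le_of_shift_le (cbrt_nonneg (t - s))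
    (integrableOn_profileAt_cube hg (hs.1.trans hs.2)) (antitone_profileAt_cube hg hs.1)
    (fun _ => hg.nonneg _) (fun x _ => hg.le_zero _)
    fun x hx => profileAt_add_cbrt_le (μ := μ) hg hs hx).2
  have h3 := mul_nonneg (Real.sqrt_nonneg (2 / 3 * M * (t - s))) (hg.nonneg 0)
  have h4 := mul_nonneg (cbrt_nonneg (t - s)) (hg.nonneg 0)
  simp only [radiusSum]
  rw [abs_le]; constructor <;> linarith

lemma abs_flow_zero_sub_le {s : ℝ} (hs : 0 ≤ s) (ht : 0 ≤ t) :
    |flow μ t 0 0 - flow μ s 0 0| ≤ |t - s| := by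
  wlog hst : s ≤ t generalizing s t
  · rw [abs_sub_comm, abs_sub_comm t]; exact this ht hs (le_of_not_ge hst)
  rw [← flow_flow (zero_mem_Icc hs) hst]
  refine (abs_flow_sub_le (zero_mem_Icc hs) _ _).trans ?_
  have h1 := flow_le_add (μ := μ) ⟨hs, hst⟩ 0
  have h2 := flow_nonneg (μ := μ) ⟨hs, hst⟩ le_rfl
  rw [sub_zero, abs_of_nonneg h2, abs_of_nonneg (sub_nonneg.2 hst)]
  linarith

/-- By convexity the flow lies above a line of positive slope `p` to the right of `1`, so
`profileAt` shifted by `1` is dominated by `g (p x)`. -/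
lemma integrableOn_profileAt (hg : Profile B g) (ht : 0 ≤ t) :
    IntegrableOn (profileAt g μ t) (Ioi 0) := by
  set p := flowSlope μ t 0 1 with hp
  have hp0 : 0 < p := flowSlope_pos _ _ _ _
  have h1 : IntegrableOn (fun x => g (p * x)) (Ioi 0) := by
    rw [integrableOn_Ioi_comp_mul_left_iff _ _ hp0, mul_zero]
    exact hg.integrable
  refine (integrableOn_and_integral_le_of_shift_le zero_le_one h1
    (antitone_profileAt hg ht) (fun _ => hg.nonneg _) (fun x _ => hg.le_zero _)
    fun x hx => hg.antitone ?_).1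
  have h2 := flow_ge_chord (μ := μ) ht le_rfl zero_lt_one (le_add_of_nonneg_left hx)
  have h3 := flow_nonneg (μ := μ) (zero_mem_Icc ht) zero_le_one
  rw [add_sub_cancel_right] at h2
  linarith

/-! ### Dependence on the rate -/

lemma abs_flow_sub_flow_le {μ' : Rate} (ht : 0 ≤ t) (x : ℝ) :
    |flow μ t x 0 - flow μ' t x 0| ≤ ∫ u in (0 : ℝ)..t, |μ u - μ' u| * cbrt (x + t) := by
  have key : ∀ μ μ' : Rate, flow μ t x 0 - flow μ' t x 0 ≤
      ∫ u in (0 : ℝ)..t, |μ u - μ' u| * cbrt (x + t) := by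
    intro μ μ'
    have h := (isTrajectory_flow ht x).sub_le (μ := μ) (isTrajectory_flow (μ := μ') ht x)
      (continuous_flow ht x) (zero_mem_Icc ht)
    rw [flow_self ht, flow_self ht, sub_self, max_self, zero_add] at h
    have hc := (μ.continuous.sub μ'.continuous).abs
    refine h.trans (intervalIntegral.integral_mono_on ht
      ((hc.mul (continuous_cbrt.comp (continuous_flow ht x))).intervalIntegrable _ _)
      ((hc.mul continuous_const).intervalIntegrable _ _) fun u hu => ?_)
    refine mul_le_mul_of_nonneg_left (cbrt_mono ?_) (abs_nonneg _)
    have := flow_le_add (μ := μ') hu x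
    linarith [hu.1]
  have h1 := key μ μ'
  have h2 := key μ' μ
  simp_rw [abs_sub_comm (μ' _)] at h2
  rw [abs_le]; constructor <;> linarith

lemma flow_congr {μ' : Rate} (ht : 0 ≤ t) (h : ∀ u ∈ Icc 0 t, μ u = μ' u) (x : ℝ) :
    flow μ t x 0 = flow μ' t x 0 := by
  have h1 := abs_flow_sub_flow_le (μ := μ) (μ' := μ') ht x
  have h2 : ∫ u in (0 : ℝ)..t, |μ u - μ' u| * cbrt (x + t) = ∫ u in (0 : ℝ)..t, (0 : ℝ) := by
    refine intervalIntegral.integral_congr fun u hu => ?_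
    rw [uIcc_of_le ht] at hu
    simp [h u hu]
  rw [h2, intervalIntegral.integral_zero] at h1
  exact sub_eq_zero.1 (abs_nonpos_iff.1 h1)

lemma tendsto_flow {ν : ℕ → Rate} {M : ℝ} (ht : 0 ≤ t)
    (hM : ∀ n, ∀ u ∈ Icc 0 t, ν n u ≤ M)
    (h : ∀ u ∈ Icc 0 t, Tendsto (fun n => ν n u) atTop (𝓝 (μ u))) (x : ℝ) :
    Tendsto (fun n => flow (ν n) t x 0) atTop (𝓝 (flow μ t x 0)) := by
  have hμ : ∀ u ∈ Icc 0 t, μ u ≤ M := fun u hu => le_of_tendsto' (h u hu) fun n => hM n u hu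
  have h1 : Tendsto (fun n => ∫ u in (0 : ℝ)..t, |ν n u - μ u| * cbrt (x + t)) atTop
      (𝓝 (∫ u in (0 : ℝ)..t, (0 : ℝ))) := by
    refine intervalIntegral.tendsto_integral_filter_of_dominated_convergence
      (fun _ => M * cbrt (x + t)) (Eventually.of_forall fun n => ?_) ?_
      intervalIntegrable_const ?_
    · exact (((ν n).continuous.sub μ.continuous).abs.mul continuous_const).aestronglyMeasurable
    · refine Eventually.of_forall fun n => Eventually.of_forall fun u hu => ?_
      rw [uIoc_of_le ht] at hu
      have hu' := Ioc_subset_Icc_self hu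
      rw [Real.norm_of_nonneg (mul_nonneg (abs_nonneg _) (cbrt_nonneg _))]
      refine mul_le_mul_of_nonneg_right ?_ (cbrt_nonneg _)
      have := hM n u hu'
      have := hμ u hu'
      have := μ.nonneg u
      have := (ν n).nonneg u
      rw [abs_le]; constructor <;> linarith
    · refine Eventually.of_forall fun u hu => ?_
      rw [uIoc_of_le ht] at hu
      simpa using (((h u (Ioc_subset_Icc_self hu)).sub_const (μ u)).abs.mul_const (cbrt (x + t)))
  rw [intervalIntegral.integral_zero] at h1
  rw [tendsto_iff_dist_tendsto_zero]
  exact squeeze_zero (fun _ => dist_nonneg) (fun n => by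
    rw [Real.dist_eq]; exact abs_flow_sub_flow_le ht x) h1

/-- Dominated convergence. Pointwise convergence can fail only where the limit flow meets the jump
of `g`, and strict monotonicity allows at most one such radius. -/
lemma tendsto_radiusSum (hg : Profile B g) {ν : ℕ → Rate} {M : ℝ} (ht : 0 ≤ t)
    (hM : ∀ n, ∀ u ∈ Icc 0 t, ν n u ≤ M)
    (h : ∀ u ∈ Icc 0 t, Tendsto (fun n => ν n u) atTop (𝓝 (μ u))) :
    Tendsto (fun n => radiusSum g (ν n) t) atTop (𝓝 (radiusSum g μ t)) := by
  set a := √(2 / 3 * M * (t - 0)) with ha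
  have ha0 : 0 ≤ a := Real.sqrt_nonneg _
  have hG : Antitone fun ρ => g (max (ρ - a) 0 ^ 3) := hg.antitone.comp_monotone fun x y hxy =>
    pow_le_pow_left₀ (le_max_right _ _) (max_le_max_right _ (by linarith)) 3
  refine tendsto_integral_filter_of_dominated_convergence (fun ρ => g (max (ρ - a) 0 ^ 3))
    (Eventually.of_forall fun n =>
      (antitone_profileAt_cube hg ht).measurable.aestronglyMeasurable)
    (Eventually.of_forall fun n => ae_restrict_of_forall_mem measurableSet_Ioi fun ρ hρ => ?_)
    (integrableOn_and_integral_le_of_shift_le ha0 hg.integrable_cube hG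
      (fun _ => hg.nonneg _) (fun x _ => hg.le_zero _) fun x hx => ?_).1 ?_
  · rw [profileAt, Real.norm_of_nonneg (hg.nonneg _)]
    change profileAt g (ν n) t (ρ ^ 3) ≤ _
    rcases le_total ρ a with hρa | hρa
    · rw [max_eq_right (by linarith), zero_pow (by norm_num)]
      exact hg.le_zero _
    · rw [max_eq_left (by linarith)]
      have := profileAt_add_sqrt_le (ρ := ρ - a) hg (zero_mem_Icc ht) (hM n) (by linarith)
      rwa [profileAt_time_zero, ← ha, sub_add_cancel] at this
  · rw [add_sub_cancel_right, max_eq_left hx]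
  · have hsub : {ρ : ℝ | ρ ∈ Ioi 0 ∧ ¬ ContinuousAt g (flow μ t (ρ ^ 3) 0)}.Subsingleton := by
      intro ρ hρ σ hσ
      have h1 := hg.subsingleton_not_continuousAt hρ.2 hσ.2
      have key : ∀ ρ σ : ℝ, 0 < ρ → ρ < σ → flow μ t (ρ ^ 3) 0 < flow μ t (σ ^ 3) 0 :=
        fun ρ σ h0 h => flow_zero_lt ht (by positivity) (pow_lt_pow_left₀ h h0.le (by norm_num))
      rcases lt_trichotomy ρ σ with h | h | h
      · exact absurd h1 (key ρ σ hρ.1 h).ne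
      · exact h
      · exact absurd h1 (key σ ρ hσ.1 h).ne'
    rw [ae_restrict_iff' measurableSet_Ioi]
    have hnull : volume {ρ : ℝ | ρ ∈ Ioi 0 ∧ ¬ ContinuousAt g (flow μ t (ρ ^ 3) 0)} = 0 :=
      hsub.measure_zero _
    filter_upwards [measure_eq_zero_iff_ae_notMem.1 hnull] with ρ hρ hρ0
    have hc : ContinuousAt g (flow μ t (ρ ^ 3) 0) := by
      by_contra hc; exact hρ ⟨hρ0, hc⟩
    exact hc.tendsto.comp (tendsto_flow ht hM h _)

end

/-! ### Existence for the regularised coupling of rate and profile. -/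

section

/-! ### A compactness principle -/

/-- Arzelà–Ascoli on the half line: Tychonoff gives convergence at the rational times, and the
common modulus extends it to all times. -/
lemma exists_subseq_tendsto_of_equicontinuous {f : ℕ → ℝ → ℝ}
    (hbd : ∀ t, 0 ≤ t → ∃ R, ∀ n, |f n t| ≤ R)
    (heq : ∀ T, 0 ≤ T → ∃ ω : ℝ → ℝ, Tendsto ω (𝓝 0) (𝓝 0) ∧
      ∀ n, ∀ s ∈ Icc 0 T, ∀ t ∈ Icc s T, |f n t - f n s| ≤ ω (t - s)) :
    ∃ φ : ℕ → ℕ, StrictMono φ ∧ ∃ l : ℝ → ℝ,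
      (∀ t, 0 ≤ t → Tendsto (fun n => f (φ n) t) atTop (𝓝 (l t))) ∧ ContinuousOn l (Ici 0) := by
  choose! R hR using hbd
  have hcpt : IsCompact (Set.pi univ fun q : ℚ => Icc (-R (max q 0)) (R (max q 0))) :=
    isCompact_univ_pi fun q => isCompact_Icc
  obtain ⟨a, -, φ, hφ, ha⟩ := hcpt.tendsto_subseq (x := fun n (q : ℚ) => f n (max q 0))
    fun n q _ => abs_le.1 (hR _ (le_max_right _ _) n)
  have hq : ∀ q : ℚ, 0 ≤ q → Tendsto (fun n => f (φ n) q) atTop (𝓝 (a q)) := by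
    intro q hq
    have := (tendsto_pi_nhds.1 ha) q
    have hq' : (0 : ℝ) ≤ q := by exact_mod_cast hq
    simpa [max_eq_left hq'] using this
  have hex : ∀ t, 0 ≤ t → ∃ l, Tendsto (fun n => f (φ n) t) atTop (𝓝 l) := by
    intro t ht
    refine cauchySeq_tendsto_of_complete (Metric.cauchySeq_iff'.2 fun ε hε => ?_)
    obtain ⟨ω, hω, hf⟩ := heq (t + 1) (by linarith)
    obtain ⟨δ, hδ, hωδ⟩ := Metric.tendsto_nhds_nhds.1 hω (ε / 3) (by positivity)
    obtain ⟨q, hq1, hq2⟩ := exists_rat_btwn (show t < t + min δ 1 by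
      have : 0 < min δ 1 := by positivity
      linarith)
    have hq0 : (0 : ℝ) ≤ q := ht.trans hq1.le
    have hclose : ∀ n, |f (φ n) q - f (φ n) t| < ε / 3 := by
      intro n
      have h1 := hf (φ n) t ⟨ht, by linarith⟩ q ⟨hq1.le, by linarith [min_le_right δ 1]⟩
      have h2 := hωδ (x := q - t) (by
        rw [Real.dist_eq, sub_zero, abs_of_pos (by linarith)]
        linarith [min_le_left δ 1])
      rw [Real.dist_eq, sub_zero] at h2
      exact (h1.trans (le_abs_self _)).trans_lt h2
    obtain ⟨N, hN⟩ := Metric.cauchySeq_iff'.1 (hq q (by exact_mod_cast hq0)).cauchySeq (ε / 3)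
      (by positivity)
    refine ⟨N, fun n hn => ?_⟩
    have h1 := abs_lt.1 (hclose n)
    have h2 := abs_lt.1 (hclose N)
    have h3 := hN n hn
    rw [Real.dist_eq] at h3 ⊢
    have h3 := abs_lt.1 h3
    rw [abs_lt]; constructor <;> linarith
  choose! l hl using hex
  refine ⟨φ, hφ, l, hl, ?_⟩
  intro t ht
  obtain ⟨ω, hω, hf⟩ := heq (t + 1) (by have : (0:ℝ) ≤ t := ht; linarith)
  have hlω : ∀ s ∈ Icc 0 (t + 1), ∀ r ∈ Icc s (t + 1), |l r - l s| ≤ ω (r - s) := fun s hs r hr =>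
    le_of_tendsto' ((hl r (hs.1.trans hr.1)).sub (hl s hs.1)).abs fun n => hf (φ n) s hs r hr
  have h1 : Tendsto (fun s => ω |s - t|) (𝓝[Ici 0] t) (𝓝 0) := by
    refine hω.comp (tendsto_nhdsWithin_of_tendsto_nhds ?_)
    have : Continuous fun s : ℝ => |s - t| := by fun_prop
    simpa using this.tendsto t
  rw [ContinuousWithinAt, tendsto_iff_dist_tendsto_zero]
  refine squeeze_zero' (Eventually.of_forall fun _ => dist_nonneg) ?_ h1
  filter_upwards [self_mem_nhdsWithin, nhdsWithin_le_nhds (gt_mem_nhds (lt_add_one t))]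
    with s hs hst
  rw [Real.dist_eq]
  rcases le_total s t with h | h
  · rw [abs_sub_comm (l s), abs_sub_comm s, abs_of_nonneg (sub_nonneg.2 h)]
    exact hlω s ⟨hs, hst.le⟩ t ⟨h, by linarith⟩
  · rw [abs_of_nonneg (sub_nonneg.2 h)]
    exact hlω t ⟨ht, by linarith⟩ s ⟨h, hst.le⟩

/-! ### The regularised self-consistency relation -/

variable {B : ℝ} {g : ℝ → ℝ} {μ : Rate} {t : ℝ}

/-- `g` may jump to zero at the end of its support, but its tail is continuous and vanishes there,
so the minimum is squeezed to zero. This is the reason for the cutoff of the numerator in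
`response`. -/
lemma Profile.continuousOn_min (hg : Profile B g) :
    ContinuousOn (fun p : ℝ × ℝ => min (g p.2) (p.1 * tail g p.2)) (univ ×ˢ Ici 0) := by
  have ht : ContinuousOn (fun p : ℝ × ℝ => p.1 * tail g p.2) (univ ×ˢ Ici 0) :=
    continuousOn_fst.mul (hg.continuousOn_tail.comp continuousOn_snd fun p hp => hp.2)
  rintro ⟨k, x⟩ hx
  rcases (hg.nonneg x).eq_or_lt with h0 | hpos
  · have hmin : min (g x) (k * tail g x) = 0 := by
      rw [← h0, hg.tail_eq_zero h0.symm, mul_zero, min_self]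
    have h1 := ht (k, x) hx
    have h2 : ContinuousWithinAt (fun p : ℝ × ℝ => min 0 (p.1 * tail g p.2))
        (univ ×ˢ Ici 0) (k, x) :=
      continuousWithinAt_const.min h1
    rw [ContinuousWithinAt] at h1 h2 ⊢
    simp only [hg.tail_eq_zero h0.symm, mul_zero, min_self] at h1 h2
    simp only [hmin]
    exact tendsto_of_tendsto_of_tendsto_of_le_of_le h2 h1
      (fun p => min_le_min_right _ (hg.nonneg _)) (fun p => min_le_right _ _)
  · exact Filter.Tendsto.min
      ((hg.continuousAt x hpos).comp_continuousWithinAt continuousWithinAt_snd) (ht (k, x) hx)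

/-- The right side `w(0,t) / (1/3 ∫ x^{-2/3} w(x,t) dx)` of the relation that determines the rate,
with numerator and denominator replaced by `min (w(0,t)) (K t h₀)` and `max (·) (c t)`. -/
def response (g K c : ℝ → ℝ) (t ξ v : ℝ) : ℝ := min (g ξ) (K t * tail g ξ) / max v (c t)

variable {K c : ℝ → ℝ}

lemma response_nonneg (hg : Profile B g) (hK0 : ∀ t, 0 ≤ K t) (hc0 : ∀ t, 0 < c t) (t ξ v : ℝ) :
    0 ≤ response g K c t ξ v :=
  div_nonneg (le_min (hg.nonneg _) (mul_nonneg (hK0 _) (hg.tail_nonneg _)))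
    ((hc0 t).le.trans (le_max_right _ _))

lemma response_le (hg : Profile B g) (hc0 : ∀ t, 0 < c t) (t ξ v : ℝ) :
    response g K c t ξ v ≤ g 0 / c t :=
  div_le_div₀ (hg.nonneg 0) ((min_le_left _ _).trans (hg.le_zero _)) (hc0 t) (le_max_right _ _)

lemma continuousOn_response (hg : Profile B g) (hK : Continuous K) (hc : Continuous c)
    (hc0 : ∀ t, 0 < c t) :
    ContinuousOn (fun p : ℝ × ℝ × ℝ => response g K c p.1 p.2.1 p.2.2) (univ ×ˢ Ici 0 ×ˢ univ) := by
  refine ContinuousOn.div ?_ ?_ fun p _ => ((hc0 _).trans_le (le_max_right _ _)).ne'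
  · exact hg.continuousOn_min.comp (f := fun p : ℝ × ℝ × ℝ => (K p.1, p.2.1))
      (by fun_prop) fun p hp => ⟨trivial, hp.2.1⟩
  · exact Continuous.continuousOn (by fun_prop)

lemma flow_zero_nonneg (ht : 0 ≤ t) : 0 ≤ flow μ t 0 0 := flow_nonneg (zero_mem_Icc ht) le_rfl

lemma tendsto_sqrt_add_cbrt (M N : ℝ) :
    Tendsto (fun δ => (√(2 / 3 * M * δ) + cbrt δ) * N) (𝓝 0) (𝓝 0) := by
  have : Continuous fun δ => (√(2 / 3 * M * δ) + cbrt δ) * N := by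
    have := continuous_cbrt
    fun_prop
  simpa [cbrt_of_nonpos le_rfl] using this.tendsto 0

lemma continuousOn_flow_zero (μ : Rate) : ContinuousOn (fun t => flow μ t 0 0) (Ici 0) :=
  (LipschitzOnWith.of_dist_le_mul (K := 1) fun x hx y hy => by
    simpa [Real.dist_eq] using abs_flow_zero_sub_le (μ := μ) hy hx).continuousOn

lemma continuousOn_radiusSum (hg : Profile B g) (μ : Rate) :
    ContinuousOn (radiusSum g μ) (Ici 0) := by
  have hb : ∀ T, 0 ≤ T → ∃ ω : ℝ → ℝ, Tendsto ω (𝓝 0) (𝓝 0) ∧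
      ∀ _ : ℕ, ∀ s ∈ Icc 0 T, ∀ t ∈ Icc s T, |radiusSum g μ t - radiusSum g μ s| ≤ ω (t - s) := by
    intro T hT
    obtain ⟨M, -, hM⟩ := μ.exists_bound T
    exact ⟨_, tendsto_sqrt_add_cbrt M (g 0), fun _ s hs t ht =>
      abs_radiusSum_sub_le hg ⟨hs.1, ht.1⟩ fun u hu => hM u ⟨hu.1, hu.2.trans ht.2⟩⟩
  -- Applied to a constant sequence, the compactness principle returns continuity of its single
  -- member.
  obtain ⟨φ, -, l, hl, hlc⟩ := exists_subseq_tendsto_of_equicontinuous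
    (f := fun _ => radiusSum g μ) (fun t _ => ⟨_, fun _ => le_rfl⟩) hb
  exact hlc.congr fun t ht => tendsto_nhds_unique tendsto_const_nhds (hl t ht)

/-- The rate determined with delay `ε` by the rate `μ`. -/
def delayedRate (hg : Profile B g) (hK : Continuous K) (hK0 : ∀ t, 0 ≤ K t) (hc : Continuous c)
    (hc0 : ∀ t, 0 < c t) (ε : ℝ) (μ : Rate) : Rate where
  toFun s := response g K c (max (s - ε) 0) (flow μ (max (s - ε) 0) 0 0)
    (radiusSum g μ (max (s - ε) 0))
  continuous_toFun := by
    have h1 : Continuous fun s : ℝ => max (s - ε) 0 := by fun_prop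
    refine (continuousOn_response hg hK hc hc0).comp_continuous
      (f := fun s => (max (s - ε) 0, flow μ (max (s - ε) 0) 0 0, radiusSum g μ (max (s - ε) 0)))
      (h1.prodMk (((continuousOn_flow_zero μ).comp_continuous h1 fun s =>
        mem_Ici.2 (le_max_right _ _)).prodMk
        ((continuousOn_radiusSum hg μ).comp_continuous h1 fun s => mem_Ici.2 (le_max_right _ _))))
      fun s => ⟨trivial, flow_zero_nonneg (le_max_right _ _), trivial⟩
  nonneg_toFun s := response_nonneg hg hK0 hc0 _ _ _

lemma radiusSum_congr {μ' : Rate} (ht : 0 ≤ t) (h : ∀ u ∈ Icc 0 t, μ u = μ' u) :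
    radiusSum g μ t = radiusSum g μ' t := by
  simp only [radiusSum, profileAt, flow_congr ht h]

/-- Existence of rates that solve the self-consistency relation with delay `ε` up to a given
time. -/
lemma exists_delayed_solution (hg : Profile B g) (hK : Continuous K) (hK0 : ∀ t, 0 ≤ K t)
    (hc : Continuous c) (hc0 : ∀ t, 0 < c t) {ε : ℝ} (hε : 0 < ε) (T : ℝ) :
    ∃ μ : Rate, (∃ μ', μ = delayedRate hg hK hK0 hc hc0 ε μ') ∧
      ∀ s, s ≤ T → μ s = response g K c (max (s - ε) 0) (flow μ (max (s - ε) 0) 0 0)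
        (radiusSum g μ (max (s - ε) 0)) := by
  set D := delayedRate hg hK hK0 hc hc0 ε with hD
  have hcongr : ∀ μ μ' : Rate, ∀ s, (∀ u ∈ Icc 0 (max (s - ε) 0), μ u = μ' u) → D μ s = D μ' s := by
    intro μ μ' s h
    change response _ _ _ _ _ _ = response _ _ _ _ _ _
    rw [flow_congr (le_max_right _ _) h, radiusSum_congr (le_max_right _ _) h]
  -- Up to time `ε` the delayed rate sees only the state at time `0`, which is the same for all
  -- rates.
  have hzero : ∀ μ μ' : Rate, ∀ s ≤ ε, D μ s = D μ' s := by
    intro μ μ' s hs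
    change response _ _ _ _ _ _ = response _ _ _ _ _ _
    rw [max_eq_right (by linarith)]
    simp only [flow_self le_rfl, radiusSum, profileAt]
  -- Method of steps: `D` looks back by `ε`, so each further iteration fixes the rate on one more
  -- interval of that length.
  have hagree : ∀ n : ℕ, ∀ μ : Rate, ∀ s ≤ n * ε, D^[n + 1] μ s = D^[n + 2] μ s := by
    intro n
    induction n with
    | zero =>
      intro μ s hs
      simp only [Function.iterate_succ, Function.iterate_zero, Function.comp_apply, id]
      exact hzero _ _ s (by simp at hs; linarith)
    | succ n ih =>
      intro μ s hs
      rw [Function.iterate_succ_apply' D (n + 1), Function.iterate_succ_apply' D (n + 2)]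
      refine hcongr _ _ s fun u hu => ih μ u (hu.2.trans ?_)
      push_cast at hs
      exact max_le (by linarith) (by positivity)
  obtain ⟨n, hn⟩ := exists_nat_ge (T / ε)
  rw [div_le_iff₀ hε] at hn
  refine ⟨D^[n + 1] ⟨fun _ => 0, continuous_const, fun _ => le_rfl⟩,
    ⟨_, Function.iterate_succ_apply' D n _⟩, fun s hs => ?_⟩
  rw [hagree n _ s (hs.trans hn), Function.iterate_succ_apply' D (n + 1)]
  rfl

/-- Solve with delay `1/(n+1)` up to time `n`. The denominator cutoff bounds all rates uniformly, so
`flow · t 0 0` and `radiusSum` converge along a subsequence. Continuity of `response` then makes the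
rates converge, and stability of the flow identifies the limits. -/
lemma exists_selfconsistent_rate (hg : Profile B g) (hK : Continuous K) (hK0 : ∀ t, 0 ≤ K t)
    (hc : Continuous c) (hc0 : ∀ t, 0 < c t) (hca : Antitone c) :
    ∃ μ : Rate, ∀ t, 0 ≤ t → μ t = response g K c t (flow μ t 0 0) (radiusSum g μ t) := by
  choose ν hν hνeq using fun n : ℕ =>
    exists_delayed_solution hg hK hK0 hc hc0 (Nat.one_div_pos_of_nat (α := ℝ) (n := n)) n
  have hbd : ∀ T, 0 ≤ T → ∀ n, ∀ u ∈ Icc 0 T, ν n u ≤ g 0 / c T := by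
    intro T hT n u hu
    -- The delayed relation is known only up to time `n`, but every value of a `delayedRate` is a
    -- `response`, so the bound holds for all `n` and all times.
    obtain ⟨μ', hμ'⟩ := hν n
    rw [hμ']
    refine (response_le hg hc0 _ _ _).trans
      (div_le_div_of_nonneg_left (hg.nonneg 0) (hc0 _) (hca (max_le ?_ hT)))
    have : (0 : ℝ) < 1 / ((n : ℝ) + 1) := by positivity
    linarith [hu.2]
  obtain ⟨φ, hφ, f, hf, hfc⟩ := exists_subseq_tendsto_of_equicontinuous
    (f := fun n t => flow (ν n) t 0 0)
    (fun t ht => ⟨t, fun n => by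
      have := abs_flow_zero_sub_le (μ := ν n) le_rfl ht
      rwa [flow_self le_rfl, sub_zero, sub_zero, abs_of_nonneg ht] at this⟩)
    (fun T _ => ⟨id, tendsto_id, fun n s hs t ht => by
      have := abs_flow_zero_sub_le (μ := ν n) hs.1 (hs.1.trans ht.1)
      rwa [abs_of_nonneg (sub_nonneg.2 ht.1)] at this⟩)
  obtain ⟨ψ, hψ, v, hv, hvc⟩ := exists_subseq_tendsto_of_equicontinuous
    (f := fun n t => radiusSum g (ν (φ n)) t)
    (fun t ht => ⟨|∫ ρ in Ioi 0, g (ρ ^ 3)| +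
        |(√(2 / 3 * (g 0 / c t) * (t - 0)) + cbrt (t - 0)) * g 0|, fun n => by
      have h := abs_radiusSum_sub_le hg (zero_mem_Icc ht) (hbd t ht (φ n))
      have h0 : radiusSum g (ν (φ n)) 0 = ∫ ρ in Ioi 0, g (ρ ^ 3) := by
        simp only [radiusSum, profileAt_time_zero]
      rw [← h0]
      have h2 := abs_sub_abs_le_abs_sub (radiusSum g (ν (φ n)) t) (radiusSum g (ν (φ n)) 0)
      have h3 := le_abs_self ((√(2 / 3 * (g 0 / c t) * (t - 0)) + cbrt (t - 0)) * g 0)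
      linarith⟩)
    (fun T hT => ⟨_, tendsto_sqrt_add_cbrt (g 0 / c T) (g 0), fun n s hs t ht =>
      abs_radiusSum_sub_le hg ⟨hs.1, ht.1⟩ fun u hu => hbd T hT _ u ⟨hu.1, hu.2.trans ht.2⟩⟩)
  have hf0 : ∀ t, 0 ≤ t → 0 ≤ f t := fun t ht =>
    ge_of_tendsto' (hf t ht) fun n => flow_zero_nonneg ht
  have hmc : Continuous fun s : ℝ => max s 0 := by fun_prop
  let μ : Rate :=
    { toFun := fun s => response g K c (max s 0) (f (max s 0)) (v (max s 0))
      continuous_toFun := (continuousOn_response hg hK hc hc0).comp_continuous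
        (f := fun s => (max s 0, f (max s 0), v (max s 0)))
        (hmc.prodMk ((hfc.comp_continuous hmc fun s =>
        mem_Ici.2 (le_max_right _ _)).prodMk
          (hvc.comp_continuous hmc fun s => mem_Ici.2 (le_max_right _ _))))
        fun s => ⟨trivial, hf0 _ (le_max_right _ _), trivial⟩
      nonneg_toFun := fun s => response_nonneg hg hK0 hc0 _ _ _ }
  have hμ : ∀ t, 0 ≤ t → μ t = response g K c t (f t) (v t) := fun t ht => by
    change response _ _ _ _ _ _ = _
    rw [max_eq_left ht]
  have hθ : Tendsto (fun n => φ (ψ n)) atTop atTop := (hφ.comp hψ).tendsto_atTop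
  have hlim : ∀ u, 0 ≤ u → Tendsto (fun n => ν (φ (ψ n)) u) atTop (𝓝 (μ u)) := by
    intro u hu
    -- The delayed times tend to `u`, and the uniform moduli make the delay disappear in the limit.
    set r : ℕ → ℝ := fun n => max (u - 1 / ((φ (ψ n) : ℝ) + 1)) 0 with hr
    have hr0 : ∀ n, 0 ≤ r n := fun n => le_max_right _ _
    have hrlim : Tendsto r atTop (𝓝 u) := by
      have h1 := (tendsto_one_div_add_atTop_nhds_zero_nat (𝕜 := ℝ)).comp hθ
      have h2 := ((tendsto_const_nhds (x := u)).sub h1).max (tendsto_const_nhds (x := (0 : ℝ)))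
      simpa [hr, max_eq_left hu] using h2
    have hru : Tendsto (fun n => |u - r n|) atTop (𝓝 0) := by
      simpa using ((tendsto_const_nhds (x := u)).sub hrlim).abs
    have hrle : ∀ n, r n ≤ u := fun n => max_le (by
      have : (0 : ℝ) < 1 / ((φ (ψ n) : ℝ) + 1) := by positivity
      linarith) hu
    have h1 : Tendsto (fun n => flow (ν (φ (ψ n))) (r n) 0 0) atTop (𝓝 (f u)) := by
      have hd : Tendsto (fun n => flow (ν (φ (ψ n))) u 0 0 - flow (ν (φ (ψ n))) (r n) 0 0) atTop
          (𝓝 0) := squeeze_zero_norm (fun n => by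
            rw [Real.norm_eq_abs]; exact abs_flow_zero_sub_le (hr0 n) hu) hru
      simpa using ((hf u hu).comp hψ.tendsto_atTop).sub hd
    have h2 : Tendsto (fun n => radiusSum g (ν (φ (ψ n))) (r n)) atTop (𝓝 (v u)) := by
      have hd : Tendsto (fun n => radiusSum g (ν (φ (ψ n))) u - radiusSum g (ν (φ (ψ n))) (r n)) atTop
          (𝓝 0) := squeeze_zero_norm (fun n => by
            rw [Real.norm_eq_abs]
            exact abs_radiusSum_sub_le hg ⟨hr0 n, hrle n⟩ (hbd u hu _))
          ((tendsto_sqrt_add_cbrt (g 0 / c u) (g 0)).comp (by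
            simpa using (tendsto_const_nhds (x := u)).sub hrlim))
      simpa using (hv u hu).sub hd
    have h3 := (continuousOn_response hg hK hc hc0 (u, f u, v u)
      ⟨trivial, hf0 u hu, trivial⟩).tendsto.comp
      (tendsto_nhdsWithin_iff.2 ⟨hrlim.prodMk_nhds (h1.prodMk_nhds h2),
        Eventually.of_forall fun n => ⟨trivial, flow_zero_nonneg (hr0 n), trivial⟩⟩)
    rw [hμ u hu]
    refine h3.congr' ?_
    filter_upwards [hθ.eventually_ge_atTop ⌈u⌉₊] with n hn
    exact (hνeq _ u ((Nat.le_ceil u).trans (by exact_mod_cast hn))).symm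
  refine ⟨μ, fun t ht => ?_⟩
  rw [hμ t ht, tendsto_nhds_unique ((hf t ht).comp hψ.tendsto_atTop)
      (tendsto_flow ht (fun n => hbd t ht _) (fun u hu => hlim u hu.1) 0),
    tendsto_nhds_unique (hv t ht)
      (tendsto_radiusSum hg ht (fun n => hbd t ht _) fun u hu => hlim u hu.1)]

end

section

/-! ### Conservation of mass -/

variable {B : ℝ} {g : ℝ → ℝ} {μ : Rate} {t : ℝ}

lemma Profile.tendsto_zero (hg : Profile B g) : Tendsto g atTop (𝓝 0) := by
  refine squeeze_zero' (Eventually.of_forall hg.nonneg) (g := fun x => 1 / x) ?_ ?_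
  · filter_upwards [eventually_gt_atTop 0] with x hx
    have h := hg.mul_le_tail_sub_tail le_rfl hx.le
    rw [hg.tail_zero, sub_zero] at h
    rw [le_div_iff₀ hx]
    linarith [hg.tail_nonneg x]
  · simpa using tendsto_inv_atTop_zero (𝕜 := ℝ)

/-- The size distribution on `(0,∞)` whose complementary distribution function is `g`. -/
def sizeMeasure (hg : Profile B g) : Measure ℝ :=
  (StieltjesFunction.mk (fun x => -g x) (fun _ _ h => neg_le_neg (hg.antitone h))
    fun x => (hg.rightCont x).neg).measure.restrict (Ioi 0)

lemma sizeMeasure_eq (hg : Profile B g) {y : ℝ} (hy : 0 ≤ y) {s : Set ℝ}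
    (hs : s ∩ Ioi 0 = Ioi y) : sizeMeasure hg s = ENNReal.ofReal (g y) := by
  have hle : sizeMeasure hg s = sizeMeasure hg (Ioi y) := by
    rw [sizeMeasure, ← Measure.restrict_apply_univ,
      Measure.restrict_restrict' measurableSet_Ioi, hs,
      Measure.restrict_apply_univ, Measure.restrict_apply measurableSet_Ioi,
      inter_eq_left.2 (Ioi_subset_Ioi hy)]
  rw [hle, sizeMeasure, Measure.restrict_apply measurableSet_Ioi,
    inter_eq_left.2 (Ioi_subset_Ioi hy), StieltjesFunction.measure_Ioi _ (l := 0)]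
  · simp
  · simpa using hg.tendsto_zero.neg

lemma ae_sizeMeasure_pos (hg : Profile B g) : ∀ᵐ ξ ∂sizeMeasure hg, 0 < ξ :=
  ae_restrict_mem measurableSet_Ioi

instance (hg : Profile B g) : SFinite (sizeMeasure hg) := by unfold sizeMeasure; infer_instance

/-- The characteristic on `[0,T]` that starts at `ξ`, extended to all times by constants. -/
def forwardPath (μ : Rate) {T : ℝ} (hT : 0 ≤ T) (s ξ : ℝ) : ℝ :=
  flow μ T (exists_flow_eq (μ := μ) (zero_mem_Icc hT) ξ).choose (max 0 (min s T))

/-! ### Characteristics forward in time and averaging over initial sizes. -/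

section forwardPath

variable {T : ℝ} (hT : 0 ≤ T)

lemma clamp_mem {T : ℝ} (hT : 0 ≤ T) (s : ℝ) : max 0 (min s T) ∈ Icc 0 T :=
  ⟨le_max_left _ _, max_le hT (min_le_right _ _)⟩

lemma clamp_eq {s : ℝ} (hs : s ∈ Icc 0 T) : max 0 (min s T) = s := by
  rw [min_eq_left hs.2, max_eq_right hs.1]

lemma flow_forwardPath {s : ℝ} (hs : s ∈ Icc 0 T) (ξ : ℝ) :
    flow μ s (forwardPath μ hT s ξ) 0 = ξ := by
  rw [forwardPath, clamp_eq hs, flow_flow (zero_mem_Icc hs.1) hs.2]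
  exact (exists_flow_eq (μ := μ) (zero_mem_Icc hT) ξ).choose_spec

lemma forwardPath_zero (ξ : ℝ) : forwardPath μ hT 0 ξ = ξ := by
  have := flow_forwardPath (μ := μ) hT (zero_mem_Icc hT) ξ
  rwa [flow_self le_rfl] at this

lemma lt_forwardPath_iff {s x ξ : ℝ} (hs : s ∈ Icc 0 T) (hx : 0 ≤ x) :
    x < forwardPath μ hT s ξ ↔ flow μ s x 0 < ξ := by
  constructor
  · intro h
    have := flow_zero_lt (μ := μ) hs.1 hx h
    rwa [flow_forwardPath hT hs] at this
  · intro h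
    by_contra hle
    have := flow_mono (μ := μ) (zero_mem_Icc hs.1) (not_lt.1 hle)
    simp only [flow_forwardPath hT hs] at this
    linarith

lemma measurable_forwardPath : Measurable (Function.uncurry (forwardPath μ hT)) := by
  refine measurable_uncurry_of_continuous_of_measurable
    (fun ξ => (continuous_flow hT _).comp (by fun_prop)) fun s => ?_
  have hmono : Monotone fun ξ => (exists_flow_eq (μ := μ) (zero_mem_Icc hT) ξ).choose := by
    intro ξ η h
    by_contra hlt
    have h1 := flow_mono (μ := μ) (zero_mem_Icc hT) (not_le.1 hlt).le
    simp only [(exists_flow_eq (μ := μ) (zero_mem_Icc hT) _).choose_spec] at h1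
    rw [le_antisymm h h1] at hlt
    exact hlt le_rfl
  exact ((flow_mono (μ := μ) (clamp_mem hT s)).comp hmono).measurable

lemma measurable_forwardPath_left (s : ℝ) : Measurable (forwardPath μ hT s) :=
  (measurable_forwardPath (μ := μ) hT).comp measurable_prodMk_left

lemma hasDerivAt_forwardPath {s ξ : ℝ} (hs : s ∈ Ioo 0 T) :
    HasDerivAt (fun s => forwardPath μ hT s ξ) (-1 + μ s * cbrt (forwardPath μ hT s ξ)) s := by
  have hs' := Ioo_subset_Icc_self hs
  have h := (isTrajectory_flow (μ := μ) hT
    (exists_flow_eq (μ := μ) (zero_mem_Icc hT) ξ).choose) s hs'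
  have h1 : forwardPath μ hT s ξ =
      flow μ T (exists_flow_eq (μ := μ) (zero_mem_Icc hT) ξ).choose s := by
    rw [forwardPath, clamp_eq hs']
  rw [h1]
  refine h.congr_of_eventuallyEq ?_
  filter_upwards [Icc_mem_nhds hs.1 hs.2] with u hu
  rw [forwardPath, clamp_eq hu]

/-- At a zero the path goes down strictly, so immediately afterwards its positive part is constantly
zero; only a right derivative exists there in general. -/
lemma hasDerivWithinAt_max_zero {X : ℝ → ℝ} {s a : ℝ} (hX : HasDerivAt X a s)
    (ha : X s = 0 → a < 0) :
    HasDerivWithinAt (fun s => max (X s) 0) (if 0 < X s then a else 0) (Ioi s) s := by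
  rcases lt_trichotomy (X s) 0 with h | h | h
  · rw [if_neg h.not_gt]
    refine ((hasDerivAt_const s (0 : ℝ)).congr_of_eventuallyEq ?_).hasDerivWithinAt
    filter_upwards [hX.continuousAt.eventually (gt_mem_nhds h)] with u hu
    exact max_eq_right hu.le
  · rw [if_neg h.not_gt]
    refine (hasDerivWithinAt_const s (Ioi s) (0 : ℝ)).congr_of_eventuallyEq ?_ (by simp [h])
    have h1 := (hasDerivAt_iff_tendsto_slope.1 hX).mono_left
      (nhdsWithin_mono s (fun u (hu : u ∈ Ioi s) => ne_of_gt hu))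
    filter_upwards [h1.eventually (gt_mem_nhds (ha h)), self_mem_nhdsWithin] with u hu hus
    rw [slope_def_field, h, sub_zero, div_lt_iff₀ (sub_pos.2 hus), zero_mul] at hu
    exact max_eq_right hu.le
  · rw [if_pos h]
    refine (hX.congr_of_eventuallyEq ?_).hasDerivWithinAt
    filter_upwards [hX.continuousAt.eventually (lt_mem_nhds h)] with u hu
    exact max_eq_left hu.le

/-- The integral over `[0,T]` of `(max X 0)' = μ cbrt X - 1_{X > 0}`. The negative term is moved to
the left so that all terms are nonnegative and Tonelli applies without integrability conditions. -/
lemma forwardPath_balance {ξ : ℝ} (hξ : 0 < ξ) :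
    ENNReal.ofReal (max (forwardPath μ hT T ξ) 0) +
        ∫⁻ s in Ioc 0 T, {s | 0 < forwardPath μ hT s ξ}.indicator 1 s =
      ENNReal.ofReal ξ + ∫⁻ s in Ioc 0 T, ENNReal.ofReal (μ s * cbrt (forwardPath μ hT s ξ)) := by
  set X := fun s => forwardPath μ hT s ξ with hX
  have hXc : Continuous X := (continuous_flow hT _).comp (by fun_prop)
  have hms : MeasurableSet {s | 0 < X s} := (isOpen_lt continuous_const hXc).measurableSet
  have hfc : Continuous fun s => μ s * cbrt (X s) := μ.continuous.mul (continuous_cbrt.comp hXc)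
  have hi1 : IntervalIntegrable (fun s => μ s * cbrt (X s)) volume 0 T :=
    hfc.intervalIntegrable _ _
  have hi2' : IntegrableOn ({s | 0 < X s}.indicator (1 : ℝ → ℝ)) (Ioc 0 T) :=
    (integrable_const (1 : ℝ)).indicator hms
  have hi2 : IntervalIntegrable ({s | 0 < X s}.indicator (1 : ℝ → ℝ)) volume 0 T := by
    rwa [intervalIntegrable_iff_integrableOn_Ioc_of_le hT]
  have hftc : ∫ s in (0 : ℝ)..T, (μ s * cbrt (X s) - {s | 0 < X s}.indicator (1 : ℝ → ℝ) s) =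
      max (X T) 0 - max (X 0) 0 := by
    refine intervalIntegral.integral_eq_sub_of_hasDeriv_right_of_le hT
      (hXc.max continuous_const).continuousOn (fun s hs => ?_) (hi1.sub hi2)
    refine (hasDerivWithinAt_max_zero (hasDerivAt_forwardPath (μ := μ) (ξ := ξ) hT hs)
      ?_).congr_deriv ?_
    rotate_left
    · change (if 0 < X s then -1 + μ s * cbrt (X s) else 0) = _
      by_cases h : 0 < X s
      · rw [indicator_of_mem (by exact h), if_pos h, Pi.one_apply]; ring
      · rw [indicator_of_notMem (by exact h), if_neg h, cbrt_of_nonpos (not_lt.1 h)]; ring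
    · intro h
      rw [h, cbrt_of_nonpos le_rfl]; norm_num
  rw [intervalIntegral.integral_sub hi1 hi2] at hftc
  have hX0 : X 0 = ξ := forwardPath_zero hT ξ
  rw [hX0, max_eq_left hξ.le, intervalIntegral.integral_of_le hT,
    intervalIntegral.integral_of_le hT] at hftc
  have h1 : ∫⁻ s in Ioc 0 T, {s | 0 < X s}.indicator 1 s =
      ENNReal.ofReal (∫ s in Ioc 0 T, {s | 0 < X s}.indicator (1 : ℝ → ℝ) s) := by
    rw [ofReal_integral_eq_lintegral_ofReal hi2'
      (Eventually.of_forall fun s => indicator_nonneg (fun _ _ => zero_le_one) s)]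
    refine lintegral_congr fun s => ?_
    by_cases h : s ∈ {s | 0 < X s} <;> simp [h]
  have h2 : ∫⁻ s in Ioc 0 T, ENNReal.ofReal (μ s * cbrt (X s)) =
      ENNReal.ofReal (∫ s in Ioc 0 T, μ s * cbrt (X s)) := by
    rw [ofReal_integral_eq_lintegral_ofReal
      ((intervalIntegrable_iff_integrableOn_Ioc_of_le hT).1 hi1)
      (Eventually.of_forall fun s => mul_nonneg (μ.nonneg s) (cbrt_nonneg _))]
  rw [h1, h2, ← ENNReal.ofReal_add (le_max_right _ _), ← ENNReal.ofReal_add hξ.le]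
  · congr 1
    linarith
  · exact integral_nonneg fun s => mul_nonneg (μ.nonneg s) (cbrt_nonneg _)
  · exact integral_nonneg fun s => indicator_nonneg (fun _ _ => zero_le_one) s

lemma sizeMeasure_lt_forwardPath (hg : Profile B g) {s x : ℝ} (hs : s ∈ Icc 0 T) (hx : 0 ≤ x) :
    sizeMeasure hg {ξ | x < forwardPath μ hT s ξ} = ENNReal.ofReal (profileAt g μ s x) := by
  refine sizeMeasure_eq hg (flow_nonneg (zero_mem_Icc hs.1) hx) ?_
  ext ξ
  simp only [mem_inter_iff, mem_ofPred_eq, mem_Ioi, lt_forwardPath_iff hT hs hx]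
  exact ⟨fun h => h.1, fun h => ⟨h, (flow_nonneg (zero_mem_Icc hs.1) hx).trans_lt h⟩⟩

lemma lintegral_forwardPath (hg : Profile B g) {s : ℝ} (hs : s ∈ Icc 0 T) :
    ∫⁻ ξ, ENNReal.ofReal (max (forwardPath μ hT s ξ) 0) ∂sizeMeasure hg =
      ∫⁻ x in Ioi 0, ENNReal.ofReal (profileAt g μ s x) := by
  rw [lintegral_eq_lintegral_meas_lt (f := fun ξ => max (forwardPath μ hT s ξ) 0) _
    (Eventually.of_forall fun _ => le_max_right _ _)
    ((measurable_forwardPath_left hT s).max measurable_const).aemeasurable]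
  refine setLIntegral_congr_fun measurableSet_Ioi fun x hx => ?_
  have hx' : (0 : ℝ) < x := hx
  simp only [lt_max_iff, hx'.not_gt, or_false]
  exact sizeMeasure_lt_forwardPath hT hg hs hx'.le

lemma lintegral_cbrt_forwardPath (hg : Profile B g) {s : ℝ} (hs : s ∈ Icc 0 T) :
    ∫⁻ ξ, ENNReal.ofReal (cbrt (forwardPath μ hT s ξ)) ∂sizeMeasure hg =
      ENNReal.ofReal (radiusSum g μ s) := by
  rw [lintegral_eq_lintegral_meas_lt _ (Eventually.of_forall fun _ => cbrt_nonneg _)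
    (continuous_cbrt.measurable.comp (measurable_forwardPath_left hT s)).aemeasurable, radiusSum,
    ofReal_integral_eq_lintegral_ofReal (integrableOn_profileAt_cube hg hs.1)
      (Eventually.of_forall fun _ => hg.nonneg _)]
  refine setLIntegral_congr_fun measurableSet_Ioi fun x hx => ?_
  have hx' : (0 : ℝ) ≤ x := le_of_lt hx
  simp only [lt_cbrt_iff hx']
  exact sizeMeasure_lt_forwardPath hT hg hs (by positivity)

/-- Average `forwardPath_balance` over the initial sizes and exchange integrals. The surviving
particles number `w(0,s)`, and the layer-cake formula turns the mean size and mean radius into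
integrals of the profile. -/
lemma mass_balance {T : ℝ} (hT : 0 ≤ T) (μ : Rate) (hg : Profile B g) :
    (∫⁻ x in Ioi 0, ENNReal.ofReal (profileAt g μ T x)) +
        ∫⁻ s in Ioc 0 T, ENNReal.ofReal (profileAt g μ s 0) =
      1 + ∫⁻ s in Ioc 0 T, ENNReal.ofReal (μ s * radiusSum g μ s) := by
  have hmeas := measurable_forwardPath (μ := μ) hT
  have h := lintegral_congr_ae ((ae_sizeMeasure_pos hg).mono fun ξ hξ =>
    forwardPath_balance (μ := μ) hT hξ)
  have hm1 : Measurable fun ξ => ENNReal.ofReal (max (forwardPath μ hT T ξ) 0) :=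
    ((measurable_forwardPath_left hT T).max measurable_const).ennreal_ofReal
  have hF1 : Measurable (Function.uncurry fun s ξ =>
      {s | 0 < forwardPath μ hT s ξ}.indicator (1 : ℝ → ENNReal) s) := by
    have : (Function.uncurry fun s ξ =>
      {s | 0 < forwardPath μ hT s ξ}.indicator (1 : ℝ → ENNReal) s) =
      ((Function.uncurry (forwardPath μ hT)) ⁻¹' Ioi 0).indicator 1 := by
      ext ⟨s, ξ⟩
      simp [Function.uncurry, indicator]
    rw [this]
    exact measurable_one.indicator (hmeas measurableSet_Ioi)
  have hF2 : Measurable (Function.uncurry fun s ξ =>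
      ENNReal.ofReal (μ s * cbrt (forwardPath μ hT s ξ))) :=
    ((μ.continuous.measurable.comp measurable_fst).mul
      (continuous_cbrt.measurable.comp hmeas)).ennreal_ofReal
  rw [lintegral_add_left hm1,
    lintegral_add_left (f := fun ξ => ENNReal.ofReal ξ) measurable_id.ennreal_ofReal,
    lintegral_forwardPath hT hg ⟨hT, le_rfl⟩,
    lintegral_lintegral_swap (f := fun ξ s =>
      {s | 0 < forwardPath μ hT s ξ}.indicator (1 : ℝ → ENNReal) s)
      (hF1.comp measurable_swap).aemeasurable,
    lintegral_lintegral_swap (f := fun ξ s =>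
      ENNReal.ofReal (μ s * cbrt (forwardPath μ hT s ξ)))
      (hF2.comp measurable_swap).aemeasurable] at h
  have h0 : ∫⁻ ξ, ENNReal.ofReal ξ ∂sizeMeasure hg = 1 := by
    have h1 := lintegral_forwardPath (μ := μ) hT hg (zero_mem_Icc hT)
    simp only [forwardPath_zero, profileAt_time_zero] at h1
    rw [← ofReal_integral_eq_lintegral_ofReal hg.integrable (Eventually.of_forall hg.nonneg),
      hg.integral_eq_one, ENNReal.ofReal_one] at h1
    rw [← h1]
    refine lintegral_congr_ae ((ae_sizeMeasure_pos hg).mono fun ξ hξ => ?_)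
    simp only [max_eq_left hξ.le]
  have h2 : ∫⁻ s in Ioc 0 T, ∫⁻ ξ, {s | 0 < forwardPath μ hT s ξ}.indicator 1 s ∂sizeMeasure hg =
      ∫⁻ s in Ioc 0 T, ENNReal.ofReal (profileAt g μ s 0) := by
    refine setLIntegral_congr_fun measurableSet_Ioc fun s hs => ?_
    have hs' := Ioc_subset_Icc_self hs
    rw [← sizeMeasure_lt_forwardPath hT hg hs' le_rfl, ← lintegral_indicator_one
      (measurableSet_lt measurable_const (measurable_forwardPath_left hT s))]
    rfl
  have h3 : ∫⁻ s in Ioc 0 T, ∫⁻ ξ, ENNReal.ofReal (μ s * cbrt (forwardPath μ hT s ξ)) ∂sizeMeasure hg =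
      ∫⁻ s in Ioc 0 T, ENNReal.ofReal (μ s * radiusSum g μ s) := by
    refine setLIntegral_congr_fun measurableSet_Ioc fun s hs => ?_
    have hs' := Ioc_subset_Icc_self hs
    simp only [ENNReal.ofReal_mul (μ.nonneg s)]
    rw [lintegral_const_mul (f := fun ξ => ENNReal.ofReal (cbrt (forwardPath μ hT s ξ))) _
      (continuous_cbrt.measurable.comp
      (measurable_forwardPath_left hT s)).ennreal_ofReal, lintegral_cbrt_forwardPath hT hg hs']
  simpa only [id, h0, h2, h3] using h

/-- Gain and loss cancel under the relation for the rate. It is required only before time `t`, which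
the continuity argument in `exists_isSelfConsistent` exploits. -/
lemma integral_profileAt_eq_one (hg : Profile B g) (ht : 0 ≤ t)
    (h : ∀ s ∈ Ico 0 t, μ s * radiusSum g μ s = profileAt g μ s 0) :
    ∫ x in Ioi 0, profileAt g μ t x = 1 := by
  have hb := mass_balance ht μ hg
  have h1 : ∫⁻ s in Ioc 0 t, ENNReal.ofReal (μ s * radiusSum g μ s) =
      ∫⁻ s in Ioc 0 t, ENNReal.ofReal (profileAt g μ s 0) := by
    rw [← restrict_Ico_eq_restrict_Ioc]
    exact setLIntegral_congr_fun measurableSet_Ico fun s hs => by rw [h s hs]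
  have hfin : ∫⁻ s in Ioc 0 t, ENNReal.ofReal (profileAt g μ s 0) ≠ ⊤ := by
    refine ne_top_of_le_ne_top (b := ∫⁻ s in Ioc 0 t, ENNReal.ofReal (g 0)) ?_
      (lintegral_mono fun s => ENNReal.ofReal_le_ofReal (hg.le_zero _))
    rw [setLIntegral_const]
    exact ENNReal.mul_ne_top ENNReal.ofReal_ne_top (by simp)
  rw [h1, ENNReal.add_left_inj hfin, ← ofReal_integral_eq_lintegral_ofReal
    (integrableOn_profileAt hg ht) (Eventually.of_forall fun _ => hg.nonneg _),
    ENNReal.ofReal_eq_one] at hb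
  exact hb

end forwardPath

end

/-! ### Bounds under conservation of mass, and removal of the cutoffs. -/

section

/-! ### A priori bounds -/

variable {B : ℝ} {g : ℝ → ℝ} {μ : Rate} {t : ℝ}

/-- Right of `y` the convex flow lies above the extended chord of slope `p`, so `profileAt g μ t z ≤
g (F + p (z - y))`; integrating in `z` produces the factor `1/p`. -/
lemma tail_profileAt_le (hg : Profile B g) (ht : 0 ≤ t) {x y : ℝ} (hx : 0 ≤ x) (hxy : x < y) :
    flowSlope μ t x y * tail (profileAt g μ t) y ≤ tail g (flow μ t y 0) := by
  set p := flowSlope μ t x y with hp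
  have hp0 : 0 < p := flowSlope_pos _ _ _ _
  set F := flow μ t y 0 with hF
  have hF0 : 0 ≤ F := flow_nonneg (zero_mem_Icc ht) (hx.trans hxy.le)
  set f : ℝ → ℝ := fun z => g (z + (F - p * y)) with hf
  have he : p * y + (F - p * y) = F := by ring
  have h1 : ∫ z in Ioi y, f (p * z) = p⁻¹ * tail g F := by
    rw [integral_comp_mul_left_Ioi f y hp0, hf, setIntegral_Ioi_comp_add_right, he, smul_eq_mul,
      tail]
  have h2 : IntegrableOn (fun z => f (p * z)) (Ioi y) := by
    rw [integrableOn_Ioi_comp_mul_left_iff _ _ hp0, hf, integrableOn_Ioi_comp_add_right_iff, he]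
    exact hg.integrableOn_Ioi hF0
  have h3 : tail (profileAt g μ t) y ≤ ∫ z in Ioi y, f (p * z) := by
    refine setIntegral_mono_on ((integrableOn_profileAt hg ht).mono_set
      (Ioi_subset_Ioi (hx.trans hxy.le))) h2 measurableSet_Ioi fun z hz => hg.antitone ?_
    have := flow_ge_chord (μ := μ) ht hx hxy (le_of_lt hz)
    linarith
  rw [h1] at h3
  calc _ ≤ p * (p⁻¹ * tail g F) := mul_le_mul_of_nonneg_left h3 hp0.le
    _ = _ := by field_simp

/-- The bound on the beta function is inherited at later times. -/
lemma inv_profileAt_sub_le (hB : 0 ≤ B) (hg : Profile B g) (ht : 0 ≤ t) {x y : ℝ} (hx : 0 ≤ x)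
    (hxy : x ≤ y) (hpos : 0 < tail (profileAt g μ t) y) :
    0 < profileAt g μ t y ∧
    1 / profileAt g μ t y - 1 / profileAt g μ t x ≤ B * (y - x) / tail (profileAt g μ t) y := by
  have hy : 0 < profileAt g μ t y := by
    refine (hg.nonneg _).lt_of_ne' fun h => hpos.ne' ?_
    exact setIntegral_eq_zero_of_forall_eq_zero fun z hz =>
      le_antisymm (h ▸ antitone_profileAt hg ht (le_of_lt hz)) (hg.nonneg _)
  refine ⟨hy, ?_⟩
  rcases hxy.eq_or_lt with rfl | hlt
  · simp
  have h1 := tail_profileAt_le (μ := μ) hg ht hx hlt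
  have hp0 : 0 < flowSlope μ t x y := flowSlope_pos _ _ _ _
  have h2 := hg.inv_sub_inv_le _ _ (flow_nonneg (zero_mem_Icc ht) hx)
    (flow_mono (μ := μ) (zero_mem_Icc ht) hxy) hy
  refine h2.trans ?_
  have h3 : flow μ t y 0 - flow μ t x 0 = flowSlope μ t x y * (y - x) := by
    have := flow_sub_flow (μ := μ) ht hx (hx.trans hxy) (Or.inr (hx.trans_lt hlt))
    linarith
  rw [h3, div_le_div_iff₀ ((mul_pos hp0 hpos).trans_le h1) hpos]
  have h4 : 0 ≤ B * (y - x) := mul_nonneg hB (sub_nonneg.2 hxy)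
  calc _ = B * (y - x) * (flowSlope μ t x y * tail (profileAt g μ t) y) := by ring
    _ ≤ _ := mul_le_mul_of_nonneg_left h1 h4

lemma one_sub_mul_le_tail (hg : Profile B g) (ht : 0 ≤ t)
    (hm : ∫ x in Ioi 0, profileAt g μ t x = 1) {y : ℝ} (hy : 0 ≤ y) :
    1 - y * profileAt g μ t 0 ≤ tail (profileAt g μ t) y := by
  have hi := integrableOn_profileAt (μ := μ) hg ht
  have h3 := Antitone.integrableOn_Ioc (antitone_profileAt (μ := μ) hg ht) 0 y
  rw [← Ioc_union_Ioi_eq_Ioi hy, setIntegral_union (Ioc_disjoint_Ioi le_rfl) measurableSet_Ioi h3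
    (hi.mono_set (Ioi_subset_Ioi hy))] at hm
  have h4 : ∫ x in Ioc 0 y, profileAt g μ t x ≤ y * profileAt g μ t 0 := by
    calc _ ≤ ∫ x in Ioc 0 y, profileAt g μ t 0 := setIntegral_mono_on h3 (by simp) measurableSet_Ioc
          fun x hx => antitone_profileAt hg ht hx.1.le
      _ = _ := by simp [hy]
  rw [tail]
  linarith

lemma mul_profileAt_le_one (hg : Profile B g) (ht : 0 ≤ t)
    (hm : ∫ x in Ioi 0, profileAt g μ t x = 1) {y : ℝ} (hy : 0 ≤ y) :
    y * profileAt g μ t y ≤ 1 := by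
  have hi := integrableOn_profileAt (μ := μ) hg ht
  calc y * profileAt g μ t y = ∫ x in Ioc 0 y, profileAt g μ t y := by simp [hy]
    _ ≤ ∫ x in Ioc 0 y, profileAt g μ t x := setIntegral_mono_on (by simp)
      (hi.mono_set Ioc_subset_Ioi_self) measurableSet_Ioc
      fun x hx => antitone_profileAt hg ht hx.2
    _ ≤ ∫ x in Ioi 0, profileAt g μ t x := setIntegral_mono_set hi
      (Eventually.of_forall fun _ => hg.nonneg _) (Ioc_subset_Ioi_self.eventuallyLE)
    _ = 1 := hm

lemma profileAt_zero_pos (hg : Profile B g) (ht : 0 ≤ t)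
    (hm : ∫ x in Ioi 0, profileAt g μ t x = 1) : 0 < profileAt g μ t 0 := by
  refine (hg.nonneg _).lt_of_ne' fun h => ?_
  have h0 : ∫ x in Ioi 0, profileAt g μ t x = 0 :=
    setIntegral_eq_zero_of_forall_eq_zero fun x hx =>
      le_antisymm (h ▸ antitone_profileAt hg ht (le_of_lt hx)) (hg.nonneg _)
  exact zero_ne_one (h0.symm.trans hm)

/-- The mean size grows at most linearly. -/
lemma inv_profileAt_zero_le (hB : 0 ≤ B) (hg : Profile B g) (ht : 0 ≤ t)
    (hm : ∀ s ∈ Icc 0 t, ∫ x in Ioi 0, profileAt g μ s x = 1) :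
    1 / profileAt g μ t 0 ≤ 1 / g 0 + B * t := by
  -- `w(0,s+τ) = w(y,s)` for a point `0 ≤ y ≤ τ`, so the beta bound at time `s` controls the change
  -- of `1/w(0,·)`; conserved mass keeps the tail at `y` above `1 - τ g 0`.
  have hstep : ∀ s τ, 0 ≤ s → 0 ≤ τ → s + τ ≤ t → τ * g 0 < 1 →
      1 / profileAt g μ (s + τ) 0 ≤ 1 / profileAt g μ s 0 + B * τ / (1 - τ * g 0) := by
    intro s τ hs hτ hst hτg
    have hmem : s ∈ Icc 0 (s + τ) := ⟨hs, by linarith⟩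
    have hy0 := flow_nonneg (μ := μ) hmem le_rfl
    have hyτ := flow_le_add (μ := μ) hmem 0
    set y := flow μ (s + τ) 0 s with hy
    have hyτ : y ≤ τ := by linarith
    have h1 := one_sub_mul_le_tail hg hs (hm s ⟨hs, by linarith⟩) hy0
    have h2 : y * profileAt g μ s 0 ≤ τ * g 0 :=
      mul_le_mul hyτ (hg.le_zero _) (hg.nonneg _) hτ
    have h3 := (inv_profileAt_sub_le (μ := μ) hB hg hs le_rfl hy0 (by linarith)).2
    rw [hy, profileAt_flow hmem, ← hy, sub_zero] at h3
    have h4 : B * y / tail (profileAt g μ s) y ≤ B * τ / (1 - τ * g 0) :=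
      div_le_div₀ (by positivity) (mul_le_mul_of_nonneg_left hyτ hB) (by linarith) (by linarith)
    linarith
  -- Dividing `[0,t]` into `n + 1` equal steps sends the factor `1 / (1 - τ g 0)` to `1`.
  have hn : ∀ n : ℕ, t / (n + 1) * g 0 < 1 →
      1 / profileAt g μ t 0 ≤ 1 / g 0 + B * t / (1 - t / (n + 1) * g 0) := by
    intro n hn
    have hτ : 0 ≤ t / ((n : ℝ) + 1) := by positivity
    have hk : ∀ k : ℕ, k ≤ n + 1 → 1 / profileAt g μ (k * (t / (n + 1))) 0 ≤
        1 / g 0 + k * (B * (t / (n + 1)) / (1 - t / (n + 1) * g 0)) := by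
      intro k
      induction k with
      | zero => intro _; simp [profileAt_time_zero]
      | succ k ih =>
        intro hk
        have h1 := ih (by omega)
        have hk' : (k : ℝ) + 1 ≤ n + 1 := by exact_mod_cast hk
        have h2 := hstep (k * (t / (n + 1))) (t / (n + 1)) (by positivity) hτ (by
          calc _ = ((k : ℝ) + 1) * (t / (n + 1)) := by ring
            _ ≤ (n + 1) * (t / (n + 1)) := mul_le_mul_of_nonneg_right hk' hτ
            _ = t := by field_simp) hn
        push_cast
        rw [add_one_mul, add_one_mul]
        linarith
    have h := hk (n + 1) le_rfl
    push_cast at h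
    have e1 : ((n : ℝ) + 1) * (t / (n + 1)) = t := by field_simp
    have e2 : ((n : ℝ) + 1) * (B * (t / (n + 1)) / (1 - t / (n + 1) * g 0)) =
        B * t / (1 - t / (n + 1) * g 0) := by field_simp
    rwa [e1, e2] at h
  have hlim : Tendsto (fun n : ℕ => t / ((n : ℝ) + 1) * g 0) atTop (𝓝 0) := by
    have := ((tendsto_one_div_add_atTop_nhds_zero_nat (𝕜 := ℝ)).const_mul t).mul_const (g 0)
    simpa [div_eq_mul_inv] using this
  refine ge_of_tendsto (x := atTop) (f := fun n : ℕ => 1 / g 0 + B * t / (1 - t / (n + 1) * g 0))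
    ?_ ((hlim.eventually (gt_mem_nhds one_pos)).mono hn)
  have := ((tendsto_const_nhds (x := B * t)).div ((tendsto_const_nhds (x := (1 : ℝ))).sub hlim)
    (by norm_num)).const_add (1 / g 0)
  simpa using this

/-- At half the mean size `Λ = 1/w(0)` the tail is at least `1/2`, so the beta bound between `0` and
`Λ/2` gives `1/w(Λ/2) ≤ (1 + B) Λ`. -/
lemma profileAt_half_ge (hB : 0 ≤ B) (hg : Profile B g) (ht : 0 ≤ t)
    (hm : ∫ x in Ioi 0, profileAt g μ t x = 1) :
    profileAt g μ t 0 / (1 + B) ≤ profileAt g μ t (1 / profileAt g μ t 0 / 2) := by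
  have h0 := profileAt_zero_pos hg ht hm
  set Λ := 1 / profileAt g μ t 0 with hΛ
  have hΛ0 : 0 < Λ := by positivity
  have hΛw : Λ * profileAt g μ t 0 = 1 := by rw [hΛ]; field_simp
  have h1 := one_sub_mul_le_tail hg ht hm (y := Λ / 2) (by positivity)
  have h2 : 1 / 2 ≤ tail (profileAt g μ t) (Λ / 2) := by linarith
  obtain ⟨h3, h4⟩ := inv_profileAt_sub_le (μ := μ) hB hg ht le_rfl (y := Λ / 2) (by positivity)
    (by linarith)
  have h5 : B * (Λ / 2 - 0) / tail (profileAt g μ t) (Λ / 2) ≤ B * (Λ / 2 - 0) / (1 / 2) :=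
    div_le_div_of_nonneg_left (by rw [sub_zero]; positivity) (by norm_num) h2
  have h6 : 1 / profileAt g μ t (Λ / 2) ≤ Λ * (1 + B) := by
    rw [← hΛ] at h4
    linarith
  rw [div_le_iff₀ h3] at h6
  rw [div_le_iff₀ (by positivity)]
  calc profileAt g μ t 0 = profileAt g μ t 0 * 1 := (mul_one _).symm
    _ ≤ profileAt g μ t 0 * (Λ * (1 + B) * profileAt g μ t (Λ / 2)) :=
      mul_le_mul_of_nonneg_left h6 h0.le
    _ = (Λ * profileAt g μ t 0) * (profileAt g μ t (Λ / 2) * (1 + B)) := by ring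
    _ = _ := by rw [hΛw, one_mul]

lemma mul_profileAt_cube_le_radiusSum (hg : Profile B g) (ht : 0 ≤ t) {R : ℝ} (hR : 0 ≤ R) :
    R * profileAt g μ t (R ^ 3) ≤ radiusSum g μ t := by
  have hi := integrableOn_profileAt_cube (μ := μ) hg ht
  calc _ = ∫ x in Ioc 0 R, profileAt g μ t (R ^ 3) := by simp [hR]
    _ ≤ ∫ x in Ioc 0 R, profileAt g μ t (x ^ 3) := setIntegral_mono_on (by simp)
      (hi.mono_set Ioc_subset_Ioi_self) measurableSet_Ioc
      fun x hx => antitone_profileAt_cube hg ht hx.2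
    _ ≤ _ := setIntegral_mono_set hi
      (Eventually.of_forall fun _ => hg.nonneg _) (Ioc_subset_Ioi_self.eventuallyLE)

lemma cbrt_mul_le_radiusSum (hB : 0 ≤ B) (hg : Profile B g) (ht : 0 ≤ t)
    (hm : ∫ x in Ioi 0, profileAt g μ t x = 1) :
    cbrt (1 / profileAt g μ t 0 / 2) * (profileAt g μ t 0 / (1 + B)) ≤ radiusSum g μ t := by
  have h0 := profileAt_zero_pos hg ht hm
  refine le_trans (mul_le_mul_of_nonneg_left ?_ (cbrt_nonneg _))
    (mul_profileAt_cube_le_radiusSum hg ht (cbrt_nonneg _))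
  rw [cbrt_pow_three (by positivity)]
  exact profileAt_half_ge hB hg ht hm

/-- Use `w ≤ w(0)` below radius `R` and `w(x) ≤ 1/x`, a consequence of unit mass, above it. -/
lemma radiusSum_le_of_cube (hg : Profile B g) (ht : 0 ≤ t)
    (hm : ∫ x in Ioi 0, profileAt g μ t x = 1) {R : ℝ} (hR : 0 < R) :
    radiusSum g μ t ≤ R * profileAt g μ t 0 + 1 / (2 * R ^ 2) := by
  have hi := integrableOn_profileAt_cube (μ := μ) hg ht
  rw [radiusSum, ← Ioc_union_Ioi_eq_Ioi hR.le, setIntegral_union (Ioc_disjoint_Ioi le_rfl)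
    measurableSet_Ioi (hi.mono_set Ioc_subset_Ioi_self) (hi.mono_set (Ioi_subset_Ioi hR.le))]
  refine add_le_add ?_ ?_
  · calc _ ≤ ∫ x in Ioc 0 R, profileAt g μ t 0 := setIntegral_mono_on
          (hi.mono_set Ioc_subset_Ioi_self) (by simp) measurableSet_Ioc
          fun x hx => antitone_profileAt hg ht (pow_nonneg hx.1.le 3)
      _ = _ := by simp [hR.le]
  · have h1 := integral_Ioi_rpow_of_lt (a := -3) (by norm_num) hR
    have h2 := integrableOn_Ioi_rpow_of_lt (a := -3) (by norm_num) hR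
    calc _ ≤ ∫ x in Ioi R, x ^ (-3 : ℝ) := setIntegral_mono_on
          (hi.mono_set (Ioi_subset_Ioi hR.le)) h2 measurableSet_Ioi fun x hx => by
            have hx0 : 0 < x := hR.trans hx
            have h3 := mul_profileAt_le_one hg ht hm (y := x ^ 3) (by positivity)
            rw [show (-3 : ℝ) = -((3 : ℕ) : ℝ) by norm_num, Real.rpow_neg hx0.le,
              Real.rpow_natCast, ← one_div, le_div_iff₀ (by positivity)]
            linarith
      _ = _ := by
        rw [h1, show (-3 + 1 : ℝ) = -((2 : ℕ) : ℝ) by norm_num, Real.rpow_neg hR.le,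
          Real.rpow_natCast]
        field_simp
        norm_num

/-! ### Rates that solve the self-consistency relation -/

/-- The relation between the rate and the profile in the LSW system. -/
def IsSelfConsistent (g : ℝ → ℝ) (μ : Rate) : Prop :=
  ∀ t, 0 ≤ t → μ t * radiusSum g μ t = profileAt g μ t 0

/-- Conserved mass makes both cutoffs strictly inactive, and inactive cutoffs conserve mass. The
functions `c` and `K` depend on `g` and `B` alone, so they can be chosen before the rate. -/
lemma exists_isSelfConsistent (hB : 0 ≤ B) (hg : Profile B g) :
    ∃ μ : Rate, IsSelfConsistent g μ := by
  have hg0 := hg.zero_pos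
  set Λ₀ := 1 / g 0 with hΛ₀
  have hΛ₀0 : 0 < Λ₀ := by positivity
  set x₀ := Λ₀ / 2 with hx₀
  have hx₀0 : 0 < x₀ := by positivity
  have hcx : 0 < cbrt x₀ := cbrt_pos hx₀0
  -- Half of the a priori lower bound for `radiusSum` that `cbrt_mul_le_radiusSum` and `Λ(t) ≤ Λ₀ +
  -- B t` provide.
  set c : ℝ → ℝ := fun t => cbrt x₀ / (2 * (1 + B) * (Λ₀ + B * max t 0)) with hc
  have hden : ∀ t, 0 < 2 * (1 + B) * (Λ₀ + B * max t 0) := fun t => by positivity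
  have hc0 : ∀ t, 0 < c t := fun t => div_pos hcx (hden t)
  have hcc : Continuous c := Continuous.div (by fun_prop) (by fun_prop) fun t => (hden t).ne'
  have hca : Antitone c := fun s t hst =>
    div_le_div_of_nonneg_left hcx.le (hden s) (by gcongr)
  set M : ℝ → ℝ := fun t => g 0 / c t with hM
  have hM0 : ∀ t, 0 < M t := fun t => div_pos hg0 (hc0 t)
  have hMc : Continuous M := continuous_const.div hcc fun t => (hc0 t).ne'
  have hm0 : ∀ t, 0 < cbrt (min x₀ ((1 / M t) ^ 3)) := fun t =>
    cbrt_pos (lt_min hx₀0 (by have := hM0 t; positivity))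
  -- A lower bound for `flow μ t x₀ 0 - flow μ t 0 0` for every rate bounded by `M t` on `[0,t]`.
  set d : ℝ → ℝ := fun t =>
    Real.exp (-(M t / cbrt (min x₀ ((1 / M t) ^ 3)) ^ 2 * t)) * x₀ with hd
  have hd0 : ∀ t, 0 < d t := fun t => mul_pos (Real.exp_pos _) hx₀0
  have hdc : Continuous d := by
    have h1 : Continuous fun t => cbrt (min x₀ ((1 / M t) ^ 3)) :=
      continuous_cbrt.comp (continuous_const.min
        ((continuous_const.div hMc fun t => (hM0 t).ne').pow 3))
    exact (Real.continuous_exp.comp ((hMc.div (h1.pow 2)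
      fun t => (pow_pos (hm0 t) 2).ne').mul continuous_id).neg).mul continuous_const
  -- The tail of `g` at `flow μ t 0 0` is at least `d t · w(0,t) / (1 + B)`, so this `K` makes the
  -- second entry of the minimum at least `2 w(0,t)`.
  set K : ℝ → ℝ := fun t => 2 * (1 + B) / d t with hK
  have hK0 : ∀ t, 0 ≤ K t := fun t => div_nonneg (by positivity) (hd0 t).le
  have hKc : Continuous K := continuous_const.div hdc fun t => (hd0 t).ne'
  obtain ⟨μ, hμ⟩ := exists_selfconsistent_rate hg hKc hK0 hcc hc0 hca
  refine ⟨μ, ?_⟩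
  have hμM : ∀ t, 0 ≤ t → ∀ u ∈ Icc 0 t, μ u ≤ M t := fun t ht u hu => by
    rw [hμ u hu.1]
    exact (response_le hg hc0 _ _ _).trans
      (div_le_div_of_nonneg_left hg0.le (hc0 t) (hca hu.2))
  have hok : ∀ t, 0 ≤ t → g (flow μ t 0 0) < K t * tail g (flow μ t 0 0) →
      c t < radiusSum g μ t → μ t * radiusSum g μ t = profileAt g μ t 0 := by
    intro t ht h1 h2
    rw [hμ t ht, response, min_eq_left h1.le, max_eq_left h2.le,
      div_mul_cancel₀ _ ((hc0 t).trans h2).ne', profileAt]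
  have hstrict : ∀ t, 0 ≤ t → (∀ s ∈ Icc 0 t, ∫ x in Ioi 0, profileAt g μ s x = 1) →
      0 < g (flow μ t 0 0) ∧ g (flow μ t 0 0) < K t * tail g (flow μ t 0 0) ∧
        c t < radiusSum g μ t := by
    intro t ht hm
    have hmt := hm t ⟨ht, le_rfl⟩
    have hw0 := profileAt_zero_pos hg ht hmt
    have hΛ := inv_profileAt_zero_le hB hg ht hm
    have hhalf := profileAt_half_ge hB hg ht hmt
    have hR := cbrt_mul_le_radiusSum hB hg ht hmt
    set Λ := 1 / profileAt g μ t 0 with hΛdef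
    have hΛ0 : 0 < Λ := by positivity
    have hw : profileAt g μ t 0 = 1 / Λ := by rw [hΛdef, one_div_one_div]
    have hΛ₀Λ : Λ₀ ≤ Λ := one_div_le_one_div_of_le hw0 (hg.le_zero _)
    have hx₀Λ : x₀ ≤ Λ / 2 := by rw [hx₀]; linarith
    refine ⟨hw0, ?_, ?_⟩
    · have h1 := flow_sub_flow (μ := μ) ht hx₀0.le le_rfl (Or.inl hx₀0)
      have h2 : d t ≤ flow μ t x₀ 0 - flow μ t 0 0 := by
        rw [h1, sub_zero]
        exact mul_le_mul_of_nonneg_right (exp_mul_le_flowSlope ht (hM0 t) (hμM t ht) hx₀0) hx₀0.le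
      have h3 := hg.mul_le_tail_sub_tail (flow_zero_nonneg (μ := μ) ht)
        (flow_mono (μ := μ) (zero_mem_Icc ht) hx₀0.le)
      have h4 := hg.tail_nonneg (flow μ t x₀ 0)
      have h5 : profileAt g μ t 0 / (1 + B) ≤ g (flow μ t x₀ 0) :=
        hhalf.trans (antitone_profileAt hg ht hx₀Λ)
      have h6 : d t * (profileAt g μ t 0 / (1 + B)) ≤ tail g (flow μ t 0 0) :=
        (mul_le_mul h2 h5 (by positivity) ((hd0 t).le.trans h2)).trans (by linarith)
      calc g (flow μ t 0 0) < 2 * profileAt g μ t 0 := by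
            change profileAt g μ t 0 < _; linarith
        _ = K t * (d t * (profileAt g μ t 0 / (1 + B))) := by
            have := hd0 t
            simp only [hK]; field_simp
        _ ≤ _ := mul_le_mul_of_nonneg_left h6 (hK0 t)
    · refine lt_of_lt_of_le ?_ hR
      have h1 : c t < cbrt x₀ / ((1 + B) * (Λ₀ + B * t)) := by
        simp only [hc, max_eq_left ht]
        have : 0 < (1 + B) * (Λ₀ + B * t) := by positivity
        exact div_lt_div_of_pos_left hcx this (by linarith)
      refine h1.trans_le ?_
      rw [hw]
      calc _ ≤ cbrt (Λ / 2) / ((1 + B) * Λ) := div_le_div₀ (cbrt_nonneg _) (cbrt_mono hx₀Λ)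
            (by positivity) (mul_le_mul_of_nonneg_left hΛ (by positivity))
        _ = _ := by field_simp
  by_contra hnot
  set S : Set ℝ := {t | 0 ≤ t ∧ μ t * radiusSum g μ t ≠ profileAt g μ t 0} with hS
  have hSne : S.Nonempty := by
    simp only [IsSelfConsistent, not_forall] at hnot
    obtain ⟨t, ht, h⟩ := hnot
    exact ⟨t, ht, h⟩
  have hSbd : BddBelow S := ⟨0, fun t ht => ht.1⟩
  -- Validity before `T` already conserves mass up to and including `T`. The strict inequalities at
  -- `T` persist slightly beyond it by continuity, contradicting that `T` is the infimum.
  set T := sInf S with hT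
  have hT0 : 0 ≤ T := le_csInf hSne fun t ht => ht.1
  have hbefore : ∀ s ∈ Ico 0 T, μ s * radiusSum g μ s = profileAt g μ s 0 := fun s hs => by
    by_contra h
    exact hs.2.not_ge (csInf_le hSbd ⟨hs.1, h⟩)
  obtain ⟨h1, h2, h3⟩ := hstrict T hT0 fun s hs =>
    integral_profileAt_eq_one hg hs.1 fun u hu => hbefore u ⟨hu.1, hu.2.trans_le hs.2⟩
  have hθ := continuousOn_flow_zero μ T hT0
  have hev : ∀ᶠ s in 𝓝[Ici 0] T, μ s * radiusSum g μ s = profileAt g μ s 0 := by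
    have e1 : ContinuousWithinAt (fun s => g (flow μ s 0 0)) (Ici 0) T :=
      ContinuousAt.comp_continuousWithinAt (f := fun s => flow μ s 0 0) (hg.continuousAt _ h1) hθ
    have e2 : ContinuousWithinAt (fun s => K s * tail g (flow μ s 0 0)) (Ici 0) T :=
      hKc.continuousWithinAt.mul ((hg.continuousOn_tail _ (flow_zero_nonneg hT0)).comp
        (f := fun s => flow μ s 0 0) hθ fun s hs => flow_zero_nonneg hs)
    filter_upwards [e1.eventually_lt e2 h2,
      hcc.continuousWithinAt.eventually_lt (continuousOn_radiusSum hg μ T hT0) h3,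
      self_mem_nhdsWithin] with s hs1 hs2 hs3
    exact hok s hs3 hs1 hs2
  obtain ⟨ε, hε, hεs⟩ := Metric.mem_nhdsWithin_iff.1 hev
  obtain ⟨s, hsS, hsT⟩ := exists_lt_of_csInf_lt hSne (show sInf S < T + ε by linarith)
  have hTs : T ≤ s := csInf_le hSbd hsS
  exact hsS.2 (hεs ⟨by rw [Metric.mem_ball, Real.dist_eq, abs_of_nonneg (by linarith)]; linarith,
    hsS.1⟩)

end

/-! ### Differentiability of the solution and growth of `L`. -/

section

variable {B : ℝ} {g : ℝ → ℝ} {μ : Rate} {t : ℝ}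

/-! ### Derivatives of the flow -/

lemma IsTrajectory.abs_flow_sub_le {T s : ℝ} {Z : ℝ → ℝ} (hZ : IsTrajectory μ T Z) (htT : t ≤ T)
    (hs : s ∈ Icc 0 t) (x : ℝ) : |flow μ t x s - Z s| ≤ |x - Z t| := by
  rw [(hZ.mono htT).eq_flow hs]
  exact LSW.abs_flow_sub_le hs x (Z t)

/-- The derivative of `x ↦ flow μ t x 0` at `Z t`. -/
def flowDeriv (μ : Rate) (t : ℝ) (Z : ℝ → ℝ) : ℝ :=
  Real.exp (-∫ s in (0 : ℝ)..t, μ s / cbrtDen (Z s) (Z s))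

/-- The reference characteristic `Z` is continued past `t` up to `T`, so the end times `τ` may
approach `t` from both sides. -/
lemma IsTrajectory.tendsto_flow {ι : Type*} {T s : ℝ} {Z : ℝ → ℝ} (hZ : IsTrajectory μ T Z)
    (hZc : Continuous Z) (htT : t < T) {l : Filter ι} {y τ : ι → ℝ} (hy : Tendsto y l (𝓝 (Z t)))
    (hτ : Tendsto τ l (𝓝 t)) (hs : s ∈ Ico 0 t) :
    Tendsto (fun i => flow μ (τ i) (y i) s) l (𝓝 (Z s)) := by
  have h1 : Tendsto (fun i => |y i - Z (τ i)|) l (𝓝 0) := by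
    simpa using (hy.sub ((hZc.tendsto t).comp hτ)).abs
  rw [tendsto_iff_dist_tendsto_zero]
  refine squeeze_zero' (Eventually.of_forall fun _ => dist_nonneg) ?_ h1
  filter_upwards [hτ.eventually (gt_mem_nhds htT), hτ.eventually (lt_mem_nhds hs.2)] with i hi hi'
  rw [Real.dist_eq]
  exact hZ.abs_flow_sub_le hi.le ⟨hs.1, hi'.le⟩ _

lemma tendsto_flowSlope_integrand {ι : Type*} {T s : ℝ} {Z : ℝ → ℝ} (hZ : IsTrajectory μ T Z)
    (hZc : Continuous Z) (htT : t < T) (hpos : 0 < Z t) {l : Filter ι} {y z τ : ι → ℝ}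
    (hy : Tendsto y l (𝓝 (Z t))) (hz : Tendsto z l (𝓝 (Z t))) (hτ : Tendsto τ l (𝓝 t))
    (hs : s ∈ Ico 0 t) :
    Tendsto (fun i => μ s / cbrtDen (flow μ (τ i) (y i) s) (flow μ (τ i) (z i) s)) l
      (𝓝 (μ s / cbrtDen (Z s) (Z s))) := by
  have hZs : 0 < Z s := by
    rw [(hZ.mono htT.le).eq_flow ⟨hs.1, hs.2.le⟩]
    exact flow_pos ⟨hs.1, hs.2.le⟩ hpos
  have h1 := (hZ.tendsto_flow hZc htT hy hτ hs).prodMk_nhds (hZ.tendsto_flow hZc htT hz hτ hs)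
  have h2 : Tendsto (fun p : ℝ × ℝ => cbrtDen p.1 p.2) (𝓝 (Z s, Z s))
      (𝓝 (cbrtDen (Z s) (Z s))) := continuous_cbrtDen.tendsto (Z s, Z s)
  have h3 := (tendsto_const_nhds (x := μ s) (f := l)).div (h2.comp h1)
    (cbrtDen_pos (Or.inl hZs)).ne'
  exact h3

lemma tendsto_flowSlope {T : ℝ} {Z : ℝ → ℝ} (hZ : IsTrajectory μ T Z) (hZc : Continuous Z)
    (ht : 0 ≤ t) (htT : t < T) (hpos : 0 < Z t) {l : Filter ℝ} [l.IsCountablyGenerated]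
    {y z τ : ℝ → ℝ} (hy : Tendsto y l (𝓝 (Z t))) (hz : Tendsto z l (𝓝 (Z t)))
    (hτ : Tendsto τ l (𝓝 t)) (hτ0 : ∀ᶠ i in l, 0 ≤ τ i) :
    Tendsto (fun i => flowSlope μ (τ i) (y i) (z i)) l (𝓝 (flowDeriv μ t Z)) := by
  have hT : 0 ≤ T := ht.trans htT.le
  obtain ⟨M, hM, hμ⟩ := μ.exists_bound T
  set m := min (Z t / 2) ((1 / M) ^ 3) with hm
  have hm0 : 0 < m := lt_min (by positivity) (by positivity)
  have hcm := cbrt_pos hm0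
  have hev : ∀ᶠ i in l, 0 ≤ τ i ∧ τ i < T ∧ Z t / 2 < y i := by
    filter_upwards [hτ0, hτ.eventually (gt_mem_nhds htT),
      hy.eventually (lt_mem_nhds (half_lt_self hpos))] with i h1 h2 h3 using ⟨h1, h2, h3⟩
  set f : ℝ → ℝ → ℝ :=
    fun i s => μ s / cbrtDen (flow μ (τ i) (y i) s) (flow μ (τ i) (z i) s) with hf
  set f₀ : ℝ → ℝ := fun s => μ s / cbrtDen (Z s) (Z s) with hf₀
  have hint : ∀ᶠ i in l, ∫ s in (0 : ℝ)..τ i, f i s = ∫ s, (Ioc 0 (τ i)).indicator (f i) s := by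
    filter_upwards [hev] with i hi
    rw [intervalIntegral.integral_of_le hi.1, integral_indicator measurableSet_Ioc]
  have hint₀ : ∫ s in (0 : ℝ)..t, f₀ s = ∫ s, (Ioc 0 t).indicator f₀ s := by
    rw [intervalIntegral.integral_of_le ht, integral_indicator measurableSet_Ioc]
  have hlim : Tendsto (fun i => ∫ s, (Ioc 0 (τ i)).indicator (f i) s) l
      (𝓝 (∫ s, (Ioc 0 t).indicator f₀ s)) := by
    -- Indicators absorb the moving end point `τ`. Their convergence may fail only at `s = t`, and
    -- backward lower bounds on the characteristics keep the denominators away from zero.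
    refine tendsto_integral_filter_of_dominated_convergence
      ((Ioc 0 T).indicator fun _ => M / cbrt m ^ 2) ?_ ?_ ?_ ?_
    · filter_upwards [hev] with i hi
      refine Measurable.aestronglyMeasurable (Measurable.indicator ?_ measurableSet_Ioc)
      exact μ.continuous.measurable.div (continuous_cbrtDen.comp
        ((continuous_flow hi.1 _).prodMk (continuous_flow hi.1 _))).measurable
    · filter_upwards [hev] with i hi
      refine Eventually.of_forall fun s => ?_
      by_cases hs : s ∈ Ioc 0 (τ i)
      · rw [indicator_of_mem hs, indicator_of_mem (Ioc_subset_Ioc_right hi.2.1.le hs)]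
        have hs' := Ioc_subset_Icc_self hs
        have h1 : m ≤ flow μ (τ i) (y i) s :=
          (min_le_min_right _ hi.2.2.le).trans (min_inv_cube_le_flow hs' hM
            (fun u hu => hμ u ⟨hu.1, hu.2.trans hi.2.1.le⟩) _)
        have h2 : cbrt m ^ 2 ≤ cbrtDen (flow μ (τ i) (y i) s) (flow μ (τ i) (z i) s) := by
          have h3 := pow_le_pow_left₀ hcm.le (cbrt_mono h1) 2
          have h4 := cbrt_nonneg (flow μ (τ i) (y i) s)
          have h5 := cbrt_nonneg (flow μ (τ i) (z i) s)
          unfold cbrtDen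
          nlinarith [mul_nonneg h4 h5, sq_nonneg (cbrt (flow μ (τ i) (z i) s))]
        have h6 : 0 < cbrt m ^ 2 := by positivity
        rw [Real.norm_of_nonneg (div_nonneg (μ.nonneg s) (h6.trans_le h2).le)]
        exact div_le_div₀ hM.le (hμ s ⟨hs.1.le, hs.2.trans hi.2.1.le⟩) h6 h2
      · rw [indicator_of_notMem hs, norm_zero]
        exact indicator_nonneg (fun _ _ => by positivity) s
    · exact (integrable_indicator_iff measurableSet_Ioc).2 (by simp)
    · have hne : ∀ᵐ s : ℝ, s ≠ t := by simp [ae_iff, measure_singleton]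
      filter_upwards [hne] with s hst
      rcases le_or_gt s 0 with hs0 | hs0
      · simp [hs0.not_gt, tendsto_const_nhds]
      rcases lt_or_gt_of_ne hst with hlt | hgt
      · rw [indicator_of_mem (show s ∈ Ioc 0 t from ⟨hs0, hlt.le⟩)]
        have hquot : Tendsto (fun i => f i s) l (𝓝 (f₀ s)) :=
          tendsto_flowSlope_integrand hZ hZc htT hpos hy hz hτ ⟨hs0.le, hlt⟩
        refine hquot.congr' ?_
        filter_upwards [hτ.eventually (lt_mem_nhds hlt)] with i hi
        rw [indicator_of_mem (show s ∈ Ioc 0 (τ i) from ⟨hs0, hi.le⟩)]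
      · rw [indicator_of_notMem fun h => hgt.not_ge h.2]
        refine tendsto_const_nhds.congr' ?_
        filter_upwards [hτ.eventually (gt_mem_nhds hgt)] with i hi
        rw [indicator_of_notMem fun h => hi.not_ge h.2]
  rw [← hint₀] at hlim
  exact (Real.continuous_exp.tendsto _).comp (hlim.congr' (hint.mono fun i hi => hi.symm)).neg

lemma hasDerivAt_flow_space {T : ℝ} {Z : ℝ → ℝ} (hZ : IsTrajectory μ T Z) (hZc : Continuous Z)
    (ht : 0 ≤ t) (htT : t < T) (hpos : 0 < Z t) :
    HasDerivAt (fun x => flow μ t x 0) (flowDeriv μ t Z) (Z t) := by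
  rw [hasDerivAt_iff_tendsto_slope]
  have h := tendsto_flowSlope (l := 𝓝[≠] (Z t)) (y := fun x => x) (z := fun _ => Z t)
    (τ := fun _ => t) hZ hZc ht htT hpos (tendsto_id.mono_left nhdsWithin_le_nhds)
    tendsto_const_nhds tendsto_const_nhds (Eventually.of_forall fun _ => ht)
  refine h.congr' ?_
  filter_upwards [self_mem_nhdsWithin, nhdsWithin_le_nhds (lt_mem_nhds hpos)] with x hx hx0
  rw [slope_def_field, flow_sub_flow ht hx0.le hpos.le (Or.inl hx0),
    mul_div_cancel_right₀ _ (sub_ne_zero.2 hx)]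

/-- The starting point is constant along `Z`, so the time increment at fixed `x = Z t` equals the
space increment at time `s` from `Z s` to `Z t`, a `flowSlope` times `-(Z s - Z t)`. -/
lemma hasDerivAt_flow_time {T : ℝ} {Z : ℝ → ℝ} (hZ : IsTrajectory μ T Z) (hZc : Continuous Z)
    (ht : 0 < t) (htT : t < T) (hpos : 0 < Z t) :
    HasDerivAt (fun s => flow μ s (Z t) 0) (flowDeriv μ t Z * (1 - μ t * cbrt (Z t))) t := by
  rw [hasDerivAt_iff_tendsto_slope]
  have hZt : Tendsto Z (𝓝[≠] t) (𝓝 (Z t)) := (hZc.tendsto t).mono_left nhdsWithin_le_nhds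
  have hid : Tendsto (fun s : ℝ => s) (𝓝[≠] t) (𝓝 t) := tendsto_id.mono_left nhdsWithin_le_nhds
  have h := tendsto_flowSlope (l := 𝓝[≠] t) (y := fun _ => Z t) (z := Z)
    (τ := fun s => s) hZ hZc ht.le htT hpos tendsto_const_nhds hZt hid
    (nhdsWithin_le_nhds ((lt_mem_nhds ht).mono fun _ h => h.le))
  have h2 := hasDerivAt_iff_tendsto_slope.1 (hZ t ⟨ht.le, htT.le⟩)
  have h3 := h.mul h2.neg
  rw [show -(-1 + μ t * cbrt (Z t)) = 1 - μ t * cbrt (Z t) by ring] at h3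
  refine h3.congr' ?_
  filter_upwards [self_mem_nhdsWithin, nhdsWithin_le_nhds (lt_mem_nhds ht),
    nhdsWithin_le_nhds (gt_mem_nhds htT), hZt.eventually (lt_mem_nhds hpos)] with s hst hs0 hsT hZs
  have h4 : flow μ t (Z t) 0 = flow μ s (Z s) 0 := by
    rw [← (hZ.mono htT.le).eq_flow (zero_mem_Icc ht.le),
      ← (hZ.mono hsT.le).eq_flow (zero_mem_Icc hs0.le)]
  rw [slope_def_field, slope_def_field, h4, flow_sub_flow hs0.le hpos.le hZs.le (Or.inl hpos)]
  ring

lemma exists_hasDerivAt_flow (μ : Rate) {x : ℝ} (hx : 0 < x) (ht : 0 < t) :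
    ∃ a, HasDerivAt (fun y => flow μ t y 0) a x ∧
      HasDerivAt (fun s => flow μ s x 0) (a * (1 - μ t * cbrt x)) t := by
  have hT : 0 ≤ t + 1 := by linarith
  obtain ⟨z, hz⟩ := exists_flow_eq (μ := μ) (t := t + 1) ⟨ht.le, by linarith⟩ x
  have h1 := isTrajectory_flow (μ := μ) hT z
  have h2 := continuous_flow (μ := μ) hT z
  refine ⟨flowDeriv μ t (flow μ (t + 1) z), ?_, ?_⟩
  · simpa only [hz] using hasDerivAt_flow_space h1 h2 ht.le (lt_add_one t) (hz ▸ hx)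
  · simpa only [hz] using hasDerivAt_flow_time h1 h2 ht (lt_add_one t) (hz ▸ hx)

/-! ### The parameter `L` -/

lemma volumeL_eq (w : ℝ → ℝ) : volumeL w = ((∫ ρ in Ioi 0, w (ρ ^ 3)) / w 0) ^ 3 := by
  have h := integral_comp_rpow_Ioi (fun ρ => w (ρ ^ 3)) (p := 1 / 3) (by norm_num)
  rw [volumeL, ← h, ← integral_const_mul]
  congr 2
  refine setIntegral_congr_fun measurableSet_Ioi fun x hx => ?_
  have hx0 : (0 : ℝ) < x := hx
  simp only [smul_eq_mul]
  rw [← cbrt_eq_rpow hx0.le, cbrt_pow_three hx0.le]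
  norm_num
  ring

lemma volumeL_profileAt : volumeL (fun x => profileAt g μ t x) =
    (radiusSum g μ t / profileAt g μ t 0) ^ 3 := volumeL_eq _

namespace IsSelfConsistent

lemma mass (h : IsSelfConsistent g μ) (hg : Profile B g) (ht : 0 ≤ t) :
    ∫ x in Ioi 0, profileAt g μ t x = 1 :=
  integral_profileAt_eq_one hg ht fun s hs => h s hs.1

lemma profileAt_zero_pos (h : IsSelfConsistent g μ) (hg : Profile B g) (ht : 0 ≤ t) :
    0 < profileAt g μ t 0 := LSW.profileAt_zero_pos hg ht (h.mass hg ht)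

lemma radiusSum_pos (h : IsSelfConsistent g μ) (hg : Profile B g) (ht : 0 ≤ t) :
    0 < radiusSum g μ t := by
  have h1 := h.profileAt_zero_pos hg ht
  rw [← h t ht] at h1
  exact pos_of_mul_pos_right h1 (μ.nonneg t)

lemma rate_eq (h : IsSelfConsistent g μ) (hg : Profile B g) (ht : 0 ≤ t) :
    μ t = profileAt g μ t 0 / radiusSum g μ t := by
  rw [eq_div_iff (h.radiusSum_pos hg ht).ne', h t ht]

lemma div_volumeL_rpow (h : IsSelfConsistent g μ) (hg : Profile B g) (ht : 0 ≤ t) {x : ℝ}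
    (hx : 0 ≤ x) :
    (x / volumeL (fun y => profileAt g μ t y)) ^ (1 / 3 : ℝ) = μ t * cbrt x := by
  have h1 := h.profileAt_zero_pos hg ht
  have h2 := h.radiusSum_pos hg ht
  have h3 : x / volumeL (fun y => profileAt g μ t y) = (μ t * cbrt x) ^ 3 := by
    rw [volumeL_profileAt, mul_pow, cbrt_pow_three hx, h.rate_eq hg ht]
    field_simp
  rw [h3, ← cbrt_eq_rpow (pow_nonneg (mul_nonneg (μ.nonneg t) (cbrt_nonneg x)) 3),
    cbrt_cube (mul_nonneg (μ.nonneg t) (cbrt_nonneg x))]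

/-- If `g` vanishes at the starting point, then `x` lies strictly beyond the support. Strict
monotonicity of the flow leaves a gap there, so `g` is zero in a neighbourhood. -/
lemma differentiableAt_profile (h : IsSelfConsistent g μ) (hg : Profile B g) (ht : 0 ≤ t) {x : ℝ}
    (hx : 0 < x) (hne : (x : EReal) ≠ supportEnd (fun y => profileAt g μ t y)) :
    DifferentiableAt ℝ g (flow μ t x 0) := by
  rcases (hg.nonneg (flow μ t x 0)).eq_or_lt' with h0 | hpos
  · have hle : supportEnd (fun y => profileAt g μ t y) ≤ x := by
      refine sSup_le ?_
      rintro e ⟨y, hy, hwy, rfl⟩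
      rw [EReal.coe_le_coe_iff]
      by_contra hlt
      have := antitone_profileAt (μ := μ) hg ht (not_le.1 hlt).le
      rw [profileAt, profileAt, h0] at this
      exact absurd hwy this.not_gt
    obtain ⟨y, hy1, hy2⟩ := EReal.lt_iff_exists_real_btwn.1 (lt_of_le_of_ne hle hne.symm)
    have hmem : ∀ z : ℝ, 0 ≤ z → 0 < profileAt g μ t z →
        (z : EReal) ≤ supportEnd (fun y => profileAt g μ t y) := fun z hz hwz =>
      le_sSup ⟨z, hz, hwz, rfl⟩
    have hy0 : 0 < y := by
      have := (hmem 0 le_rfl (h.profileAt_zero_pos hg ht)).trans_lt hy1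
      exact_mod_cast this
    have hgy : g (flow μ t y 0) = 0 := by
      refine le_antisymm (not_lt.1 fun hlt => ?_) (hg.nonneg _)
      exact hy1.not_ge (hmem y hy0.le hlt)
    have hlt := flow_zero_lt (μ := μ) ht hy0.le (EReal.coe_lt_coe_iff.1 hy2)
    have : g =ᶠ[𝓝 (flow μ t x 0)] fun _ => 0 := by
      filter_upwards [lt_mem_nhds hlt] with z hz
      exact le_antisymm (hgy ▸ hg.antitone hz.le) (hg.nonneg z)
    exact (differentiableAt_const 0).congr_of_eventuallyEq this
  · exact hg.differentiableAt _ (flow_pos (zero_mem_Icc ht) hx) hpos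

lemma isGlobalSolution (h : IsSelfConsistent g μ) (hg : Profile B g) {w₀ : ℝ → ℝ}
    (hgw : ∀ x, 0 ≤ x → g x = w₀ x) :
    IsGlobalSolution w₀ fun x t => profileAt g μ t x where
  initial x hx := by rw [profileAt_time_zero, hgw x hx]
  memE t ht :=
    { nonneg := fun x _ => hg.nonneg _
      antitone := (antitone_profileAt hg ht).antitoneOn _
      integrable := integrableOn_profileAt hg ht
      rightCont := fun x _ => (hg.rightCont _).comp (t := Ici (flow μ t x 0))
        (continuous_flow_left (zero_mem_Icc ht)).continuousWithinAt
        fun y hy => flow_mono (zero_mem_Icc ht) hy }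
  mass t ht := h.mass hg ht
  L_cont := by
    have h1 : ContinuousOn (fun t => profileAt g μ t 0) (Ici 0) := fun t ht =>
      ContinuousAt.comp_continuousWithinAt (f := fun s => flow μ s 0 0)
        (hg.continuousAt _ (h.profileAt_zero_pos hg ht)) (continuousOn_flow_zero μ t ht)
    refine (((continuousOn_radiusSum hg μ).div h1
      fun t ht => (h.profileAt_zero_pos hg ht).ne').pow 3).congr fun t _ => volumeL_profileAt
  pde x t hx ht hne := by
    obtain ⟨a, h1, h2⟩ := exists_hasDerivAt_flow μ hx ht
    have h3 := (h.differentiableAt_profile hg ht.le hx hne).hasDerivAt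
    refine ⟨_, h3.comp x h1, ?_⟩
    rw [h.div_volumeL_rpow hg ht.le hx.le]
    refine (h3.comp t h2).congr_deriv ?_
    ring
  characteristics x t hx ht := by
    refine ⟨flow μ t x, fun s hs => ⟨flow_nonneg hs hx, ?_⟩, flow_self ht x,
      hgw _ (flow_nonneg (zero_mem_Icc ht) hx)⟩
    rw [h.div_volumeL_rpow hg hs.1 (flow_nonneg hs hx)]
    exact (((isTrajectory_flow ht x) s hs).hasDerivWithinAt).congr_deriv (by ring)

/-! ### The coarsening bound -/

/-- If `Λ₀ ≤ 800 (1 + B)^3 t`, then `L ≤ 27/8 Λ ≤ 4 (Λ₀ + B t)` and `Λ₀` is absorbed. Otherwise `V`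
and `1/w(0,·)` each grow by at most a factor `21/20`, and `(21/20)^6 ≤ 2`. The number `800` is
chosen large enough for these factors. -/
lemma volumeL_le (h : IsSelfConsistent g μ) (hg : Profile B g) (hB : 0 ≤ B) (ht : 0 ≤ t) :
    volumeL (fun x => profileAt g μ t x) ≤
      2 * volumeL (fun x => profileAt g μ 0 x) + 4 * (800 * (1 + B) ^ 3 + B) * t := by
  have hg0 := hg.zero_pos
  have hw := fun s (hs : 0 ≤ s) => h.profileAt_zero_pos hg hs
  have hV := fun s (hs : 0 ≤ s) => h.radiusSum_pos hg hs
  have hΛ := fun s (hs : 0 ≤ s) => inv_profileAt_zero_le (μ := μ) hB hg hs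
    fun u hu => h.mass hg hu.1
  set Λ₀ := 1 / g 0 with hΛ₀
  have hΛ₀0 : 0 < Λ₀ := by positivity
  have hge : ∀ s, 0 ≤ s → Λ₀ ≤ 1 / profileAt g μ s 0 := fun s hs =>
    one_div_le_one_div_of_le (hw s hs) (hg.le_zero _)
  set a := cbrt (Λ₀ / 2) with ha
  have ha0 : 0 < a := cbrt_pos (by positivity)
  have ha3 : a ^ 3 = Λ₀ / 2 := cbrt_pow_three (by positivity)
  have hlow : ∀ s, 0 ≤ s → a / (1 + B) ≤ radiusSum g μ s / profileAt g μ s 0 := by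
    intro s hs
    have h1 := cbrt_mul_le_radiusSum hB hg hs (h.mass hg hs)
    have h2 : a ≤ cbrt (1 / profileAt g μ s 0 / 2) := cbrt_mono (by linarith [hge s hs])
    rw [le_div_iff₀ (hw s hs)]
    calc _ = a * (profileAt g μ s 0 / (1 + B)) := by ring
      _ ≤ _ := mul_le_mul_of_nonneg_right h2 (div_nonneg (hw s hs).le (by positivity))
      _ ≤ _ := h1
  rw [volumeL_profileAt, volumeL_profileAt]
  have hV0 := div_pos (hV 0 le_rfl) (hw 0 le_rfl)
  set ℓ₀ := radiusSum g μ 0 / profileAt g μ 0 0 with hℓ₀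
  rcases le_or_gt Λ₀ (800 * (1 + B) ^ 3 * t) with hlarge | hsmall
  · set Λ := 1 / profileAt g μ t 0 with hΛt
    have hΛ0 : 0 < Λ := hΛ₀0.trans_le (hge t ht)
    have hwt : profileAt g μ t 0 = 1 / Λ := by rw [hΛt, one_div_one_div]
    have hR := cbrt_pos hΛ0
    have hR3 := cbrt_pow_three hΛ0.le
    have h1 := radiusSum_le_of_cube hg ht (h.mass hg ht) hR
    have h2 : radiusSum g μ t / profileAt g μ t 0 ≤ 3 / 2 * cbrt Λ := by
      rw [div_le_iff₀ (hw t ht)]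
      refine h1.trans (le_of_eq ?_)
      rw [hwt, show 1 / Λ = 1 / cbrt Λ ^ 3 by rw [hR3]]
      field_simp
      norm_num
    have h3 := pow_le_pow_left₀ (div_pos (hV t ht) (hw t ht)).le h2 3
    rw [mul_pow, hR3] at h3
    have h4 := hΛ t ht
    have h5 : 0 ≤ ℓ₀ ^ 3 := by positivity
    linarith
  · have h1 : ∀ u ∈ Icc 0 t, μ u ≤ (1 + B) / a := by
      intro u hu
      have h2 := one_div_le_one_div_of_le (by positivity) (hlow u hu.1)
      rwa [one_div_div, one_div_div, ← h.rate_eq hg hu.1] at h2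
    have h2 := radiusSum_le hg (zero_mem_Icc ht) h1
    have hB3 : 1 ≤ (1 + B) ^ 3 := one_le_pow₀ (by linarith)
    have h3 : √(2 / 3 * ((1 + B) / a) * (t - 0)) ≤ ℓ₀ / 20 := by
      refine (Real.sqrt_le_left (by positivity)).2 ?_
      have h4 : (a / (1 + B) / 20) ^ 2 ≤ (ℓ₀ / 20) ^ 2 := by
        have := hlow 0 le_rfl
        gcongr
      refine le_trans ?_ h4
      rw [sub_zero, show 2 / 3 * ((1 + B) / a) * t = 2 / 3 * (1 + B) * t / a by ring,
        show (a / (1 + B) / 20) ^ 2 = a ^ 2 / (400 * (1 + B) ^ 2) by field_simp; norm_num,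
        div_le_div_iff₀ ha0 (by positivity)]
      have h5 : a ^ 2 * a = Λ₀ / 2 := by rw [← ha3]; ring
      rw [h5]
      nlinarith
    have h6 : B * t ≤ Λ₀ / 20 := by
      have : 800 * B * t ≤ 800 * (1 + B) ^ 3 * t := by
        have : B ≤ (1 + B) ^ 3 := by nlinarith [pow_nonneg hB 3, pow_nonneg hB 2]
        gcongr
      linarith
    have h7 : profileAt g μ 0 0 = 1 / Λ₀ := by rw [profileAt_time_zero, hΛ₀, one_div_one_div]
    have h8 : radiusSum g μ 0 = ℓ₀ / Λ₀ := by rw [hℓ₀, h7]; field_simp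
    have h9 : radiusSum g μ t / profileAt g μ t 0 ≤ (ℓ₀ * (21 / 20)) * (21 / 20) := by
      have h10 : radiusSum g μ t ≤ ℓ₀ * (21 / 20) / Λ₀ := by
        refine h2.trans ?_
        rw [h7, h8, mul_one_div, ← add_div]
        gcongr
        linarith
      have h11 : 1 / profileAt g μ t 0 ≤ Λ₀ * (21 / 20) := by linarith [hΛ t ht]
      calc _ = radiusSum g μ t * (1 / profileAt g μ t 0) := by ring
        _ ≤ (ℓ₀ * (21 / 20) / Λ₀) * (Λ₀ * (21 / 20)) :=
          mul_le_mul h10 h11 (one_div_pos.2 (hw t ht)).le (by positivity)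
        _ = _ := by field_simp
    have h12 := pow_le_pow_left₀ (div_pos (hV t ht) (hw t ht)).le h9 3
    have h13 : 0 ≤ 4 * (800 * (1 + B) ^ 3 + B) * t := by positivity
    have h14 : 0 ≤ ℓ₀ ^ 3 := by positivity
    calc _ ≤ (ℓ₀ * (21 / 20) * (21 / 20)) ^ 3 := h12
      _ = ℓ₀ ^ 3 * ((21 / 20) ^ 6) := by ring
      _ ≤ ℓ₀ ^ 3 * 2 := mul_le_mul_of_nonneg_left (by norm_num) h14
      _ ≤ _ := by linarith

end IsSelfConsistent

end

/-! ### From the hypotheses on the initial data to a profile -/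

section InitialData

variable {w₀ : ℝ → ℝ}

lemma MemE.exists_gt_pos (hw : MemE w₀) {x : ℝ} (hx : 0 ≤ x) (hpos : 0 < w₀ x) :
    ∃ y, x < y ∧ 0 < w₀ y := by
  have h1 := (hw.rightCont x hx).eventually (lt_mem_nhds hpos)
  obtain ⟨y, hy1, hy2⟩ := ((h1.filter_mono (nhdsWithin_mono x Ioi_subset_Ici_self)).and
    self_mem_nhdsWithin).exists
  exact ⟨y, hy2, hy1⟩

lemma MemE.mem_betaDomain_iff (hw : MemE w₀) {x : ℝ} :
    x ∈ betaDomain w₀ ↔ 0 ≤ x ∧ 0 < w₀ x := by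
  constructor
  · rintro ⟨hx, hlt⟩
    obtain ⟨e, ⟨y, hy, hwy, rfl⟩, hxy⟩ := lt_sSup_iff.1 hlt
    exact ⟨hx, hwy.trans_le (hw.antitone hx hy (EReal.coe_lt_coe_iff.1 hxy).le)⟩
  · rintro ⟨hx, hpos⟩
    obtain ⟨y, hxy, hwy⟩ := hw.exists_gt_pos hx hpos
    exact ⟨hx, (EReal.coe_lt_coe_iff.2 hxy).trans_le (le_sSup ⟨y, hx.trans hxy.le, hwy, rfl⟩)⟩

lemma MemE.hasDerivWithinAt_tail (hw : MemE w₀) {x : ℝ} (hx : 0 ≤ x) :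
    HasDerivWithinAt (tail w₀) (-w₀ x) (Ici x) x := by
  have hi : ∀ y, x ≤ y → IntervalIntegrable w₀ volume x y := fun y hxy =>
    (intervalIntegrable_iff_integrableOn_Ioc_of_le hxy).2
      (hw.integrable.mono_set (Ioc_subset_Ioi_self.trans (Ioi_subset_Ioi hx)))
  have htail : ∀ y, x ≤ y → tail w₀ y = tail w₀ x - ∫ z in x..y, w₀ z := by
    intro y hxy
    rw [intervalIntegral.integral_of_le hxy, tail, tail, ← Ioc_union_Ioi_eq_Ioi hxy,
      setIntegral_union (Ioc_disjoint_Ioi le_rfl) measurableSet_Ioi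
      (hw.integrable.mono_set (Ioc_subset_Ioi_self.trans (Ioi_subset_Ioi hx)))
      (hw.integrable.mono_set (Ioi_subset_Ioi (hx.trans hxy)))]
    ring
  have hmeas : StronglyMeasurableAtFilter w₀ (𝓝[Ioi x] x) volume :=
    ⟨Ioi x, self_mem_nhdsWithin,
      (hw.integrable.mono_set (Ioi_subset_Ioi hx)).aestronglyMeasurable⟩
  have h := intervalIntegral.integral_hasDerivWithinAt_right (hi x le_rfl) hmeas
    ((hw.rightCont x hx).mono Ioi_subset_Ici_self) (s := Ici x)
  have h2 := h.const_sub (tail w₀ x)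
  exact h2.congr (fun y hy => htail y hy) (htail x le_rfl)

/-- Right continuity alone gives only the right derivative of the tail; smoothness supplies a
two-sided one, and the two must agree. -/
lemma MemE.hasDerivAt_tail (hw : MemE w₀) (hc : ContDiffOn ℝ 2 (tail w₀) (betaDomain w₀)) {x y : ℝ}
    (hx : x ∈ Ioo 0 y) (hy : 0 < w₀ y) : HasDerivAt (tail w₀) (-w₀ x) x := by
  have hD : betaDomain w₀ ∈ 𝓝 x := by
    filter_upwards [Ioo_mem_nhds hx.1 hx.2] with z hz
    exact hw.mem_betaDomain_iff.2 ⟨hz.1.le, hy.trans_le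
      (hw.antitone hz.1.le (hz.1.trans hz.2).le hz.2.le)⟩
  have h1 := ((hc.contDiffAt hD).differentiableAt (by norm_num)).hasDerivAt
  have h2 := (uniqueDiffWithinAt_Ici x).eq_deriv _ h1.hasDerivWithinAt
    (hw.hasDerivWithinAt_tail hx.1.le)
  rwa [h2] at h1

lemma MemE.hasDerivAt (hw : MemE w₀) (hc : ContDiffOn ℝ 2 (tail w₀) (betaDomain w₀)) {B : ℝ}
    (hB : ∀ x ∈ betaDomain w₀, beta w₀ x ≤ B) {x : ℝ} (hx : 0 < x) (hpos : 0 < w₀ x) :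
    ∃ a, HasDerivAt w₀ a x ∧ -a * tail w₀ x ≤ B * w₀ x ^ 2 := by
  obtain ⟨y, hxy, hwy⟩ := hw.exists_gt_pos hx.le hpos
  have hmem : x ∈ Ioo 0 y := ⟨hx, hxy⟩
  have hsub : Ioo 0 y ⊆ betaDomain w₀ := fun z hz => hw.mem_betaDomain_iff.2 ⟨hz.1.le,
    hwy.trans_le (hw.antitone hz.1.le (hz.1.trans hz.2).le hz.2.le)⟩
  have hc2 : ContDiffOn ℝ (1 + 1) (tail w₀) (Ioo 0 y) := by
    have := hc.mono hsub
    rwa [show (2 : WithTop ℕ∞) = 1 + 1 by norm_num] at this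
  have hd := ((contDiffOn_succ_iff_deriv_of_isOpen isOpen_Ioo).1 hc2).2.2
  have hd1 : DifferentiableAt ℝ (deriv (tail w₀)) x :=
    (hd.contDiffAt (isOpen_Ioo.mem_nhds hmem)).differentiableAt (by norm_num)
  have heq : deriv (tail w₀) =ᶠ[𝓝 x] fun z => -w₀ z := by
    filter_upwards [isOpen_Ioo.mem_nhds hmem] with z hz
    exact (hw.hasDerivAt_tail hc hz hwy).deriv
  have hd2 : HasDerivAt w₀ (-deriv (deriv (tail w₀)) x) x := by
    have := (hd1.hasDerivAt.congr_of_eventuallyEq heq.symm).neg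
    simpa [Pi.neg_def] using this
  refine ⟨_, hd2, ?_⟩
  have hb := hB x (hsub hmem)
  have hIci : Ici (0 : ℝ) ∈ 𝓝 x := Ici_mem_nhds hx
  have e1 : derivWithin (tail w₀) (Ici 0) x = -w₀ x := by
    rw [derivWithin_of_mem_nhds hIci, heq.eq_of_nhds]
  have e2 : iteratedDerivWithin 2 (tail w₀) (Ici 0) x = deriv (deriv (tail w₀)) x := by
    rw [iteratedDerivWithin_succ, derivWithin_of_mem_nhds hIci]
    refine Filter.EventuallyEq.deriv_eq ?_
    filter_upwards [lt_mem_nhds hx] with z hz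
    have hz' : Ici (0 : ℝ) ∈ 𝓝 z := Ici_mem_nhds hz
    rw [iteratedDerivWithin_one, derivWithin_of_mem_nhds hz']
  rw [beta, e1, e2, neg_sq, div_le_iff₀ (by positivity)] at hb
  linarith

lemma tail_extend {x : ℝ} (hx : 0 ≤ x) : tail (fun y => w₀ (max y 0)) x = tail w₀ x :=
  setIntegral_congr_fun measurableSet_Ioi fun y hy => by
    rw [max_eq_left (hx.trans (le_of_lt hy))]

/-- With `h = tail w₀` one has `(1/w₀)' = β/h`, and on `[x,y]` this is at most `B / h(y)` because
`h` decreases. The mean value inequality integrates the bound. -/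
lemma MemE.profile (hw : MemE w₀) (hm : ∫ x in Ioi (0 : ℝ), w₀ x = 1)
    (hc : ContDiffOn ℝ 2 (tail w₀) (betaDomain w₀)) {B : ℝ}
    (hB : ∀ x ∈ betaDomain w₀, beta w₀ x ≤ B) (hB0 : 0 ≤ B) :
    Profile B fun x => w₀ (max x 0) := by
  have hanti : Antitone fun x => w₀ (max x 0) := fun x y hxy =>
    hw.antitone (mem_Ici.2 (le_max_right _ _)) (mem_Ici.2 (le_max_right _ _))
      (max_le_max_right 0 hxy)
  have heq : ∀ x, 0 < x → (fun x => w₀ (max x 0)) =ᶠ[𝓝 x] w₀ := fun x hx => by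
    filter_upwards [lt_mem_nhds hx] with y hy
    rw [max_eq_left hy.le]
  have hright : ∀ x, ContinuousWithinAt (fun x => w₀ (max x 0)) (Ici x) x := fun x =>
    (hw.rightCont (max x 0) (le_max_right _ _)).comp (f := fun x => max x 0)
      (by fun_prop) fun y hy => mem_Ici.2 (max_le_max_right 0 (mem_Ici.1 hy))
  have hcont : ∀ x, 0 < w₀ (max x 0) → ContinuousAt (fun x => w₀ (max x 0)) x := by
    intro x hpos
    rcases le_or_gt x 0 with hx | hx
    · refine continuousAt_iff_continuous_left_right.2 ⟨?_, hright x⟩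
      refine (continuousWithinAt_const (b := w₀ 0)).congr (fun y hy => ?_) ?_
      · rw [max_eq_right (le_trans hy hx)]
      · rw [max_eq_right hx]
    · rw [max_eq_left hx.le] at hpos
      obtain ⟨a, ha, -⟩ := hw.hasDerivAt hc hB hx hpos
      exact ha.continuousAt.congr (heq x hx).symm
  refine ⟨fun x => hw.nonneg _ (le_max_right _ _), hanti, fun x hx => by simp [max_eq_right hx],
    ?_, ?_, hright, hcont, ?_, ?_⟩
  · exact hw.integrable.congr_fun (fun x hx => by rw [max_eq_left (le_of_lt hx)]) measurableSet_Ioi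
  · exact (tail_extend (w₀ := w₀) le_rfl).trans hm
  · intro x hx hpos
    rw [max_eq_left hx.le] at hpos
    obtain ⟨a, ha, -⟩ := hw.hasDerivAt hc hB hx hpos
    exact ha.differentiableAt.congr_of_eventuallyEq (heq x hx)
  · intro x y hx hxy hpos
    have hpz : ∀ z ∈ Icc x y, 0 < w₀ (max z 0) := fun z hz => hpos.trans_le (hanti hz.2)
    have hmono : ∀ z, z ∈ Icc x y → tail w₀ y ≤ tail w₀ z := fun z hz =>
      setIntegral_mono_set (hw.integrable.mono_set (Ioi_subset_Ioi (hx.trans hz.1)))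
        (ae_restrict_of_forall_mem measurableSet_Ioi fun u hu =>
          hw.nonneg u ((hx.trans hz.1).trans (le_of_lt hu)))
        (Ioi_subset_Ioi hz.2).eventuallyLE
    have hy0 : 0 ≤ y := hx.trans hxy
    have htail : 0 < tail w₀ y := by
      rw [max_eq_left hy0] at hpos
      obtain ⟨z, hyz, hwz⟩ := hw.exists_gt_pos hy0 hpos
      have hi := hw.integrable.mono_set (Ioi_subset_Ioi hy0)
      calc 0 < (z - y) * w₀ z := mul_pos (sub_pos.2 hyz) hwz
        _ = ∫ u in Ioc y z, w₀ z := by simp [hyz.le]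
        _ ≤ ∫ u in Ioc y z, w₀ u := setIntegral_mono_on (by simp)
          (hi.mono_set Ioc_subset_Ioi_self) measurableSet_Ioc
          fun u hu => hw.antitone (hy0.trans hu.1.le) (hy0.trans hyz.le) hu.2
        _ ≤ _ := setIntegral_mono_set hi (ae_restrict_of_forall_mem measurableSet_Ioi fun u hu =>
          hw.nonneg u (hy0.trans (le_of_lt hu))) Ioc_subset_Ioi_self.eventuallyLE
    have hder : ∀ z ∈ Ioo x y, ∃ a, HasDerivAt (fun z => 1 / w₀ (max z 0)) a z ∧
        a ≤ B / tail w₀ y := by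
      intro z hz
      have hz0 : 0 < z := hx.trans_lt hz.1
      have hzp := hpz z (Ioo_subset_Icc_self hz)
      rw [max_eq_left hz0.le] at hzp
      obtain ⟨a, ha, hab⟩ := hw.hasDerivAt hc hB hz0 hzp
      have h1 : HasDerivAt (fun z => w₀ (max z 0)) a z := ha.congr_of_eventuallyEq (heq z hz0)
      have h2 := h1.fun_inv (by rw [max_eq_left hz0.le]; exact hzp.ne')
      simp only [one_div]
      refine ⟨_, h2, ?_⟩
      rw [max_eq_left hz0.le]
      have h3 := hmono z (Ioo_subset_Icc_self hz)
      calc -a / w₀ z ^ 2 ≤ B / tail w₀ z := by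
            rw [div_le_div_iff₀ (by positivity) (htail.trans_le h3)]
            exact hab
        _ ≤ _ := div_le_div_of_nonneg_left hB0 htail h3
    rw [tail_extend hy0]
    have := (convex_Icc x y).image_sub_le_mul_sub_of_deriv_le (C := B / tail w₀ y)
      (f := fun z => 1 / w₀ (max z 0))
      (fun z hz => ((continuousAt_const.div (hcont z (hpz z hz))
        (hpz z hz).ne')).continuousWithinAt)
      (fun z hz => by
        rw [interior_Icc] at hz
        obtain ⟨a, ha, -⟩ := hder z hz
        exact ha.differentiableAt.differentiableWithinAt)
      (fun z hz => by
        rw [interior_Icc] at hz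
        obtain ⟨a, ha, hab⟩ := hder z hz
        rwa [ha.deriv])
      x ⟨le_rfl, hxy⟩ y ⟨hxy, le_rfl⟩ hxy
    calc _ ≤ B / tail w₀ y * (y - x) := this
      _ = _ := by ring

end InitialData

end LSW

end

theorem proposition4p1 (βinf : ℝ) :
    ∃ C : ℝ, 0 < C ∧ ∀ w₀ : ℝ → ℝ,
      LSW.MemE w₀ →
      ∫ x in Set.Ioi (0 : ℝ), w₀ x = 1 →
      ContDiffOn ℝ 2 (LSW.tail w₀) (LSW.betaDomain w₀) →
      (∀ x ∈ LSW.betaDomain w₀, LSW.beta w₀ x ≤ βinf) →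
      ∃ w : ℝ → ℝ → ℝ, LSW.IsGlobalSolution w₀ w ∧
        ∀ t : ℝ, 0 ≤ t →
          LSW.volumeL (fun x => w x t) ≤ 2 * LSW.volumeL (fun x => w x 0) + C * t := by
  -- Enlarging the bound to a nonnegative one is harmless, and the comparison of tails in
  -- denominators needs the sign.
  have hB : 0 ≤ max βinf 0 := le_max_right _ _
  refine ⟨4 * (800 * (1 + max βinf 0) ^ 3 + max βinf 0), by positivity,
    fun w₀ hw hm hc hβ => ?_⟩
  have hg := hw.profile hm hc (fun x hx => (hβ x hx).trans (le_max_left βinf 0)) hB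
  obtain ⟨μ, hμ⟩ := LSW.exists_isSelfConsistent hB hg
  exact ⟨_, hμ.isGlobalSolution hg fun x hx => by rw [max_eq_left hx],
    fun t ht => hμ.volumeL_le hg hB ht⟩
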